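/- **Setting.** Let $T>0$, let $\Omega\subset\mathbb R^3$ be a bounded $C^2$ domain with outer unit normal $\mathbf n$, and put $Q=(0,T)\times\Omega$. Let $F:\mathbb R^{3\times3}_{\rm sym}\to[0,\infty)$ be convex with $F(0)=0$ and, for some $\mu>0$, $q>1$, $F(\mathbb D)\ge\mu|\mathbb D-\frac13{\rm tr}[\mathbb D]\mathbb I|^q$ whenever $|\mathbb D|>1$; let $F^*$ be its convex conjugate and $\bar d>0$ a constant. The data satisfy: $0\le\varrho_0\le1$, $\varrho_0\in L^1(\Omega)$, $\varrho_0\not\equiv0$, the mean of $\varrho_0$ over $\Omega$ is $<1$; $\mathbf m_0\in L^2(\Omega)$, $\mathbf m_0=0$ a.e. on $\{\varrho_0=0\}$, $\mathbf u_0=\mathbf m_0/\varrho_0$ on $\{\varrho_0>0\}$, $\varrho_0|\mathbf u_0|^2\in L^2(\Omega)$; $\mathbf u_B\in C^2(\partial\Omega;\mathbb R^3)$, $\int_{\partial\Omega}\mathbf u_B\cdot\mathbf n\,dS\ge0$, extended to a field (still $\mathbf u_B$) in $C^1(\overline\Omega;\mathbb R^3)$; with $\Gamma_{\rm in}=\{\mathbf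 u_B\cdot\mathbf n<0\}$, $\Gamma_{\rm out}=\{\mathbf u_B\cdot\mathbf n\ge0\}\subset\partial\Omega$, $\varrho_B\in C^1(\partial\Omega)$, $0<\varrho_B\le1$ on $\Gamma_{\rm in}$, $\inf_{\Gamma_{\rm in}}\varrho_B>0$. We write $(\nabla_x\mathbf v)_{ij}=\partial_jv_i$, $\mathbb D_x\mathbf v=\frac12(\nabla_x\mathbf v+\nabla_x\mathbf v^t)$. **Generalized dissipative solution.** $(\varrho,\mathbf u,\mathbb S,\pi)$, together with a Reynolds defect $\mathfrak R$, is a generalized dissipative solution if: (i) $0\le\varrho\le1$ a.e. in $Q$, $\varrho\in C_{\rm weak}([0,T];L^\gamma(\Omega))\cap L^\gamma(0,T;L^\gamma(\partial\Omega;|\mathbf u_B\cdot\mathbf n|dS))$ for all $\gamma>1$, $\varrho(0,\cdot)=\varrho_0$; $\mathbf u\in L^q(0,T;W^{1,q}(\Omega;\mathbb R^3))$, $\mathbf u-\mathbf u_B\in L^q(0,T;W^{1,q}_0(\Omega;\mathbb R^3))$; $\varrho\mathbf u\in C_{\rm weak}([0,T];L^{2\gamma/(\gamma+1)}(\Omega;\mathbb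 R^3))$ for all $\gamma>1$, with initial value $\mathbf m_0$, and $\varrho|\mathbf u|^2\in L^1(Q)$; $\mathbb S\in L^1(Q;\mathbb R^{3\times3}_{\rm sym})$; $\mathfrak R\in L^\infty(0,T;\mathcal M^+(\overline\Omega;\mathbb R^{3\times3}_{\rm sym}))$ (positive semidefinite matrix-valued measures); $\pi$ is a nonnegative Radon measure on $Q$ with $(\varrho-1)\pi=0$, and ${\rm div}_x\mathbf u=0$ a.e. on $\{\varrho=1\}$. (ii) For all $\varphi\in C^1([0,T]\times\overline\Omega)$, $$\Big[\int_\Omega\varrho\varphi\,dx\Big]_{t=0}^{t=T}=\int_0^T\!\!\int_\Omega\big[\varrho\partial_t\varphi+\varrho\mathbf u\cdot\nabla_x\varphi\big]dx\,dt-\int_0^T\!\!\int_{\Gamma_{\rm out}}\varphi\varrho\,\mathbf u_B\cdot\mathbf n\,dS\,dt-\int_0^T\!\!\int_{\Gamma_{\rm in}}\varphi\varrho_B\,\mathbf u_B\cdot\mathbf n\,dS\,dt.$$ (iii) For all $\boldsymbol\varphi\in C^1_c(Q;\mathbb R^3)$, $$0=\int_Q\big[\varrho\mathbf u\cdot\partial_t\boldsymbol\varphi+\varrho\mathbf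 u\otimes\mathbf u:\nabla_x\boldsymbol\varphi-\mathbb S:\nabla_x\boldsymbol\varphi\big]dx\,dt+\int_Q{\rm div}_x\boldsymbol\varphi\,d\pi+\int_0^T\!\!\int_\Omega\nabla_x\boldsymbol\varphi:d\mathfrak R(t)\,dt.$$ (iv) $F(\mathbb D_x\mathbf u)+F^*(\mathbb S)\in L^1(Q)$, ${\rm div}_x\mathbf u_B$ is $\pi$-integrable, and for a.e. $\tau\in(0,T)$ $$\int_\Omega\tfrac12\varrho|\mathbf u-\mathbf u_B|^2(\tau)\,dx-\int_\Omega\tfrac12\varrho_0|\mathbf u_0-\mathbf u_B|^2dx+\int_0^\tau\!\!\int_\Omega\big[F(\mathbb D_x\mathbf u)+F^*(\mathbb S)\big]dx\,dt+\int_{(0,\tau)\times\Omega}{\rm div}_x\mathbf u_B\,d\pi+\frac1{\bar d}\int_{\overline\Omega}d\,{\rm tr}[\mathfrak R](\tau)$$ $$\le-\int_0^\tau\!\!\int_{\overline\Omega}\nabla_x\mathbf u_B:d\mathfrak R(t)\,dt-\int_0^\tau\!\!\int_\Omega\varrho\mathbf u\otimes\mathbf u:\nabla_x\mathbf u_B\,dx\,dt+\int_0^\tau\!\!\int_\Omega\varrho\sum_{i,j}u_j(\mathbf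 u_B)_i\,\partial_j(\mathbf u_B)_i\,dx\,dt+\int_0^\tau\!\!\int_\Omega\mathbb S:\nabla_x\mathbf u_B\,dx\,dt.$$ **Theorem 2.** Let $(\varrho,\mathbf u,\mathbb S,\pi)$ be a generalized dissipative solution with Reynolds defect $\mathfrak R$ such that $$\mathbf u\in C^1([0,T]\times\overline\Omega;\mathbb R^3),\quad\varrho\in C^1([0,T]\times\overline\Omega),\quad\inf_{(0,T)\times\Omega}\varrho>0,$$ and $\pi$ has a density with respect to Lebesgue measure, again denoted $\pi$, with $\pi\in C([0,T]\times\overline\Omega)$. Then: 1. The equations hold in the classical sense: at every point of $Q$, $\partial_t\varrho+{\rm div}_x(\varrho\mathbf u)=0$, $0\le\varrho\le1$, ${\rm div}_x\mathbf u=0$ where $\varrho=1$, $\pi=0$ where $\varrho<1$, and $\pi\ge0$ where $\varrho=1$; and $$\partial_t(\varrho\mathbf u)+{\rm div}_x(\varrho\mathbf u\otimes\mathbf u)-{\rm div}_x\mathbb S+\nabla_x\pi=0,$$ where the first two terms are classical derivatives (continuous functions) and ${\rm div}_x\mathbb S-\nabla_x\pi$ is taken in the sense of distributions on $Q$ (no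 differentiability of $\mathbb S$ and $\pi$ is assumed); this equation holds at every point of every open subset of $Q$ on which $\pi$ is $C^1$ and $\mathbb S$ agrees a.e. with a $C^1$ field. 2. $\mathfrak R(t)=0$ for a.e. $t\in(0,T)$. 3. $\mathbb S\in\partial F(\mathbb D_x\mathbf u)$ a.e. in $Q$. -/

import Mathlib

open MeasureTheory Set Filter Topology
open scoped ENNReal ContDiff

namespace FreeBoundary

noncomputable section

/-- Physical space `ℝ³`, with the Euclidean norm. -/
abbrev E3 : Type := EuclideanSpace ℝ (Fin 3)

/-- Real `3 × 3` matrices. -/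
abbrev M3 : Type := Matrix (Fin 3) (Fin 3) ℝ

/-! ### Matrices, differential operators -/

/-- The contraction `A : B`. -/
def frob (A B : M3) : ℝ := ∑ i, ∑ j, A i j * B i j

/-- The Frobenius norm `|A|`. -/
def frobNorm (A : M3) : ℝ := Real.sqrt (frob A A)

/-- The symmetric part of a matrix. -/
def symPart (A : M3) : M3 := (1 / 2 : ℝ) • (A + A.transpose)

/-- The traceless part of a matrix. -/
def devPart (A : M3) : M3 := A - (A.trace / 3) • (1 : M3)

/-- The partial derivative `∂_j f (x)`. -/
def pderiv (j : Fin 3) (f : E3 → ℝ) (x : E3) : ℝ :=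
  fderiv ℝ f x (EuclideanSpace.single j 1)

/-- The gradient matrix `(∇v)_{ij} = ∂_j v_i`. -/
def grad (v : E3 → E3) (x : E3) : M3 :=
  Matrix.of fun i j => fderiv ℝ v x (EuclideanSpace.single j 1) i

/-- The gradient matrix of a field given on `closure Ω`; at the points of the open set `Ω` it is
`grad v`, at boundary points it is the continuous extension of it (for `v ∈ C¹` up to the boundary
of a regular domain). -/
def gradUpTo (Ω : Set E3) (v : E3 → E3) (x : E3) : M3 :=
  Matrix.of fun i j => fderivWithin ℝ v (closure Ω) x (EuclideanSpace.single j 1) i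

/-! ### The viscous potential -/

/-- The convex conjugate `F*(S) = sup { S : D - F(D) | D symmetric }`, with values in `[-∞, ∞]`. -/
def conjugate (F : M3 → ℝ) (S : M3) : EReal :=
  ⨆ D : {D : M3 // D.IsSymm}, ((frob S D.1 - F D.1 : ℝ) : EReal)

/-- `S ∈ ∂F(D)`: the subdifferential of a function on the space of symmetric matrices. -/
def MemSubdifferential (F : M3 → ℝ) (D S : M3) : Prop :=
  S.IsSymm ∧ ∀ D' : M3, D'.IsSymm → F D + frob S (D' - D) ≤ F D'

/-- `F : ℝ^{3×3}_sym → [0, ∞)` is convex, `F(0) = 0`, and `F(D) ≥ μ |D - (tr D / 3) I|^q` for all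
symmetric `D` with `|D| > 1`. Values of `F` off the symmetric matrices are never used. -/
structure IsPotential (F : M3 → ℝ) (q : ℝ) : Prop where
  convex : ConvexOn ℝ {D : M3 | D.IsSymm} F
  nonneg : ∀ D : M3, D.IsSymm → 0 ≤ F D
  zero : F 0 = 0
  one_lt : 1 < q
  growth : ∃ μ : ℝ, 0 < μ ∧ ∀ D : M3, D.IsSymm → 1 < frobNorm D →
    μ * frobNorm (devPart D) ^ q ≤ F D

/-! ### Domains of class `C²`, outer normal -/

/-- `ψ` is a `C²` defining function of `Ω` near the boundary point `x`. -/
def IsDefiningFunction (Ω : Set E3) (x : E3) (ψ : E3 → ℝ) : Prop :=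
  ContDiff ℝ 2 ψ ∧ fderiv ℝ ψ x ≠ 0 ∧ ∀ᶠ y in 𝓝 x, (y ∈ Ω ↔ ψ y < 0)

/-- A bounded domain (nonempty, open, connected) of class `C²`. -/
structure IsC2Domain (Ω : Set E3) : Prop where
  isOpen : IsOpen Ω
  isConnected : IsConnected Ω
  isBounded : Bornology.IsBounded Ω
  boundary : ∀ x ∈ frontier Ω, ∃ ψ, IsDefiningFunction Ω x ψ

/-- `n` is the outer unit normal at the boundary point `x`: the normalized gradient of a local
defining function. -/
def IsOuterNormal (Ω : Set E3) (x n : E3) : Prop :=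
  ∃ ψ, IsDefiningFunction Ω x ψ ∧ n = ‖gradient ψ x‖⁻¹ • gradient ψ x

open Classical in
/-- The outer unit normal field (zero where there is none). -/
def outerNormal (Ω : Set E3) (x : E3) : E3 :=
  if h : ∃ n, IsOuterNormal Ω x n then h.choose else 0

/-- The surface measure of `∂Ω`: two-dimensional Hausdorff measure, normalized to agree with area
on planes. -/
def surfaceMeasure (Ω : Set E3) : Measure E3 :=
  (Measure.euclideanHausdorffMeasure 2).restrict (frontier Ω)

/-- `f ∈ C^k(∂Ω)`: the values of `f` on `∂Ω` are those of a `C^k` function. -/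
def IsCkOnBoundary {V : Type*} [NormedAddCommGroup V] [NormedSpace ℝ V]
    (k : ℕ) (Ω : Set E3) (f : E3 → V) : Prop :=
  ∃ g : E3 → V, ContDiff ℝ k g ∧ EqOn g f (frontier Ω)

/-! ### Function spaces -/

/-- `H` is the weak gradient of `v` in `Ω`. -/
def IsWeakGradient (Ω : Set E3) (v : E3 → E3) (H : E3 → M3) : Prop :=
  ∀ φ : E3 → ℝ, ContDiff ℝ ∞ φ → HasCompactSupport φ → tsupport φ ⊆ Ω →
    ∀ i j, ∫ x in Ω, v x i * pderiv j φ x = - ∫ x in Ω, H x i j * φ x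

/-- `v ∈ W^{1,q}_0(Ω)` with gradient `H`: `(v, H)` is a limit in `L^q(Ω)` of pairs `(φ, ∇φ)` with
`φ` smooth and compactly supported in `Ω`. -/
def MemW0 (q : ℝ) (Ω : Set E3) (v : E3 → E3) (H : E3 → M3) : Prop :=
  ∀ ε : ℝ≥0∞, ε ≠ 0 → ∃ φ : E3 → E3,
    ContDiff ℝ ∞ φ ∧ HasCompactSupport φ ∧ tsupport φ ⊆ Ω ∧
    eLpNorm (fun x => v x - φ x) (ENNReal.ofReal q) (volume.restrict Ω) < ε ∧
    ∀ i j, eLpNorm (fun x => H x i j - grad φ x i j) (ENNReal.ofReal q) (volume.restrict Ω) < ε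

/-- `f ∈ C_weak([0,T]; L^p(Ω))`, `1 < p < ∞`; the dual exponent is `p / (p - 1)`. -/
def WeaklyContinuous {V : Type*} [NormedAddCommGroup V] [InnerProductSpace ℝ V]
    (p T : ℝ) (Ω : Set E3) (f : ℝ → E3 → V) : Prop :=
  (∀ t ∈ Icc 0 T, MemLp (f t) (ENNReal.ofReal p) (volume.restrict Ω)) ∧
  ∀ ψ : E3 → V, MemLp ψ (ENNReal.ofReal (p / (p - 1))) (volume.restrict Ω) →
    ContinuousOn (fun t => ∫ x in Ω, inner ℝ (f t x) (ψ x)) (Icc 0 T)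

/-! ### Tensor valued measures -/

/-- A matrix valued measure on `ℝ³`. -/
abbrev TensorMeasure : Type := VectorMeasure E3 M3

/-- The `(i, j)` entry of a matrix valued measure. -/
def TensorMeasure.entry (R : TensorMeasure) (i j : Fin 3) : SignedMeasure E3 :=
  R.mapRange (Matrix.entryAddMonoidHom ℝ i j) (continuous_id.matrix_elem i j)

/-- `∫_K A : dR`. -/
def TensorMeasure.pairing (R : TensorMeasure) (K : Set E3) (A : E3 → M3) : ℝ :=
  ∑ i, ∑ j, ∫ᵛ x in K, A x i j ∂<•(R.entry i j)

/-- `R ∈ M⁺(K; ℝ^{3×3}_sym)`: `R` lives on `K`, and its values are symmetric positive semidefinite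
matrices. -/
def TensorMeasure.IsPosOn (R : TensorMeasure) (K : Set E3) : Prop :=
  (∀ A : Set E3, Disjoint A K → R A = 0) ∧ ∀ A : Set E3, (R A).PosSemidef

/-- `R ∈ L^∞(0,T; M⁺(K; ℝ^{3×3}_sym))`: weakly-* measurable and essentially bounded. For positive
semidefinite measures the trace of the total mass is equivalent to the total variation. -/
structure IsBoundedDefect (T : ℝ) (K : Set E3) (R : ℝ → TensorMeasure) : Prop where
  measurable : ∀ f : E3 → ℝ, Continuous f → ∀ i j,
    AEMeasurable (fun t => ∫ᵛ x in K, f x ∂<•((R t).entry i j)) (volume.restrict (Ioo 0 T))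
  pos : ∀ᵐ t ∂(volume.restrict (Ioo 0 T)), (R t).IsPosOn K
  bounded : ∃ C : ℝ, ∀ᵐ t ∂(volume.restrict (Ioo 0 T)), (R t K).trace ≤ C

/-! ### The problem -/

/-- The data of the problem: domain, length of the time interval, viscous potential with its growth
exponent, initial density and momentum, boundary density, boundary velocity (given by a field
`uB` on `closure Ω`, that extends the boundary values), and the constant of the energy
inequality. -/
structure Data where
  Ω : Set E3
  T : ℝ
  F : M3 → ℝ
  q : ℝ
  rho0 : E3 → ℝ
  m0 : E3 → E3
  rhoB : E3 → ℝ
  uB : E3 → E3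
  dbar : ℝ

namespace Data

variable (P : Data)

/-- The open space-time cylinder `(0,T) × Ω`. -/
def Q : Set (ℝ × E3) := Ioo 0 P.T ×ˢ P.Ω

/-- The closed space-time cylinder `[0,T] × closure Ω`. -/
def Qc : Set (ℝ × E3) := Icc 0 P.T ×ˢ closure P.Ω

/-- The normal component `u_B · n` on the boundary. -/
def flux (x : E3) : ℝ := inner ℝ (P.uB x) (outerNormal P.Ω x)

/-- The inflow part of the boundary. -/
def Γin : Set E3 := {x ∈ frontier P.Ω | P.flux x < 0}

/-- The outflow part of the boundary. -/
def Γout : Set E3 := {x ∈ frontier P.Ω | 0 ≤ P.flux x}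

/-- The initial velocity `m₀ / ϱ₀` (zero where `ϱ₀` vanishes). -/
def u0 (x : E3) : E3 := (P.rho0 x)⁻¹ • P.m0 x

/-- `∇u_B` on `closure Ω`. -/
def gradB (x : E3) : M3 := gradUpTo P.Ω P.uB x

/-- The standing assumptions on the data. -/
structure Admissible : Prop where
  T_pos : 0 < P.T
  domain : IsC2Domain P.Ω
  potential : IsPotential P.F P.q
  dbar_pos : 0 < P.dbar
  rho0_bounds : ∀ᵐ x ∂(volume.restrict P.Ω), 0 ≤ P.rho0 x ∧ P.rho0 x ≤ 1
  rho0_integrable : IntegrableOn P.rho0 P.Ω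
  rho0_ne : ¬ (P.rho0 =ᵐ[volume.restrict P.Ω] 0)
  rho0_mean : ⨍ x in P.Ω, P.rho0 x < 1
  m0_memLp : MemLp P.m0 2 (volume.restrict P.Ω)
  m0_vacuum : ∀ᵐ x ∂(volume.restrict P.Ω), P.rho0 x = 0 → P.m0 x = 0
  energy0 : MemLp (fun x => P.rho0 x * ‖P.u0 x‖ ^ 2) 2 (volume.restrict P.Ω)
  uB_extension : ContDiffOn ℝ 1 P.uB (closure P.Ω)
  uB_boundary : IsCkOnBoundary 2 P.Ω P.uB
  uB_flux : 0 ≤ ∫ x, P.flux x ∂(surfaceMeasure P.Ω)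
  rhoB_boundary : IsCkOnBoundary 1 P.Ω P.rhoB
  rhoB_le : ∀ x ∈ P.Γin, P.rhoB x ≤ 1
  rhoB_inf : ∃ c : ℝ, 0 < c ∧ ∀ x ∈ P.Γin, c ≤ P.rhoB x

/-- All requirements on a generalized dissipative solution `(ϱ, u, S, π)` with Reynolds defect `R`,
where `G` is the weak spatial gradient of `u`, and `m` is the weakly continuous momentum `ϱ u`. The
pressure is a Radon measure on `(0,T) × Ω`. The values of `ϱ` on `∂Ω` are the boundary trace. -/
structure IsDissipativeWith (rho : ℝ → E3 → ℝ) (u : ℝ → E3 → E3) (S : ℝ → E3 → M3)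
    (pi : Measure (ℝ × E3)) (R : ℝ → TensorMeasure) (G : ℝ → E3 → M3) (m : ℝ → E3 → E3) :
    Prop where
  -- density
  rho_meas : AEStronglyMeasurable (fun z : ℝ × E3 => rho z.1 z.2) (volume.restrict P.Q)
  rho_bounds : ∀ᵐ z ∂(volume.restrict P.Q), 0 ≤ rho z.1 z.2 ∧ rho z.1 z.2 ≤ 1
  rho_weak : ∀ γ : ℝ, 1 < γ → WeaklyContinuous γ P.T P.Ω rho
  rho_trace : ∀ γ : ℝ, 1 < γ → MemLp (fun z : ℝ × E3 => rho z.1 z.2) (ENNReal.ofReal γ)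
    ((volume.restrict (Ioo 0 P.T)).prod
      ((surfaceMeasure P.Ω).withDensity fun x => ENNReal.ofReal |P.flux x|))
  rho_init : rho 0 =ᵐ[volume.restrict P.Ω] P.rho0
  -- velocity
  u_memLp : MemLp (fun z : ℝ × E3 => u z.1 z.2) (ENNReal.ofReal P.q) (volume.restrict P.Q)
  G_memLp : ∀ i j, MemLp (fun z : ℝ × E3 => G z.1 z.2 i j) (ENNReal.ofReal P.q)
    (volume.restrict P.Q)
  u_grad : ∀ᵐ t ∂(volume.restrict (Ioo 0 P.T)), IsWeakGradient P.Ω (u t) (G t)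
  u_bdry : ∀ᵐ t ∂(volume.restrict (Ioo 0 P.T)),
    MemW0 P.q P.Ω (fun x => u t x - P.uB x) (fun x => G t x - P.gradB x)
  -- momentum
  m_eq : ∀ᵐ z ∂(volume.restrict P.Q), m z.1 z.2 = rho z.1 z.2 • u z.1 z.2
  m_weak : ∀ γ : ℝ, 1 < γ → WeaklyContinuous (2 * γ / (γ + 1)) P.T P.Ω m
  m_init : m 0 =ᵐ[volume.restrict P.Ω] P.m0
  kinetic : IntegrableOn (fun z : ℝ × E3 => rho z.1 z.2 * ‖u z.1 z.2‖ ^ 2) P.Q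
  -- viscous stress and Reynolds defect
  S_integrable : ∀ i j, IntegrableOn (fun z : ℝ × E3 => S z.1 z.2 i j) P.Q
  S_symm : ∀ᵐ z ∂(volume.restrict P.Q), (S z.1 z.2).IsSymm
  defect : IsBoundedDefect P.T (closure P.Ω) R
  -- pressure
  pi_support : pi P.Qᶜ = 0
  pi_radon : ∀ K : Set (ℝ × E3), IsCompact K → K ⊆ P.Q → pi K < (⊤ : ℝ≥0∞)
  pi_free : ∀ᵐ z ∂pi, rho z.1 z.2 = 1
  div_free : ∀ᵐ z ∂(volume.restrict P.Q), rho z.1 z.2 = 1 → (G z.1 z.2).trace = 0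
  -- continuity equation
  continuity : ∀ φ : ℝ → E3 → ℝ, ContDiffOn ℝ 1 (fun z : ℝ × E3 => φ z.1 z.2) P.Qc →
    (∫ x in P.Ω, rho P.T x * φ P.T x) - (∫ x in P.Ω, rho 0 x * φ 0 x) =
      (∫ z in P.Q, (rho z.1 z.2 * deriv (fun s => φ s z.2) z.1
        + rho z.1 z.2 * ∑ j, u z.1 z.2 j * pderiv j (φ z.1) z.2))
      - (∫ t in Ioo 0 P.T, ∫ x in P.Γout, φ t x * rho t x * P.flux x ∂(surfaceMeasure P.Ω))
      - ∫ t in Ioo 0 P.T, ∫ x in P.Γin, φ t x * P.rhoB x * P.flux x ∂(surfaceMeasure P.Ω)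
  -- momentum equation; the test functions vanish near `t = 0` and `t = T`
  momentum : ∀ φ : ℝ → E3 → E3, ContDiff ℝ 1 (fun z : ℝ × E3 => φ z.1 z.2) →
    HasCompactSupport (fun z : ℝ × E3 => φ z.1 z.2) →
    tsupport (fun z : ℝ × E3 => φ z.1 z.2) ⊆ P.Q →
    0 = (∫ z in P.Q, (rho z.1 z.2 * inner ℝ (u z.1 z.2) (deriv (fun s => φ s z.2) z.1)
          + rho z.1 z.2 * ∑ i, ∑ j, u z.1 z.2 i * u z.1 z.2 j * grad (φ z.1) z.2 i j
          - frob (S z.1 z.2) (grad (φ z.1) z.2)))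
      + (∫ z, (grad (φ z.1) z.2).trace ∂pi)
      + ∫ t in Ioo 0 P.T, (R t).pairing P.Ω (grad (φ t))
  -- energy inequality on `(0,τ)`, for almost every `τ`
  dissipation_finite : ∫⁻ z in P.Q, (ENNReal.ofReal (P.F (symPart (G z.1 z.2)))
    + (conjugate P.F (S z.1 z.2)).toENNReal) ≠ (⊤ : ℝ≥0∞)
  pi_pairing : Integrable (fun z : ℝ × E3 => (P.gradB z.2).trace) pi
  energy : ∀ᵐ τ ∂(volume.restrict (Ioo 0 P.T)),
    (∫ x in P.Ω, 1 / 2 * rho τ x * ‖u τ x - P.uB x‖ ^ 2)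
      - (∫ x in P.Ω, 1 / 2 * P.rho0 x * ‖P.u0 x - P.uB x‖ ^ 2)
      + (∫⁻ z in Ioo 0 τ ×ˢ P.Ω, (ENNReal.ofReal (P.F (symPart (G z.1 z.2)))
          + (conjugate P.F (S z.1 z.2)).toENNReal)).toReal
      + (∫ z in Ioo 0 τ ×ˢ P.Ω, (P.gradB z.2).trace ∂pi)
      + 1 / P.dbar * (R τ (closure P.Ω)).trace
    ≤ - (∫ t in Ioo 0 τ, (R t).pairing (closure P.Ω) P.gradB)
      - (∫ z in Ioo 0 τ ×ˢ P.Ω,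
          rho z.1 z.2 * ∑ i, ∑ j, u z.1 z.2 i * u z.1 z.2 j * P.gradB z.2 i j)
      + (∫ z in Ioo 0 τ ×ˢ P.Ω,
          rho z.1 z.2 * ∑ i, ∑ j, u z.1 z.2 j * P.uB z.2 i * P.gradB z.2 i j)
      + ∫ z in Ioo 0 τ ×ˢ P.Ω, frob (S z.1 z.2) (P.gradB z.2)

/-- `(ϱ, u, S, π)` is a generalized dissipative solution with Reynolds defect `R`. -/
def IsDissipativeSolution (rho : ℝ → E3 → ℝ) (u : ℝ → E3 → E3) (S : ℝ → E3 → M3)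
    (pi : Measure (ℝ × E3)) (R : ℝ → TensorMeasure) : Prop :=
  ∃ (G : ℝ → E3 → M3) (m : ℝ → E3 → E3), P.IsDissipativeWith rho u S pi R G m

/-- The measure `pi` on `(0,T) × Ω` has the density `p`, continuous on `[0,T] × closure Ω`. -/
def HasContinuousDensity (pi : Measure (ℝ × E3)) (p : ℝ → E3 → ℝ) : Prop :=
  ContinuousOn (fun z : ℝ × E3 => p z.1 z.2) P.Qc ∧
  ∀ φ : ℝ × E3 → ℝ, Continuous φ → HasCompactSupport φ → tsupport φ ⊆ P.Q →
    ∫ z, φ z ∂pi = ∫ z in P.Q, φ z * p z.1 z.2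

/-- The acceleration term `∂_t (ϱ u) + div (ϱ u ⊗ u)`, `i`-th component. -/
def inertia (rho : ℝ → E3 → ℝ) (u : ℝ → E3 → E3) (t : ℝ) (x : E3) (i : Fin 3) : ℝ :=
  deriv (fun s => rho s x * u s x i) t
    + ∑ j, pderiv j (fun y => rho t y * u t y i * u t y j) x

/-- The equations hold in the classical sense. The stress `S` is merely integrable, and the pressure
`p` merely continuous, so the momentum equation is stated in two ways: the distribution
`div S - ∇p` is the continuous function `∂_t (ϱ u) + div (ϱ u ⊗ u)` (computed from classical
derivatives), and the equation holds at every point of every open set on which `S` (after a change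
on a null set) and `p` are continuously differentiable. -/
structure IsClassical (rho : ℝ → E3 → ℝ) (u : ℝ → E3 → E3) (S : ℝ → E3 → M3)
    (p : ℝ → E3 → ℝ) : Prop where
  continuity : ∀ t ∈ Ioo 0 P.T, ∀ x ∈ P.Ω,
    deriv (fun s => rho s x) t + ∑ j, pderiv j (fun y => rho t y * u t y j) x = 0
  momentum : ∀ φ : ℝ → E3 → E3, ContDiff ℝ 1 (fun z : ℝ × E3 => φ z.1 z.2) →
    HasCompactSupport (fun z : ℝ × E3 => φ z.1 z.2) →
    tsupport (fun z : ℝ × E3 => φ z.1 z.2) ⊆ P.Q →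
    ∫ z in P.Q, ∑ i, inertia rho u z.1 z.2 i * φ z.1 z.2 i =
      - (∫ z in P.Q, frob (S z.1 z.2) (grad (φ z.1) z.2))
      + ∫ z in P.Q, p z.1 z.2 * (grad (φ z.1) z.2).trace
  momentum_pointwise : ∀ (U : Set (ℝ × E3)) (S' : ℝ → E3 → M3), IsOpen U → U ⊆ P.Q →
    (∀ᵐ z ∂(volume.restrict U), S' z.1 z.2 = S z.1 z.2) →
    (∀ i j, ContDiffOn ℝ 1 (fun z : ℝ × E3 => S' z.1 z.2 i j) U) →
    ContDiffOn ℝ 1 (fun z : ℝ × E3 => p z.1 z.2) U →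
    ∀ t x, (t, x) ∈ U → ∀ i,
      inertia rho u t x i - ∑ j, pderiv j (fun y => S' t y i j) x + pderiv i (p t) x = 0
  rho_bounds : ∀ t ∈ Ioo 0 P.T, ∀ x ∈ P.Ω, 0 ≤ rho t x ∧ rho t x ≤ 1
  div_free : ∀ t ∈ Ioo 0 P.T, ∀ x ∈ P.Ω, rho t x = 1 → (grad (u t) x).trace = 0
  p_free : ∀ t ∈ Ioo 0 P.T, ∀ x ∈ P.Ω, rho t x < 1 → p t x = 0
  p_nonneg : ∀ t ∈ Ioo 0 P.T, ∀ x ∈ P.Ω, rho t x = 1 → 0 ≤ p t x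

end Data

end

end FreeBoundary

/-!
The proof is a relative energy argument, in which the comparison state is the solution itself.

Since `ϱ` and `u` are `C¹`, the continuity equation holds pointwise, and it forces `div u = 0` where
`ϱ = 1`: the density is maximal there, so its derivatives vanish. The pressure vanishes where
`ϱ < 1`, hence `p div u = 0` in `Q` (`Data.IsRegularSolution.pressure_mul_div_eq_zero`).

The momentum equation is tested with `u - u_B` on `(0, τ)`, and the result is subtracted from the
energy inequality. The kinetic terms cancel by the continuity equation, the pressure terms by
`p div u = 0`, and the convective terms identically. What remains is
`∫ (F(𝔻u) + F*(𝕊) - 𝕊 : ∇u) + tr ℜ(τ) / d̄ ≤ D ∫₀^τ tr ℜ`, where `tr ℜ(t)` is the trace of the total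
mass of the defect (`Data.IsRegularSolution.exists_relative_energy_bound`). The first integrand is
nonnegative by the Fenchel–Young inequality, so Gronwall's lemma gives `ℜ = 0`; then the integral
vanishes, and equality in the Fenchel–Young inequality is the relation `𝕊 ∈ ∂F(𝔻u)`. The momentum
equation without defect yields its classical form by the fundamental lemma of the calculus of
variations.

Two points need care, as test functions must be compactly supported in `Q`.

* The relative velocity vanishes on the lateral boundary only in the sense of `W^{1,q}_0`. That it
  vanishes there pointwise is shown by blow-up at a boundary point
  (`IsC2Domain.eq_zero_on_frontier`): the extension by zero of a function in `W^{1,q}_0` with bounded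
  gradient has bounded distributional derivatives, whereas a jump across the boundary would leave,
  in the limit, a derivative concentrated on a plane.

* A function `f` that vanishes on the lateral boundary is approximated by compactly supported ones
  through a truncation of its values near `0`, without regard to the geometry of the boundary
  (`Data.cut`). The gradients stay bounded, and converge almost everywhere because `∇f = 0` almost
  everywhere on `{f = 0}`. The defect is singular in space, and its contribution need not converge,
  but it is bounded by `D ∫₀^τ tr ℜ`, which is all that Gronwall's lemma asks for.
-/

namespace FreeBoundary

/-! ### Integration by parts and test functions -/

section Calculus

lemma continuous_mul_of_tsupport_subset {E : Type*} [TopologicalSpace E] {U : Set E}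
    (hU : IsOpen U) {f φ : E → ℝ}
    (hf : ContinuousOn f U) (hφ : Continuous φ) (hsub : tsupport φ ⊆ U) :
    Continuous fun x => f x * φ x := by
  rw [continuous_iff_continuousAt]
  intro x
  by_cases hx : x ∈ tsupport φ
  · exact (hf.continuousAt (hU.mem_nhds (hsub hx))).mul hφ.continuousAt
  · have : (fun x => f x * φ x) =ᶠ[𝓝 x] fun _ => 0 := by
      filter_upwards [notMem_tsupport_iff_eventuallyEq.1 hx] with y hy
      simp [hy]
    exact (continuousAt_const.congr this.symm)

lemma integrable_mul_of_tsupport_subset {E : Type*} [TopologicalSpace E] [T2Space E]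
    [MeasurableSpace E] [OpensMeasurableSpace E] {μ : Measure E} [IsFiniteMeasureOnCompacts μ]
    {U : Set E} (hU : IsOpen U) {f φ : E → ℝ}
    (hf : ContinuousOn f U) (hφ : Continuous φ) (hc : HasCompactSupport φ) (hsub : tsupport φ ⊆ U) :
    Integrable (fun x => f x * φ x) μ :=
  (continuous_mul_of_tsupport_subset hU hf hφ hsub).integrable_of_hasCompactSupport
    (hc.mul_left)

/-- Extension by zero of a `C¹` function that vanishes off a compact subset of an open set. -/
lemma contDiff_indicator_of_compact {E F : Type*} [NormedAddCommGroup E]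
    [NormedSpace ℝ E] [NormedAddCommGroup F] [NormedSpace ℝ F]
    {U K : Set E} (hU : IsOpen U) (hK : IsCompact K) (hKU : K ⊆ U)
    {f : E → F} (hf : ContDiffOn ℝ 1 f U) (h0 : ∀ x ∈ U, x ∉ K → f x = 0) :
    ContDiff ℝ 1 (U.indicator f) ∧ HasCompactSupport (U.indicator f) ∧
      tsupport (U.indicator f) ⊆ K := by
  have hz : ∀ x ∉ K, U.indicator f x = 0 := fun x hx => by
    by_cases hxU : x ∈ U
    · rw [indicator_of_mem hxU, h0 x hxU hx]
    · exact indicator_of_notMem hxU f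
  have hts : tsupport (U.indicator f) ⊆ K :=
    closure_minimal (fun x hx => by_contra fun h => hx (hz x h)) hK.isClosed
  refine ⟨?_, hK.of_isClosed_subset (isClosed_tsupport _) hts, hts⟩
  rw [contDiff_iff_contDiffAt]
  intro x
  by_cases hx : x ∈ K
  · refine (hf.contDiffAt (hU.mem_nhds (hKU hx))).congr_of_eventuallyEq ?_
    filter_upwards [hU.mem_nhds (hKU hx)] with y hy using indicator_of_mem hy f
  · refine (contDiffAt_const (c := (0 : F))).congr_of_eventuallyEq ?_
    filter_upwards [hK.isClosed.isOpen_compl.mem_nhds hx] with y hy using hz y hy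

variable {E : Type*} [NormedAddCommGroup E] [NormedSpace ℝ E] [FiniteDimensional ℝ E]
  [MeasurableSpace E] [BorelSpace E] {μ : Measure E} [μ.IsAddHaarMeasure]

/-- Integration by parts against a test function with compact support in an open set. -/
lemma setIntegral_mul_fderiv {U : Set E} (hU : IsOpen U) {f φ : E → ℝ}
    (hf : ContDiffOn ℝ 1 f U) (hφ : ContDiff ℝ 1 φ) (hc : HasCompactSupport φ)
    (hsub : tsupport φ ⊆ U) (v : E) :
    ∫ x in U, f x * fderiv ℝ φ x v ∂μ = - ∫ x in U, fderiv ℝ f x v * φ x ∂μ := by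
  have hcont : ContinuousOn (fun x => fderiv ℝ f x v) U :=
    (hf.continuousOn_fderiv_of_isOpen hU le_rfl).clm_apply continuousOn_const
  have hcφ : Continuous fun x => fderiv ℝ φ x v :=
    (hφ.continuous_fderiv one_ne_zero).clm_apply continuous_const
  have hsub' : tsupport (fun x => fderiv ℝ φ x v) ⊆ tsupport φ :=
    tsupport_fderiv_apply_subset ℝ v
  rw [setIntegral_eq_integral_of_forall_compl_eq_zero,
    setIntegral_eq_integral_of_forall_compl_eq_zero]
  · apply integral_mul_fderiv_eq_neg_fderiv_mul_of_integrable
    · exact integrable_mul_of_tsupport_subset hU hcont hφ.continuous hc hsub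
    · exact integrable_mul_of_tsupport_subset hU hf.continuousOn hcφ
        (hc.fderiv_apply ℝ v) (hsub'.trans hsub)
    · exact integrable_mul_of_tsupport_subset hU hf.continuousOn hφ.continuous hc hsub
    · exact fun x hx => (hf.differentiableOn one_ne_zero).differentiableAt (hU.mem_nhds (hsub hx))
    · exact fun x _ => hφ.differentiable one_ne_zero x
  · intro x hx
    rw [image_eq_zero_of_notMem_tsupport (fun h => hx (hsub h)), mul_zero]
  · intro x hx
    rw [image_eq_zero_of_notMem_tsupport (f := fun x => fderiv ℝ φ x v)
      (fun h => hx (hsub (hsub' h))), mul_zero]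

/-- The fundamental lemma of the calculus of variations for continuous functions. -/
lemma eq_zero_of_setIntegral_smooth_mul {U : Set E} (hU : IsOpen U) {f : E → ℝ}
    (hf : ContinuousOn f U)
    (h : ∀ φ : E → ℝ, ContDiff ℝ ∞ φ → HasCompactSupport φ → tsupport φ ⊆ U →
      ∫ x in U, φ x * f x ∂μ = 0) : ∀ x ∈ U, f x = 0 := by
  have hae : ∀ᵐ x ∂μ, x ∈ U → f x = 0 := by
    refine hU.ae_eq_zero_of_integral_contDiff_smul_eq_zero
      (hf.locallyIntegrableOn hU.measurableSet) ?_
    intro g hg hgc hgs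
    rw [← h g hg hgc hgs, setIntegral_eq_integral_of_forall_compl_eq_zero]
    · simp
    · intro x hx
      rw [image_eq_zero_of_notMem_tsupport (fun h => hx (hgs h)), zero_mul]
  have := Measure.eqOn_open_of_ae_eq (μ := μ) (U := U) (f := f) (g := fun _ => (0 : ℝ))
    ((ae_restrict_iff' hU.measurableSet).2 hae) hU hf continuousOn_const
  exact this

/-- A continuous function with nonnegative integrals against nonnegative test functions is
nonnegative. -/
lemma nonneg_of_setIntegral_mul_nonneg {U : Set E} (hU : IsOpen U)
    {f : E → ℝ} (hf : ContinuousOn f U)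
    (h : ∀ φ : E → ℝ, Continuous φ → HasCompactSupport φ → tsupport φ ⊆ U → (∀ x, 0 ≤ φ x) →
      0 ≤ ∫ x in U, φ x * f x ∂μ) : ∀ x ∈ U, 0 ≤ f x := by
  intro x hx
  by_contra! hneg
  have hV : IsOpen (U ∩ f ⁻¹' Iio 0) := hf.isOpen_inter_preimage hU isOpen_Iio
  obtain ⟨φ, hsub, hc, hsm, hr, hφx⟩ := exists_contDiff_tsupport_subset (n := (⊤ : ℕ∞))
    (hV.mem_nhds ⟨hx, hneg⟩)
  have hsubU : tsupport φ ⊆ U := hsub.trans inter_subset_left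
  have h0 := h φ hsm.continuous hc hsubU (fun y => (hr (mem_range_self y)).1)
  have hcont : Continuous fun y => - (f y * φ y) :=
    (continuous_mul_of_tsupport_subset hU hf hsm.continuous hsubU).neg
  have hpos : 0 < ∫ y, - (f y * φ y) ∂μ := by
    refine hcont.integral_pos_of_hasCompactSupport_nonneg_nonzero (hc.mul_left.neg) ?_ (x := x) ?_
    · intro y
      by_cases hy : y ∈ tsupport φ
      · have h1 : f y < 0 := (hsub hy).2
        have h2 := (hr (mem_range_self y)).1
        simp only [Pi.zero_apply]; nlinarith
      · simp [image_eq_zero_of_notMem_tsupport hy]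
    · rw [hφx]; simpa using hneg.ne
  rw [integral_neg, ← setIntegral_eq_integral_of_forall_compl_eq_zero (s := U)] at hpos
  · simp_rw [mul_comm (f _)] at hpos
    linarith
  · intro y hy
    rw [image_eq_zero_of_notMem_tsupport (fun h => hy (hsubU h)), mul_zero]

/-- The derivative of a function vanishes almost everywhere on its zero set. -/
lemma ae_fderiv_eq_zero_of_eq_zero {U : Set E} (hU : IsOpen U) {f : E → ℝ}
    (hf : DifferentiableOn ℝ f U) :
    ∀ᵐ x ∂μ, x ∈ U → f x = 0 → fderiv ℝ f x = 0 := by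
  rcases subsingleton_or_nontrivial E with hE | hE
  · exact Eventually.of_forall fun x _ _ => by ext v; simp [Subsingleton.elim v 0]
  obtain ⟨e, he⟩ := exists_ne (0 : E)
  have hms : MeasurableSet (U ∩ f ⁻¹' {0}) := by
    obtain ⟨V, hV, hVe⟩ := (continuousOn_iff'.1 hf.continuousOn) {0}ᶜ isOpen_compl_singleton
    have : U ∩ f ⁻¹' {0} = U \ (V ∩ U) := by
      rw [← hVe]; ext x; simp
    rw [this]
    exact hU.measurableSet.diff (hV.inter hU).measurableSet
  have happ : ApproximatesLinearOn (fun x => f x • e) (0 : E →L[ℝ] E) (U ∩ f ⁻¹' {0}) 0 := by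
    intro x hx y hy
    have h1 : f x = 0 := hx.2
    have h2 : f y = 0 := hy.2
    simp [h1, h2]
  -- on its zero set, `f` is approximated by the zero map, hence so is its derivative
  have h := happ.norm_fderiv_sub_le μ hms (fun x => (fderiv ℝ f x).smulRight e) (fun x hx =>
    ((hf.differentiableAt (hU.mem_nhds hx.1)).hasFDerivAt.smul_const e).hasFDerivWithinAt)
  rw [ae_restrict_iff' hms] at h
  filter_upwards [h] with x hx hxU hx0
  have h1 := hx ⟨hxU, hx0⟩
  simp only [sub_zero, nonpos_iff_eq_zero, nnnorm_eq_zero] at h1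
  ext v
  have h2 := DFunLike.congr_fun h1 v
  simpa [he] using h2

end Calculus

/-! ### Truncation of values near zero -/

/-- A smooth function that vanishes on `[-1, 1]` and is the identity far from the origin. The
rescaled functions `n⁻¹ * gap (n * s)` approximate `s`, with bounded derivatives, and vanish near
`0`. -/
noncomputable def gap (s : ℝ) : ℝ := s * Real.smoothTransition (s ^ 2 - 1)

lemma contDiff_gap : ContDiff ℝ ∞ gap :=
  contDiff_id.mul (Real.smoothTransition.contDiff.comp ((contDiff_id.pow 2).sub contDiff_const))

lemma gap_eq_zero {s : ℝ} (hs : |s| ≤ 1) : gap s = 0 := by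
  have : s ^ 2 ≤ 1 := by rw [← sq_abs]; nlinarith [abs_nonneg s]
  rw [gap, Real.smoothTransition.zero_of_nonpos (by linarith), mul_zero]

lemma gap_eq_self {s : ℝ} (hs : 2 ≤ |s|) : gap s = s := by
  have : 4 ≤ s ^ 2 := by rw [← sq_abs]; nlinarith
  rw [gap, Real.smoothTransition.one_of_one_le (by linarith), mul_one]

lemma abs_gap_le (s : ℝ) : |gap s| ≤ |s| := by
  rw [gap, abs_mul, abs_of_nonneg (Real.smoothTransition.nonneg _)]
  exact mul_le_of_le_one_right (abs_nonneg s) (Real.smoothTransition.le_one _)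

lemma deriv_gap_eq_one {s : ℝ} (hs : 2 < |s|) : deriv gap s = 1 := by
  have : gap =ᶠ[𝓝 s] id := by
    filter_upwards [(isOpen_lt continuous_const continuous_abs).mem_nhds hs] with y hy
    exact gap_eq_self (le_of_lt hy)
  rw [this.deriv_eq, deriv_id]

lemma exists_deriv_gap_bound : ∃ C : ℝ, 0 ≤ C ∧ ∀ s, |deriv gap s| ≤ C := by
  have hc : Continuous (deriv gap) := contDiff_gap.continuous_deriv (by simp)
  obtain ⟨C, hC⟩ := (isCompact_Icc (a := (-2 : ℝ)) (b := 2)).exists_bound_of_continuousOn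
    hc.continuousOn
  refine ⟨max C 1, le_max_of_le_right zero_le_one, fun s => ?_⟩
  by_cases hs : 2 < |s|
  · rw [deriv_gap_eq_one hs]; simp
  · exact (hC s (abs_le.1 (not_lt.1 hs))).trans (le_max_left _ _)

/-- The truncation `n⁻¹ * gap (n * s)` of `s`. -/
noncomputable def trunc (n : ℕ) (s : ℝ) : ℝ := (n : ℝ)⁻¹ * gap (n * s)

lemma contDiff_trunc (n : ℕ) : ContDiff ℝ ∞ (trunc n) :=
  contDiff_const.mul (contDiff_gap.comp (contDiff_const.mul contDiff_id))

lemma deriv_trunc {n : ℕ} (hn : n ≠ 0) (s : ℝ) : deriv (trunc n) s = deriv gap (n * s) := by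
  have hg : HasDerivAt gap (deriv gap (n * s)) (n * s) :=
    (contDiff_gap.differentiable (by simp) _).hasDerivAt
  have h := (hg.comp s ((hasDerivAt_id s).const_mul (n : ℝ))).const_mul (n : ℝ)⁻¹
  have h' : HasDerivAt (trunc n) ((n : ℝ)⁻¹ * (deriv gap (n * s) * (n * 1))) s := h
  rw [h'.deriv]
  have : (n : ℝ) ≠ 0 := by exact_mod_cast hn
  field_simp

lemma trunc_eq_zero {n : ℕ} {s : ℝ} (hs : n * |s| ≤ 1) : trunc n s = 0 := by
  rw [trunc, gap_eq_zero, mul_zero]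
  rwa [abs_mul, Nat.abs_cast]

lemma abs_trunc_le (n : ℕ) (s : ℝ) : |trunc n s| ≤ |s| := by
  rcases Nat.eq_zero_or_pos n with rfl | hn
  · simp [trunc]
  rw [trunc, abs_mul, abs_inv, Nat.abs_cast, inv_mul_le_iff₀ (by positivity)]
  refine (abs_gap_le _).trans_eq ?_
  rw [abs_mul, Nat.abs_cast]

lemma tendsto_natCast_mul_abs {s : ℝ} (hs : s ≠ 0) :
    Tendsto (fun n : ℕ => (n : ℝ) * |s|) atTop atTop :=
  tendsto_natCast_atTop_atTop.atTop_mul_const (abs_pos.2 hs)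

lemma tendsto_trunc (s : ℝ) : Tendsto (fun n => trunc n s) atTop (𝓝 s) := by
  rcases eq_or_ne s 0 with rfl | hs
  · simp [trunc, gap_eq_zero]
  refine tendsto_const_nhds.congr' ?_
  filter_upwards [(tendsto_natCast_mul_abs hs).eventually_ge_atTop 2, eventually_gt_atTop 0]
    with n hn hn0
  rw [trunc, gap_eq_self (by rwa [abs_mul, Nat.abs_cast])]
  field_simp

lemma tendsto_deriv_trunc {s : ℝ} (hs : s ≠ 0) :
    Tendsto (fun n => deriv (trunc n) s) atTop (𝓝 1) := by
  refine tendsto_const_nhds.congr' ?_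
  filter_upwards [(tendsto_natCast_mul_abs hs).eventually_gt_atTop 2, eventually_gt_atTop 0]
    with n hn hn0
  rw [deriv_trunc hn0.ne', deriv_gap_eq_one (by rwa [abs_mul, Nat.abs_cast])]

/-! ### Domains of class `C²` -/

/-- Blow-up of a `C²` domain at a boundary point: the dilated domains converge to a half-space. -/
lemma IsC2Domain.exists_halfSpace {Ω : Set E3} (hΩ : IsC2Domain Ω) {x : E3}
    (hx : x ∈ frontier Ω) : ∃ l : E3 →L[ℝ] ℝ, l ≠ 0 ∧
      (∀ v, l v < 0 → ∀ᶠ n : ℕ in atTop, x + (n : ℝ)⁻¹ • v ∈ Ω) ∧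
      (∀ v, 0 < l v → ∀ᶠ n : ℕ in atTop, x + (n : ℝ)⁻¹ • v ∉ Ω) := by
  obtain ⟨ψ, hψ, hne, hev⟩ := hΩ.boundary x hx
  have hxΩ : x ∉ Ω := by
    rw [hΩ.isOpen.frontier_eq] at hx
    exact hx.2
  have hψx : ψ x = 0 := by
    refine le_antisymm ?_ (not_lt.1 fun h => hxΩ ((hev.self_of_nhds).2 h))
    have hcl : ∃ᶠ y in 𝓝 x, y ∈ Ω := mem_closure_iff_frequently.1 (frontier_subset_closure hx)
    by_contra! hpos
    have h1 : ∀ᶠ y in 𝓝 x, 0 < ψ y := hψ.continuous.continuousAt.eventually_const_lt hpos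
    obtain ⟨y, hy, hy1, hy2⟩ := (hcl.and_eventually (h1.and hev)).exists
    exact absurd (hy2.1 hy) hy1.le.not_gt
  have hd : HasFDerivAt ψ (fderiv ℝ ψ x) x := (hψ.differentiable two_ne_zero x).hasFDerivAt
  have hlim : ∀ v, Tendsto (fun n : ℕ => (n : ℝ) * ψ (x + (n : ℝ)⁻¹ • v)) atTop
      (𝓝 (fderiv ℝ ψ x v)) := by
    intro v
    have := hd.lim v (c := fun n : ℕ => (n : ℝ)) (l := atTop)
      (by simpa using tendsto_natCast_atTop_atTop)
    simpa [hψx] using this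
  have hnear : ∀ v, ∀ᶠ n : ℕ in atTop,
      (x + (n : ℝ)⁻¹ • v ∈ Ω ↔ ψ (x + (n : ℝ)⁻¹ • v) < 0) := by
    intro v
    have : Tendsto (fun n : ℕ => x + (n : ℝ)⁻¹ • v) atTop (𝓝 x) := by
      simpa using tendsto_const_nhds.add
        ((tendsto_inv_atTop_nhds_zero_nat (𝕜 := ℝ)).smul_const v)
    exact this.eventually hev
  refine ⟨fderiv ℝ ψ x, hne, fun v hv => ?_, fun v hv => ?_⟩
  · filter_upwards [hnear v, (hlim v).eventually_lt_const hv] with n h1 h2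
    exact h1.2 (by by_contra! h; exact absurd h2 (mul_nonneg n.cast_nonneg h).not_gt)
  · filter_upwards [hnear v, (hlim v).eventually_const_lt hv] with n h1 h2 h3
    exact absurd h2 (mul_nonpos_of_nonneg_of_nonpos n.cast_nonneg (h1.1 h3).le).not_gt

lemma IsC2Domain.uniqueDiffOn_closure {Ω : Set E3} (hΩ : IsC2Domain Ω) :
    UniqueDiffOn ℝ (closure Ω) := by
  intro x hx
  by_cases hxΩ : x ∈ Ω
  · exact (hΩ.isOpen.uniqueDiffOn x hxΩ).closure
  have hxf : x ∈ frontier Ω := by rw [hΩ.isOpen.frontier_eq]; exact ⟨hx, hxΩ⟩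
  obtain ⟨l, hl, hin, -⟩ := hΩ.exists_halfSpace hxf
  have hcone : ∀ v, l v < 0 → v ∈ tangentConeAt ℝ (closure Ω) x := by
    intro v hv
    refine mem_tangentConeAt_of_seq atTop (fun n : ℕ => (n : ℝ)) (fun n => (n : ℝ)⁻¹ • v) ?_
      ((hin v hv).mono fun n hn => subset_closure hn) ?_
    · simpa using (tendsto_inv_atTop_nhds_zero_nat (𝕜 := ℝ)).smul_const v
    · refine tendsto_const_nhds.congr' ?_
      filter_upwards [eventually_ne_atTop 0] with n hn
      rw [smul_smul, mul_inv_cancel₀ (by exact_mod_cast hn), one_smul]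
  refine ⟨?_, by rwa [closure_closure]⟩
  obtain ⟨e, he⟩ : ∃ e, l e < 0 := by
    obtain ⟨e, he⟩ : ∃ e, l e ≠ 0 := by
      by_contra! h
      exact hl (ContinuousLinearMap.ext h)
    rcases lt_or_gt_of_ne he with h | h
    · exact ⟨e, h⟩
    · exact ⟨-e, by simpa using h⟩
  have htop : Submodule.span ℝ (tangentConeAt ℝ (closure Ω) x) = ⊤ := by
    rw [Submodule.eq_top_iff']
    intro v
    -- every vector is the difference of two vectors pointing into the domain
    have hk : v = (v + ((|l v| + 1) / |l e|) • e) - ((|l v| + 1) / |l e|) • e := by abel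
    have hle : (|l v| + 1) / |l e| * l e = - (|l v| + 1) := by
      rw [abs_of_neg he]; field_simp [he.ne]
    rw [hk]
    refine Submodule.sub_mem _ (Submodule.subset_span (hcone _ ?_))
      (Submodule.subset_span (hcone _ ?_))
    · rw [map_add, map_smul, smul_eq_mul, hle]
      linarith [le_abs_self (l v)]
    · rw [map_smul, smul_eq_mul, hle]
      linarith [abs_nonneg (l v)]
  rw [htop]
  exact dense_univ

/-- A smooth radial bump function, decreasing in the distance from the origin. -/
noncomputable def radialBump (z : E3) : ℝ := Real.smoothTransition (2 - ‖z‖ ^ 2)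

lemma contDiff_radialBump : ContDiff ℝ ∞ radialBump :=
  Real.smoothTransition.contDiff.comp (contDiff_const.sub (contDiff_norm_sq ℝ))

lemma hasCompactSupport_radialBump : HasCompactSupport radialBump := by
  refine HasCompactSupport.intro (isCompact_closedBall (0 : E3) 2) fun z hz => ?_
  rw [mem_closedBall_zero_iff, not_le] at hz
  exact Real.smoothTransition.zero_of_nonpos (by nlinarith)

lemma fderiv_radialBump (z v : E3) : fderiv ℝ radialBump z v =
    - (deriv Real.smoothTransition (2 - ‖z‖ ^ 2) * (2 * inner ℝ z v)) := by
  have h1 : HasDerivAt Real.smoothTransition (deriv Real.smoothTransition (2 - ‖z‖ ^ 2))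
      (2 - ‖z‖ ^ 2) :=
    ((Real.smoothTransition.contDiff (n := 1)).differentiable one_ne_zero _).hasDerivAt
  have h2 : HasFDerivAt (fun y : E3 => 2 - ‖y‖ ^ 2) (-(2 • innerSL ℝ z)) z :=
    (HasStrictFDerivAt.hasFDerivAt (hasStrictFDerivAt_norm_sq z)).const_sub 2
  have h3 := h1.comp_hasFDerivAt z h2
  have h4 : fderiv ℝ radialBump z = _ := h3.fderiv
  rw [h4]
  simp

/-- The integral over a half-space of the outward derivative of the radial bump is positive. -/
lemma setIntegral_halfSpace_fderiv_radialBump_pos {v : E3} (hv : v ≠ 0) :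
    0 < ∫ z in {z : E3 | inner ℝ v z < 0}, fderiv ℝ radialBump z v := by
  have hcont : Continuous fun z => fderiv ℝ radialBump z v :=
    (contDiff_radialBump.continuous_fderiv (by simp)).clm_apply continuous_const
  have hHo : IsOpen {z : E3 | inner ℝ v z < 0} :=
    isOpen_lt (continuous_const.inner continuous_id) continuous_const
  have hint : Integrable (fun z => fderiv ℝ radialBump z v) volume :=
    hcont.integrable_of_hasCompactSupport (hasCompactSupport_radialBump.fderiv_apply ℝ v)
  rw [setIntegral_pos_iff_support_of_nonneg_ae _ hint.integrableOn]
  · obtain ⟨s, hs, hds⟩ := exists_deriv_eq_slope Real.smoothTransition (zero_lt_one' ℝ)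
      Real.smoothTransition.continuous.continuousOn
      (((Real.smoothTransition.contDiff (n := 1)).differentiable one_ne_zero).differentiableOn)
    have hz0 : (-(Real.sqrt (2 - s) / ‖v‖) • v) ∈
        (Function.support fun z => fderiv ℝ radialBump z v) ∩ {z : E3 | inner ℝ v z < 0} := by
      have hvn : 0 < ‖v‖ := norm_pos_iff.2 hv
      have hsq : 0 < Real.sqrt (2 - s) := Real.sqrt_pos.2 (by linarith [hs.2])
      have hn : ‖-(Real.sqrt (2 - s) / ‖v‖) • v‖ ^ 2 = 2 - s := by
        rw [norm_smul, norm_neg, norm_div, norm_norm, Real.norm_of_nonneg hsq.le,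
          div_mul_cancel₀ _ hvn.ne', Real.sq_sqrt (by linarith [hs.2])]
      have hin : inner ℝ v (-(Real.sqrt (2 - s) / ‖v‖) • v) < 0 := by
        rw [inner_smul_right, real_inner_self_eq_norm_sq]
        have : 0 < Real.sqrt (2 - s) / ‖v‖ * ‖v‖ ^ 2 := by positivity
        linarith
      refine ⟨?_, hin⟩
      rw [Function.mem_support, fderiv_radialBump, hn, sub_sub_cancel, hds, real_inner_comm]
      simp only [Real.smoothTransition.one, Real.smoothTransition.zero]
      norm_num
      simpa using hin.ne
    exact (((hcont.isOpen_support).inter hHo).measure_pos volume ⟨_, hz0⟩)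
  · refine (ae_restrict_iff' hHo.measurableSet).2 (Eventually.of_forall fun z hz => ?_)
    have h1 : 0 ≤ deriv Real.smoothTransition (2 - ‖z‖ ^ 2) :=
      Real.smoothTransition.monotone.deriv_nonneg
    have h2 : inner ℝ z v < 0 := by rw [real_inner_comm]; exact hz
    simp only [Pi.zero_apply]
    rw [fderiv_radialBump]
    nlinarith

/-- A function that is continuous up to the boundary of a `C²` domain and whose extension by zero
has distributional derivatives of first order that are bounded functions vanishes on the boundary:
otherwise, the blow-up at a boundary point would have a nonzero derivative concentrated on a
plane. -/
lemma IsC2Domain.eq_zero_on_frontier {Ω : Set E3} (hΩ : IsC2Domain Ω) {w : E3 → ℝ}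
    (hw : ContinuousOn w (closure Ω)) {C : E3 → ℝ}
    (hC : ∀ ψ : E3 → ℝ, ContDiff ℝ ∞ ψ → HasCompactSupport ψ → ∀ v,
      |∫ y in Ω, w y * fderiv ℝ ψ y v| ≤ C v * ∫ y, |ψ y|) :
    ∀ x ∈ frontier Ω, w x = 0 := by
  intro x hx
  obtain ⟨l, hl, hin, hout⟩ := hΩ.exists_halfSpace hx
  set v : E3 := (InnerProductSpace.toDual ℝ E3).symm l with hv
  have hlv : ∀ z, l z = inner ℝ v z := fun z => by
    rw [hv, InnerProductSpace.toDual_symm_apply]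
  have hv0 : v ≠ 0 := by
    intro h
    apply hl
    ext z
    simp [hlv, h]
  have hcont : Continuous fun z => fderiv ℝ radialBump z v :=
    (contDiff_radialBump.continuous_fderiv (by simp)).clm_apply continuous_const
  have hint : Integrable (fun z => fderiv ℝ radialBump z v) volume :=
    hcont.integrable_of_hasCompactSupport (hasCompactSupport_radialBump.fderiv_apply ℝ v)
  have hKc : IsCompact (closure Ω) := hΩ.isBounded.isCompact_closure
  obtain ⟨M, hM⟩ := hKc.exists_bound_of_continuousOn hw
  have hΩm : MeasurableSet Ω := hΩ.isOpen.measurableSet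
  let F : ℕ → E3 → ℝ := fun n z =>
    Ω.indicator w (x + (n : ℝ)⁻¹ • z) * fderiv ℝ radialBump z v
  have hwm : Measurable (Ω.indicator w) := by
    have h1 : ContinuousOn w Ω := hw.mono subset_closure
    classical
    rw [← piecewise_eq_indicator]
    exact h1.measurable_piecewise (g := fun _ => (0 : ℝ)) continuousOn_const hΩm
  -- the blow-ups of the zero extension converge to a multiple of the indicator of a half-space
  have hlim : Tendsto (fun n => ∫ z, F n z) atTop
      (𝓝 (∫ z in {z : E3 | inner ℝ v z < 0}, w x * fderiv ℝ radialBump z v)) := by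
    have hHm : MeasurableSet {z : E3 | inner ℝ v z < 0} :=
      (isOpen_lt (continuous_const.inner continuous_id) continuous_const).measurableSet
    rw [← integral_indicator hHm]
    refine tendsto_integral_of_dominated_convergence
      (fun z => M * |fderiv ℝ radialBump z v|) ?_ (hint.abs.const_mul M) ?_ ?_
    · intro n
      exact ((hwm.comp (by fun_prop)).mul hcont.measurable).aestronglyMeasurable
    · intro n
      refine Eventually.of_forall fun z => ?_
      simp only [F, norm_mul, Real.norm_eq_abs]
      gcongr
      by_cases hz : x + (n : ℝ)⁻¹ • z ∈ Ω
      · rw [indicator_of_mem hz]; exact hM _ (subset_closure hz)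
      · rw [indicator_of_notMem hz, abs_zero]
        exact (norm_nonneg _).trans (hM x (frontier_subset_closure hx))
    · have hnull : volume {z : E3 | l z = 0} = 0 := by
        have : (LinearMap.ker (l : E3 →ₗ[ℝ] ℝ)) ≠ ⊤ := by
          intro h
          apply hl
          ext z
          have : z ∈ LinearMap.ker (l : E3 →ₗ[ℝ] ℝ) := h ▸ Submodule.mem_top
          exact this
        exact Measure.addHaar_submodule volume _ this
      have hae : ∀ᵐ z : E3, l z ≠ 0 := by
        rw [ae_iff]; simpa using hnull
      filter_upwards [hae] with z hz
      have hto : Tendsto (fun n : ℕ => x + (n : ℝ)⁻¹ • z) atTop (𝓝 x) := by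
        simpa using tendsto_const_nhds.add
          ((tendsto_inv_atTop_nhds_zero_nat (𝕜 := ℝ)).smul_const z)
      rcases lt_or_gt_of_ne hz with h | h
      · rw [indicator_of_mem (show z ∈ {z : E3 | inner ℝ v z < 0} by
          rw [mem_ofPred_eq, ← hlv]; exact h)]
        refine Tendsto.mul_const _ ?_
        have h2 : Tendsto (fun n : ℕ => w (x + (n : ℝ)⁻¹ • z)) atTop (𝓝 (w x)) :=
          (hw x (frontier_subset_closure hx)).tendsto.comp
            (tendsto_nhdsWithin_iff.2 ⟨hto, (hin z h).mono fun n hn => subset_closure hn⟩)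
        refine h2.congr' ?_
        filter_upwards [hin z h] with n hn
        rw [indicator_of_mem hn]
      · rw [indicator_of_notMem (show z ∉ {z : E3 | inner ℝ v z < 0} by
          rw [mem_ofPred_eq, ← hlv]; exact h.not_gt)]
        refine tendsto_const_nhds.congr' ?_
        filter_upwards [hout z h] with n hn
        simp only [F]
        rw [indicator_of_notMem hn, zero_mul]
  -- while the bound on the distributional derivative improves under dilation
  have hbound : ∀ n : ℕ, 0 < n → |∫ z, F n z| ≤ (n : ℝ)⁻¹ * (C v * ∫ z, |radialBump z|) := by
    intro n hn
    have hn0 : (n : ℝ) ≠ 0 := by exact_mod_cast hn.ne'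
    let ψ : E3 → ℝ := fun y => radialBump ((n : ℝ) • (y - x))
    have hψ : ContDiff ℝ ∞ ψ :=
      contDiff_radialBump.comp ((contDiff_id.sub contDiff_const).const_smul (n : ℝ))
    have hψc : HasCompactSupport ψ := by
      have := hasCompactSupport_radialBump.comp_homeomorph
        ((Homeomorph.subRight x).trans (Homeomorph.smulOfNeZero (n : ℝ) hn0))
      exact this
    have hψd : ∀ y, fderiv ℝ ψ y v = n * fderiv ℝ radialBump ((n : ℝ) • (y - x)) v := by
      intro y
      have h1 : HasFDerivAt (fun y : E3 => (n : ℝ) • (y - x))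
          ((n : ℝ) • ContinuousLinearMap.id ℝ E3) y :=
        ((hasFDerivAt_id y).sub_const x).const_smul (n : ℝ)
      have h2 := ((contDiff_radialBump.differentiable (by simp)
        ((n : ℝ) • (y - x))).hasFDerivAt).comp y h1
      have h3 : fderiv ℝ ψ y = _ := h2.fderiv
      rw [h3]
      simp
    have hscale : ∀ f : E3 → ℝ, ∫ y, f y = ((n : ℝ) ^ 3)⁻¹ * ∫ z, f (x + (n : ℝ)⁻¹ • z) := by
      intro f
      have h1 := Measure.integral_comp_inv_smul (μ := (volume : Measure E3))
        (fun y => f (x + y)) (n : ℝ)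
      rw [integral_add_left_eq_self (μ := (volume : Measure E3)) f x] at h1
      rw [h1]
      simp only [finrank_euclideanSpace, Fintype.card_fin, smul_eq_mul]
      rw [abs_of_nonneg (by positivity), ← mul_assoc, inv_mul_cancel₀ (by positivity), one_mul]
    have h := hC ψ hψ hψc v
    have e1 : ∫ y in Ω, w y * fderiv ℝ ψ y v = ((n : ℝ) ^ 3)⁻¹ * (n * ∫ z, F n z) := by
      rw [← integral_indicator hΩm, hscale, ← integral_const_mul (n : ℝ)]
      refine congrArg _ (integral_congr_ae (Eventually.of_forall fun z => ?_))
      simp only [F]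
      by_cases hz : x + (n : ℝ)⁻¹ • z ∈ Ω
      · rw [indicator_of_mem hz, indicator_of_mem hz, hψd, add_sub_cancel_left, smul_smul,
          mul_inv_cancel₀ hn0, one_smul]
        ring
      · rw [indicator_of_notMem hz, indicator_of_notMem hz]; ring
    have e2 : ∫ y, |ψ y| = ((n : ℝ) ^ 3)⁻¹ * ∫ z, |radialBump z| := by
      rw [hscale]
      refine congrArg _ (integral_congr_ae (Eventually.of_forall fun z => ?_))
      simp only [ψ]
      rw [add_sub_cancel_left, smul_smul, mul_inv_cancel₀ hn0, one_smul]
    rw [e1, e2, abs_mul, abs_mul, abs_of_nonneg (by positivity : (0 : ℝ) ≤ ((n : ℝ) ^ 3)⁻¹),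
      Nat.abs_cast] at h
    have h5 : (n : ℝ) * |∫ z, F n z| ≤ C v * ∫ z, |radialBump z| := by
      have hp : (0 : ℝ) < ((n : ℝ) ^ 3)⁻¹ := by positivity
      nlinarith
    rwa [le_inv_mul_iff₀ (by positivity)]
  have hlim0 : Tendsto (fun n => ∫ z, F n z) atTop (𝓝 0) := by
    rw [tendsto_zero_iff_abs_tendsto_zero]
    have hz : Tendsto (fun n : ℕ => (n : ℝ)⁻¹ * (C v * ∫ z, |radialBump z|)) atTop (𝓝 0) := by
      simpa using (tendsto_inv_atTop_nhds_zero_nat (𝕜 := ℝ)).mul_const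
        (C v * ∫ z, |radialBump z|)
    refine squeeze_zero' (Eventually.of_forall fun n => abs_nonneg _) ?_ hz
    filter_upwards [eventually_gt_atTop 0] with n hn using hbound n hn
  have := tendsto_nhds_unique hlim hlim0
  rw [integral_const_mul] at this
  exact (mul_eq_zero.1 this).resolve_right
    (setIntegral_halfSpace_fderiv_radialBump_pos hv0).ne'

/-! ### Positive semidefinite tensor measures -/

lemma abs_entry_le_trace {A : M3} (hA : A.PosSemidef) (i j : Fin 3) : |A i j| ≤ A.trace := by
  have hd : ∀ k, 0 ≤ A k k := fun k => hA.diag_nonneg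
  have hsym : A j i = A i j := by simpa using hA.isHermitian.apply i j
  have hq : ∀ x : Fin 3 → ℝ, 0 ≤ x ⬝ᵥ (A.mulVec x) := fun x => by
    simpa using hA.dotProduct_mulVec_nonneg x
  have h1 := hq (Pi.single i 1 + Pi.single j 1)
  have h2 := hq (Pi.single i 1 - Pi.single j 1)
  simp only [Matrix.mulVec_add, Matrix.mulVec_sub, dotProduct_add, dotProduct_sub, add_dotProduct,
    sub_dotProduct, Matrix.mulVec_single, single_dotProduct, MulOpposite.op_one, one_smul,
    Matrix.col_apply, one_mul] at h1 h2
  have htr : A i i + A j j ≤ 2 * A.trace := by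
    have hk : ∀ k, A k k ≤ A.trace := fun k =>
      Finset.single_le_sum (f := fun k => A k k) (fun k _ => hd k) (Finset.mem_univ k)
    linarith [hk i, hk j]
  rw [abs_le]
  constructor <;> linarith

namespace TensorMeasure

lemma entry_apply (R : TensorMeasure) (i j : Fin 3) (A : Set E3) : R.entry i j A = R A i j := rfl

/-- The trace of a tensor measure, a signed measure. -/
noncomputable def traceMeasure (R : TensorMeasure) : SignedMeasure E3 :=
  R.mapRange (Matrix.traceAddMonoidHom (Fin 3) ℝ) continuous_id.matrix_trace

lemma traceMeasure_apply (R : TensorMeasure) (A : Set E3) : R.traceMeasure A = (R A).trace := rfl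

variable {R : TensorMeasure} {K K' : Set E3}

lemma IsPosOn.zero_le_traceMeasure (hR : R.IsPosOn K) : 0 ≤[univ] R.traceMeasure := by
  rw [VectorMeasure.le_restrict_univ_iff_le, VectorMeasure.le_iff]
  intro A _
  rw [traceMeasure_apply]
  exact (hR.2 A).trace_nonneg

lemma IsPosOn.variation_entry_le (hR : R.IsPosOn K) (i j : Fin 3) :
    (R.entry i j).variation ≤
      R.traceMeasure.toMeasureOfZeroLE univ MeasurableSet.univ hR.zero_le_traceMeasure := by
  refine VectorMeasure.variation_le_of_forall_enorm_le fun A hA => ?_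
  rw [SignedMeasure.toMeasureOfZeroLE_apply _ _ _ hA, entry_apply, ← ofReal_norm,
    Real.norm_eq_abs, ENNReal.ofReal]
  rw [ENNReal.coe_le_coe, Real.toNNReal_le_iff_le_coe]
  simpa [traceMeasure_apply] using abs_entry_le_trace (hR.2 A) i j

lemma IsPosOn.trace_mono (hR : R.IsPosOn K) (hK : MeasurableSet K) (hK' : MeasurableSet K')
    (h : K' ⊆ K) : (R K').trace ≤ (R K).trace := by
  have h1 := VectorMeasure.of_add_of_sdiff (v := R.traceMeasure) hK' hK h
  simp only [traceMeasure_apply] at h1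
  have h2 := (hR.2 (K \ K')).trace_nonneg
  linarith

lemma IsPosOn.isFiniteMeasure_variation (hR : R.IsPosOn K) (i j : Fin 3) :
    IsFiniteMeasure (R.entry i j).variation :=
  have : IsFiniteMeasure (R.traceMeasure.toMeasureOfZeroLE univ MeasurableSet.univ
      hR.zero_le_traceMeasure) := inferInstance
  isFiniteMeasure_of_le _ (hR.variation_entry_le i j)

lemma IsPosOn.isFiniteMeasure_variation_restrict (hR : R.IsPosOn K) (hK' : MeasurableSet K')
    (i j : Fin 3) : IsFiniteMeasure ((R.entry i j).restrict K').variation := by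
  have := hR.isFiniteMeasure_variation i j
  rw [VectorMeasure.variation_restrict hK']
  infer_instance

lemma IsPosOn.abs_integral_entry_le (hR : R.IsPosOn K) (hK' : MeasurableSet K') {C : ℝ}
    (hC : 0 ≤ C) {f : E3 → ℝ} (hf : ∀ x ∈ K', |f x| ≤ C) (i j : Fin 3) :
    |∫ᵛ x in K', f x ∂<•(R.entry i j)| ≤ C * (R K').trace := by
  have hfin := hR.isFiniteMeasure_variation_restrict hK' i j
  have hae : ∀ᵐ x ∂((R.entry i j).restrict K').variation, ‖f x‖ ≤ C := by
    rw [VectorMeasure.variation_restrict hK', ae_restrict_iff' hK']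
    exact Eventually.of_forall hf
  have h := VectorMeasure.norm_integral_le_of_norm_le_const
    (B := (ContinuousLinearMap.lsmul ℝ ℝ).flip) hae
  have hB : ‖(ContinuousLinearMap.lsmul ℝ ℝ : ℝ →L[ℝ] ℝ →L[ℝ] ℝ).flip‖ ≤ 1 := by
    rw [ContinuousLinearMap.opNorm_flip]
    exact ContinuousLinearMap.opNorm_lsmul_le
  have htr : 0 ≤ (R K').trace := (hR.2 K').trace_nonneg
  have hvar : ((R.entry i j).restrict K').variation.real univ ≤ (R K').trace := by
    rw [VectorMeasure.variation_restrict hK', measureReal_restrict_apply_univ]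
    refine ENNReal.toReal_le_of_le_ofReal htr ((hR.variation_entry_le i j K').trans ?_)
    rw [SignedMeasure.toMeasureOfZeroLE_apply _ _ _ hK', ENNReal.ofReal, ENNReal.coe_le_coe,
      Real.le_toNNReal_iff_coe_le htr]
    simp [traceMeasure_apply]
  refine h.trans ?_
  have h3 : C * ‖(ContinuousLinearMap.lsmul ℝ ℝ : ℝ →L[ℝ] ℝ →L[ℝ] ℝ).flip‖ ≤ C :=
    mul_le_of_le_one_right hC hB
  exact mul_le_mul h3 hvar measureReal_nonneg hC

/-- The pairing of a positive tensor measure with a bounded field is controlled by its trace. -/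
lemma IsPosOn.abs_pairing_le (hR : R.IsPosOn K) (hK : MeasurableSet K) (hK' : MeasurableSet K')
    (hsub : K' ⊆ K) {C : ℝ} (hC : 0 ≤ C) {A : E3 → M3} (hA : ∀ x ∈ K', ∀ i j, |A x i j| ≤ C) :
    |R.pairing K' A| ≤ 9 * C * (R K).trace := by
  have hij : ∀ i j, |∫ᵛ x in K', A x i j ∂<•(R.entry i j)| ≤ C * (R K).trace := fun i j =>
    (hR.abs_integral_entry_le hK' hC (fun x hx => hA x hx i j) i j).trans
      (mul_le_mul_of_nonneg_left (hR.trace_mono hK hK' hsub) hC)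
  calc |R.pairing K' A|
      ≤ ∑ i : Fin 3, ∑ j : Fin 3, C * (R K).trace :=
        (Finset.abs_sum_le_sum_abs _ _).trans (Finset.sum_le_sum fun i _ =>
          (Finset.abs_sum_le_sum_abs _ _).trans (Finset.sum_le_sum fun j _ => hij i j))
    _ = 9 * C * (R K).trace := by
        simp only [Finset.sum_const, Finset.card_univ, Fintype.card_fin, nsmul_eq_mul]
        push_cast
        ring

lemma IsPosOn.eq_zero_of_trace (hR : R.IsPosOn K) (hK : MeasurableSet K)
    (h : (R K).trace = 0) : R = 0 := by
  ext1 A hA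
  have h1 : R (A \ K) = 0 := hR.1 _ disjoint_sdiff_left
  have h2 : R (A ∩ K) = 0 := by
    rw [← (hR.2 _).trace_eq_zero_iff]
    exact le_antisymm ((hR.trace_mono hK (hA.inter hK) inter_subset_right).trans h.le)
      (hR.2 _).trace_nonneg
  have h3 := VectorMeasure.of_union (v := R) (disjoint_sdiff_inter (s := A) (t := K))
    (hA.diff hK) (hA.inter hK)
  rw [sdiff_union_inter, h1, h2, add_zero] at h3
  rw [h3]
  rfl

end TensorMeasure

/-- The total trace of a bounded defect is measurable in time. -/
lemma IsBoundedDefect.aemeasurable_trace {T : ℝ} {K : Set E3} {R : ℝ → TensorMeasure}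
    (hR : IsBoundedDefect T K R) (hK : MeasurableSet K) :
    AEMeasurable (fun t => (R t K).trace) (volume.restrict (Ioo 0 T)) := by
  have h1 : AEMeasurable (fun t => ∑ i, ∫ᵛ x in K, (1 : ℝ) ∂<•((R t).entry i i))
      (volume.restrict (Ioo 0 T)) :=
    Finset.aemeasurable_fun_sum _ fun i _ => hR.measurable (fun _ => 1) continuous_const i i
  refine h1.congr ?_
  filter_upwards [hR.pos] with t ht
  refine Finset.sum_congr rfl fun i _ => ?_
  have := ht.isFiniteMeasure_variation_restrict hK i i
  rw [VectorMeasure.integral_const]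
  simp [TensorMeasure.entry_apply]

/-! ### The viscous potential and its conjugate -/

lemma isSymm_symPart (A : M3) : (symPart A).IsSymm := by
  ext i j
  simp only [symPart, Matrix.transpose_apply, Matrix.smul_apply, Matrix.add_apply, smul_eq_mul]
  ring

lemma frob_symPart {S : M3} (hS : S.IsSymm) (A : M3) : frob S (symPart A) = frob S A := by
  have h := fun i j => hS.apply i j
  simp only [frob, symPart, Fin.sum_univ_three, Matrix.smul_apply, Matrix.add_apply,
    Matrix.transpose_apply, smul_eq_mul]
  rw [h 0 1, h 0 2, h 1 2]
  ring

namespace IsPotential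

variable {F : M3 → ℝ} {q : ℝ}

lemma continuous_symPart (hF : IsPotential F q) :
    Continuous fun A : Fin 3 → Fin 3 → ℝ => F (symPart (Matrix.of A)) := by
  have hconv : ConvexOn ℝ univ fun A : Fin 3 → Fin 3 → ℝ => F (symPart (Matrix.of A)) := by
    refine ⟨convex_univ, fun A _ B _ a b ha hb hab => ?_⟩
    have h := hF.convex.2 (isSymm_symPart (Matrix.of A)) (isSymm_symPart (Matrix.of B)) ha hb hab
    have he : symPart (Matrix.of (a • A + b • B)) =
        a • symPart (Matrix.of A) + b • symPart (Matrix.of B) := by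
      ext i j
      simp [symPart]
      ring
    simp only [he]
    exact h
  exact continuousOn_univ.1 (hconv.continuousOn isOpen_univ)

lemma measurable_conjugate :
    Measurable fun A : Fin 3 → Fin 3 → ℝ => conjugate F (Matrix.of A) := by
  refine LowerSemicontinuous.measurable (lowerSemicontinuous_iSup fun D => ?_)
  refine Continuous.lowerSemicontinuous (continuous_coe_real_ereal.comp ?_)
  simp only [frob, Matrix.of_apply]
  fun_prop

/-- The Fenchel–Young inequality. -/
lemma le_conjugate {D : M3} (hD : D.IsSymm) (S : M3) :
    ((frob S D - F D : ℝ) : EReal) ≤ conjugate F S :=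
  le_iSup (fun D : {D : M3 // D.IsSymm} => ((frob S D.1 - F D.1 : ℝ) : EReal)) ⟨D, hD⟩

lemma le_toReal_conjugate {S : M3} (h : (conjugate F S).toENNReal ≠ ⊤) {D : M3}
    (hD : D.IsSymm) : frob S D - F D ≤ (conjugate F S).toENNReal.toReal := by
  have hle := le_conjugate (F := F) hD S
  have htop : conjugate F S ≠ ⊤ := fun h' => h (by simp [h'])
  rw [EReal.toENNReal_of_ne_top htop]
  rw [ENNReal.toReal_ofReal']
  refine le_max_of_le_left ?_
  rw [← EReal.toReal_coe (frob S D - F D)]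
  exact EReal.toReal_le_toReal hle (EReal.coe_ne_bot _) htop

lemma memSubdifferential_of_le {S D : M3} (hS : S.IsSymm)
    (htop : (conjugate F S).toENNReal ≠ ⊤)
    (h : F D + (conjugate F S).toENNReal.toReal ≤ frob S D) : MemSubdifferential F D S := by
  refine ⟨hS, fun D' hD' => ?_⟩
  have h1 := le_toReal_conjugate htop hD'
  have h2 : frob S (D' - D) = frob S D' - frob S D := by
    simp [frob, mul_sub, Finset.sum_sub_distrib]
  linarith

end IsPotential

/-! ### Calculus on the space-time cylinder -/

instance isAddHaarMeasure_volume_spaceTime : (volume : Measure (ℝ × E3)).IsAddHaarMeasure :=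
  inferInstanceAs ((volume : Measure ℝ).prod (volume : Measure E3)).IsAddHaarMeasure

/-- The time derivative of a function on space-time. -/
noncomputable def dt (f : ℝ × E3 → ℝ) (z : ℝ × E3) : ℝ := fderiv ℝ f z (1, 0)

/-- The `j`-th spatial derivative of a function on space-time. -/
noncomputable def dx (j : Fin 3) (f : ℝ × E3 → ℝ) (z : ℝ × E3) : ℝ :=
  fderiv ℝ f z (0, EuclideanSpace.single j 1)

lemma hasDerivAt_slice {f : ℝ × E3 → ℝ} {t : ℝ} {x : E3} (hf : DifferentiableAt ℝ f (t, x)) :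
    HasDerivAt (fun s => f (s, x)) (dt f (t, x)) t := by
  have h1 : HasDerivAt (fun s : ℝ => (s, x)) ((1 : ℝ), (0 : E3)) t :=
    (hasDerivAt_id t).prodMk (hasDerivAt_const t x)
  exact hf.hasFDerivAt.comp_hasDerivAt t h1

lemma deriv_slice_eq_dt {f : ℝ × E3 → ℝ} {t : ℝ} {x : E3} (hf : DifferentiableAt ℝ f (t, x)) :
    deriv (fun s => f (s, x)) t = dt f (t, x) :=
  (hasDerivAt_slice hf).deriv

lemma hasFDerivAt_slice {f : ℝ × E3 → ℝ} {t : ℝ} {x : E3} (hf : DifferentiableAt ℝ f (t, x)) :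
    HasFDerivAt (fun y => f (t, y)) ((fderiv ℝ f (t, x)).comp (ContinuousLinearMap.inr ℝ ℝ E3)) x :=
  hf.hasFDerivAt.comp x (hasFDerivAt_prodMk_right t x)

lemma pderiv_slice_eq_dx {f : ℝ × E3 → ℝ} {t : ℝ} {x : E3} (hf : DifferentiableAt ℝ f (t, x))
    (j : Fin 3) : pderiv j (fun y => f (t, y)) x = dx j f (t, x) := by
  rw [pderiv, (hasFDerivAt_slice hf).fderiv]
  rfl

lemma fderiv_apply_coord {E : Type*} [NormedAddCommGroup E] [NormedSpace ℝ E] {v : E → E3} {x : E}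
    (hv : DifferentiableAt ℝ v x) (e : E) (i : Fin 3) :
    fderiv ℝ v x e i = fderiv ℝ (fun y => v y i) x e := by
  have h : HasFDerivAt (fun y => v y i)
      ((EuclideanSpace.proj i : E3 →L[ℝ] ℝ).comp (fderiv ℝ v x)) x :=
    (EuclideanSpace.proj i : E3 →L[ℝ] ℝ).hasFDerivAt.comp x hv.hasFDerivAt
  rw [h.fderiv]
  rfl

lemma grad_apply {v : E3 → E3} {x : E3} (hv : DifferentiableAt ℝ v x) (i j : Fin 3) :
    grad v x i j = pderiv j (fun y => v y i) x :=
  fderiv_apply_coord hv _ i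

lemma grad_slice_eq_dx {v : ℝ → E3 → E3} {t : ℝ} {x : E3}
    (hv : DifferentiableAt ℝ (fun z : ℝ × E3 => v z.1 z.2) (t, x)) (i j : Fin 3) :
    grad (v t) x i j = dx j (fun z => v z.1 z.2 i) (t, x) := by
  have h1 : DifferentiableAt ℝ (v t) x :=
    DifferentiableAt.comp (g := fun z : ℝ × E3 => v z.1 z.2) x hv
      (hasFDerivAt_prodMk_right t x).differentiableAt
  have h2 : DifferentiableAt ℝ (fun z : ℝ × E3 => v z.1 z.2 i) (t, x) :=
    (EuclideanSpace.proj i : E3 →L[ℝ] ℝ).differentiableAt.comp (t, x) hv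
  rw [grad_apply h1, ← pderiv_slice_eq_dx h2]

lemma dt_mul {f g : ℝ × E3 → ℝ} {z : ℝ × E3} (hf : DifferentiableAt ℝ f z)
    (hg : DifferentiableAt ℝ g z) : dt (fun z => f z * g z) z = dt f z * g z + f z * dt g z := by
  rw [dt, fderiv_fun_mul hf hg]
  simp [dt]; ring

lemma dx_mul {f g : ℝ × E3 → ℝ} {z : ℝ × E3} (hf : DifferentiableAt ℝ f z)
    (hg : DifferentiableAt ℝ g z) (j : Fin 3) :
    dx j (fun z => f z * g z) z = dx j f z * g z + f z * dx j g z := by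
  rw [dx, fderiv_fun_mul hf hg]
  simp [dx]; ring

lemma continuousOn_dt {U : Set (ℝ × E3)} (hU : IsOpen U) {f : ℝ × E3 → ℝ}
    (hf : ContDiffOn ℝ 1 f U) : ContinuousOn (dt f) U :=
  (hf.continuousOn_fderiv_of_isOpen hU le_rfl).clm_apply continuousOn_const

lemma continuousOn_dx {U : Set (ℝ × E3)} (hU : IsOpen U) {f : ℝ × E3 → ℝ}
    (hf : ContDiffOn ℝ 1 f U) (j : Fin 3) : ContinuousOn (dx j f) U :=
  (hf.continuousOn_fderiv_of_isOpen hU le_rfl).clm_apply continuousOn_const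

lemma tsupport_dt_subset (f : ℝ × E3 → ℝ) : tsupport (dt f) ⊆ tsupport f :=
  tsupport_fderiv_apply_subset ℝ _

lemma tsupport_dx_subset (f : ℝ × E3 → ℝ) (j : Fin 3) : tsupport (dx j f) ⊆ tsupport f :=
  tsupport_fderiv_apply_subset ℝ _

lemma continuous_dt {f : ℝ × E3 → ℝ} (hf : ContDiff ℝ 1 f) : Continuous (dt f) :=
  (hf.continuous_fderiv one_ne_zero).clm_apply continuous_const

lemma continuous_dx {f : ℝ × E3 → ℝ} (hf : ContDiff ℝ 1 f) (j : Fin 3) : Continuous (dx j f) :=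
  (hf.continuous_fderiv one_ne_zero).clm_apply continuous_const

/-- The weak form of a space-time divergence. -/
lemma setIntegral_spaceTime_div {U : Set (ℝ × E3)} (hU : IsOpen U) {f : ℝ × E3 → ℝ}
    {g : Fin 3 → ℝ × E3 → ℝ} (hf : ContDiffOn ℝ 1 f U) (hg : ∀ j, ContDiffOn ℝ 1 (g j) U)
    {φ : ℝ × E3 → ℝ} (hφ : ContDiff ℝ 1 φ) (hc : HasCompactSupport φ) (hsub : tsupport φ ⊆ U) :
    ∫ z in U, (f z * dt φ z + ∑ j, g j z * dx j φ z) =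
      - ∫ z in U, (dt f z + ∑ j, dx j (g j) z) * φ z := by
  have i1 : IntegrableOn (fun z => f z * dt φ z) U :=
    (integrable_mul_of_tsupport_subset hU hf.continuousOn (continuous_dt hφ)
      (hc.fderiv_apply ℝ _) ((tsupport_dt_subset φ).trans hsub)).integrableOn
  have i2 : ∀ j, IntegrableOn (fun z => g j z * dx j φ z) U := fun j =>
    (integrable_mul_of_tsupport_subset hU (hg j).continuousOn (continuous_dx hφ j)
      (hc.fderiv_apply ℝ _) ((tsupport_dx_subset φ j).trans hsub)).integrableOn
  have i3 : IntegrableOn (fun z => dt f z * φ z) U :=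
    (integrable_mul_of_tsupport_subset hU (continuousOn_dt hU hf) hφ.continuous hc
      hsub).integrableOn
  have i4 : ∀ j, IntegrableOn (fun z => dx j (g j) z * φ z) U := fun j =>
    (integrable_mul_of_tsupport_subset hU (continuousOn_dx hU (hg j) j) hφ.continuous hc
      hsub).integrableOn
  simp_rw [add_mul, Finset.sum_mul]
  rw [integral_add i1 (integrable_finsetSum _ fun j _ => i2 j),
    integral_add i3 (integrable_finsetSum _ fun j _ => i4 j),
    integral_finsetSum _ fun j _ => i2 j, integral_finsetSum _ fun j _ => i4 j, neg_add,
    ← Finset.sum_neg_distrib]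
  congr 1
  · exact setIntegral_mul_fderiv hU hf hφ hc hsub _
  · exact Finset.sum_congr rfl fun j _ => setIntegral_mul_fderiv hU (hg j) hφ hc hsub _

namespace Data

variable {P : Data}

lemma Admissible.isOpen_Q (hP : P.Admissible) : IsOpen P.Q :=
  isOpen_Ioo.prod hP.domain.isOpen

lemma Admissible.measurableSet_Q (hP : P.Admissible) : MeasurableSet P.Q :=
  hP.isOpen_Q.measurableSet

lemma Admissible.measurableSet_Ω (hP : P.Admissible) : MeasurableSet P.Ω :=
  hP.domain.isOpen.measurableSet

lemma Admissible.isCompact_closure (hP : P.Admissible) : IsCompact (closure P.Ω) :=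
  hP.domain.isBounded.isCompact_closure

lemma Admissible.isCompact_Qc (hP : P.Admissible) : IsCompact P.Qc :=
  isCompact_Icc.prod hP.isCompact_closure

lemma Q_subset_Qc : P.Q ⊆ P.Qc := prod_mono Ioo_subset_Icc_self subset_closure

lemma Admissible.uniqueDiffOn_Qc (hP : P.Admissible) : UniqueDiffOn ℝ P.Qc :=
  (uniqueDiffOn_Icc hP.T_pos).prod hP.domain.uniqueDiffOn_closure

lemma Admissible.volume_Ω_lt_top (hP : P.Admissible) : volume P.Ω < ⊤ :=
  (measure_mono subset_closure).trans_lt hP.isCompact_closure.measure_lt_top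

lemma Admissible.isFiniteMeasure_Ω (hP : P.Admissible) : IsFiniteMeasure (volume.restrict P.Ω) :=
  ⟨by simpa using hP.volume_Ω_lt_top⟩

lemma Admissible.volume_Q_lt_top (hP : P.Admissible) : volume P.Q < ⊤ :=
  (measure_mono Q_subset_Qc).trans_lt hP.isCompact_Qc.measure_lt_top

lemma Admissible.isFiniteMeasure_Q (hP : P.Admissible) : IsFiniteMeasure (volume.restrict P.Q) :=
  ⟨by simpa using hP.volume_Q_lt_top⟩

lemma volume_restrict_Q : (volume.restrict P.Q : Measure (ℝ × E3)) =
    (volume.restrict (Ioo 0 P.T)).prod (volume.restrict P.Ω) := by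
  rw [Measure.prod_restrict]; rfl

lemma Admissible.integrableOn_of_bounded (hP : P.Admissible) {f : ℝ × E3 → ℝ}
    (hf : ContinuousOn f P.Q) {C : ℝ} (hC : ∀ z ∈ P.Q, |f z| ≤ C) : IntegrableOn f P.Q :=
  have := hP.isFiniteMeasure_Q
  Integrable.of_bound (hf.aestronglyMeasurable hP.measurableSet_Q) C
    ((ae_restrict_iff' hP.measurableSet_Q).2 (Eventually.of_forall hC))

lemma Admissible.exists_bound (hP : P.Admissible) {f : ℝ × E3 → ℝ} (hf : ContinuousOn f P.Qc) :
    ∃ C, 0 ≤ C ∧ ∀ z ∈ P.Qc, |f z| ≤ C := by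
  obtain ⟨C, hC⟩ := hP.isCompact_Qc.exists_bound_of_continuousOn hf
  exact ⟨max C 0, le_max_right _ _, fun z hz => (hC z hz).trans (le_max_left _ _)⟩

lemma Admissible.exists_fderiv_bound (hP : P.Admissible) {f : ℝ × E3 → ℝ}
    (hf : ContDiffOn ℝ 1 f P.Qc) :
    ∃ C, 0 ≤ C ∧ ∀ z ∈ P.Q, |dt f z| ≤ C ∧ ∀ j, |dx j f z| ≤ C := by
  obtain ⟨C, hC⟩ := hP.isCompact_Qc.exists_bound_of_continuousOn
    (hf.continuousOn_fderivWithin hP.uniqueDiffOn_Qc le_rfl)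
  have hb : ∀ z ∈ P.Q, ‖fderiv ℝ f z‖ ≤ C := fun z hz => by
    rw [← fderivWithin_of_mem_nhds (mem_of_superset (hP.isOpen_Q.mem_nhds hz) Q_subset_Qc)]
    exact hC z (Q_subset_Qc hz)
  refine ⟨max C 0, le_max_right _ _, fun z hz => ⟨?_, fun j => ?_⟩⟩
  · refine ((fderiv ℝ f z).le_opNorm _).trans ?_
    simpa [Prod.norm_def] using Or.inl (hb z hz)
  · refine ((fderiv ℝ f z).le_opNorm _).trans ?_
    simpa [Prod.norm_def] using Or.inl (hb z hz)

/-! ### Cut-off in time and truncation of values -/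

/-- The truncated cylinder `(0,τ) × Ω`. -/
def Qτ (P : Data) (τ : ℝ) : Set (ℝ × E3) := Ioo 0 τ ×ˢ P.Ω

lemma Admissible.measurableSet_Qτ (hP : P.Admissible) (τ : ℝ) : MeasurableSet (P.Qτ τ) :=
  measurableSet_Ioo.prod hP.measurableSet_Ω

lemma Qτ_subset_Q {τ : ℝ} (h : τ ≤ P.T) : P.Qτ τ ⊆ P.Q :=
  prod_mono (Ioo_subset_Ioo_right h) le_rfl

/-- A smooth cut-off function in time, supported in `[1/n, τ - 1/n]`. -/
noncomputable def timeCut (τ : ℝ) (n : ℕ) (t : ℝ) : ℝ :=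
  Real.smoothTransition (n * t - 1) * Real.smoothTransition (n * (τ - t) - 1)

lemma contDiff_timeCut (τ : ℝ) (n : ℕ) : ContDiff ℝ 1 (timeCut τ n) :=
  (Real.smoothTransition.contDiff.comp ((contDiff_const.mul contDiff_id).sub contDiff_const)).mul
    (Real.smoothTransition.contDiff.comp
      ((contDiff_const.mul (contDiff_const.sub contDiff_id)).sub contDiff_const))

lemma timeCut_nonneg (τ : ℝ) (n : ℕ) (t : ℝ) : 0 ≤ timeCut τ n t :=
  mul_nonneg (Real.smoothTransition.nonneg _) (Real.smoothTransition.nonneg _)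

lemma timeCut_le_one (τ : ℝ) (n : ℕ) (t : ℝ) : timeCut τ n t ≤ 1 :=
  mul_le_one₀ (Real.smoothTransition.le_one _) (Real.smoothTransition.nonneg _)
    (Real.smoothTransition.le_one _)

lemma timeCut_eq_zero {τ : ℝ} {n : ℕ} {t : ℝ} (h : n * t ≤ 1 ∨ n * (τ - t) ≤ 1) :
    timeCut τ n t = 0 := by
  rcases h with h | h
  · rw [timeCut, Real.smoothTransition.zero_of_nonpos (by linarith), zero_mul]
  · rw [timeCut, Real.smoothTransition.zero_of_nonpos (x := n * (τ - t) - 1) (by linarith),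
      mul_zero]

lemma timeCut_eq_zero_of_notMem {τ : ℝ} (n : ℕ) {t : ℝ} (h : t ∉ Ioo 0 τ) :
    timeCut τ n t = 0 := by
  refine timeCut_eq_zero ?_
  have hn : (0 : ℝ) ≤ n := n.cast_nonneg
  by_contra! h'
  apply h
  constructor
  · by_contra! h0; nlinarith
  · by_contra! h0; nlinarith

lemma tendsto_timeCut (τ t : ℝ) :
    Tendsto (fun n => timeCut τ n t) atTop (𝓝 ((Ioo 0 τ).indicator 1 t)) := by
  by_cases ht : t ∈ Ioo 0 τ
  · rw [indicator_of_mem ht]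
    refine tendsto_const_nhds.congr' ?_
    have h1 := (tendsto_natCast_atTop_atTop (R := ℝ)).atTop_mul_const ht.1
    have h2 := (tendsto_natCast_atTop_atTop (R := ℝ)).atTop_mul_const (sub_pos.2 ht.2)
    filter_upwards [h1.eventually_ge_atTop 2, h2.eventually_ge_atTop 2] with n hn1 hn2
    rw [timeCut, Real.smoothTransition.one_of_one_le (by linarith),
      Real.smoothTransition.one_of_one_le (by linarith)]
    simp
  · rw [indicator_of_notMem ht]
    exact tendsto_const_nhds.congr fun n => (timeCut_eq_zero_of_notMem n ht).symm

/-- The cut-off function `θ(t) trunc (f(t,x))`, extended by zero. For `f` in `C¹` that vanishes on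
the lateral boundary it is an admissible test function. -/
noncomputable def cut (P : Data) (τ : ℝ) (n : ℕ) (f : ℝ × E3 → ℝ) : ℝ × E3 → ℝ :=
  P.Q.indicator fun z => timeCut τ n z.1 * trunc n (f z)

section Cut

variable {τ : ℝ} {n : ℕ} {f : ℝ × E3 → ℝ}

/-- The truncation vanishes near the lateral boundary, so that the cut-off function has compact
support whatever the geometry of the boundary is. -/
lemma Admissible.cut_isTest (hP : P.Admissible) (hτ : τ ≤ P.T) (hn : n ≠ 0)
    (hf : ContDiffOn ℝ 1 f P.Qc) (h0 : ∀ t ∈ Icc 0 P.T, ∀ x ∈ frontier P.Ω, f (t, x) = 0) :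
    ContDiff ℝ 1 (P.cut τ n f) ∧ HasCompactSupport (P.cut τ n f) ∧
      tsupport (P.cut τ n f) ⊆ P.Q := by
  have hn0 : (0 : ℝ) < n := by exact_mod_cast Nat.pos_of_ne_zero hn
  let K : Set (ℝ × E3) := P.Qc ∩ {z | 1 ≤ n * z.1 ∧ 1 ≤ n * (τ - z.1)} ∩ {z | 1 ≤ n * |f z|}
  have hK : IsCompact K := by
    have hc : IsCompact (P.Qc ∩ {z : ℝ × E3 | 1 ≤ n * z.1 ∧ 1 ≤ n * (τ - z.1)}) := by
      refine hP.isCompact_Qc.inter_right ?_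
      have c1 : Continuous fun z : ℝ × E3 => (n : ℝ) * z.1 := by fun_prop
      have c2 : Continuous fun z : ℝ × E3 => (n : ℝ) * (τ - z.1) := by fun_prop
      exact (isClosed_le continuous_const c1).inter (isClosed_le continuous_const c2)
    have hcl : IsClosed K := by
      have hcont : ContinuousOn (fun z => n * |f z|)
          (P.Qc ∩ {z : ℝ × E3 | 1 ≤ n * z.1 ∧ 1 ≤ n * (τ - z.1)}) :=
        continuousOn_const.mul (hf.continuousOn.mono inter_subset_left).abs
      exact hcont.preimage_isClosed_of_isClosed hc.isClosed isClosed_Ici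
    exact hc.of_isClosed_subset hcl inter_subset_left
  have hKQ : K ⊆ P.Q := by
    rintro ⟨t, x⟩ ⟨⟨⟨ht, hx⟩, h1, h2⟩, h3⟩
    simp only [mem_ofPred_eq] at h1 h2 h3
    refine ⟨⟨?_, ?_⟩, ?_⟩
    · by_contra! h
      have : (n : ℝ) * t ≤ 0 := mul_nonpos_of_nonneg_of_nonpos hn0.le h
      linarith
    · by_contra! h
      have h' : (n : ℝ) * (τ - t) ≤ 0 :=
        mul_nonpos_of_nonneg_of_nonpos hn0.le (by linarith)
      linarith
    · by_contra hxΩ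
      have hxf : x ∈ frontier P.Ω := by
        rw [hP.domain.isOpen.frontier_eq]; exact ⟨hx, hxΩ⟩
      rw [h0 t ht x hxf] at h3
      norm_num at h3
  have hcd : ContDiffOn ℝ 1 (fun z : ℝ × E3 => timeCut τ n z.1 * trunc n (f z)) P.Q :=
    ((contDiff_timeCut τ n).comp contDiff_fst).contDiffOn.mul
      (((contDiff_trunc n).of_le (by exact_mod_cast le_top)).comp_contDiffOn (hf.mono Q_subset_Qc))
  have h := contDiff_indicator_of_compact hP.isOpen_Q hK hKQ hcd (fun z hz hzK => by
    by_cases h1 : 1 ≤ n * z.1 ∧ 1 ≤ n * (τ - z.1)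
    · have h2 : ¬ (1 ≤ n * |f z|) := fun h2 => hzK ⟨⟨Q_subset_Qc hz, h1⟩, h2⟩
      rw [trunc_eq_zero (not_le.1 h2).le, mul_zero]
    · rw [timeCut_eq_zero, zero_mul]
      by_contra! h2
      exact h1 ⟨h2.1.le, h2.2.le⟩)
  exact ⟨h.1, h.2.1, h.2.2.trans hKQ⟩

lemma abs_cut_le {z : ℝ × E3} : |P.cut τ n f z| ≤ |f z| := by
  by_cases hz : z ∈ P.Q
  · rw [cut, indicator_of_mem hz, abs_mul, abs_of_nonneg (timeCut_nonneg _ _ _)]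
    exact (mul_le_of_le_one_left (abs_nonneg _) (timeCut_le_one _ _ _)).trans (abs_trunc_le _ _)
  · rw [cut, indicator_of_notMem hz, abs_zero]
    exact abs_nonneg _

lemma tendsto_cut (hτ : τ ≤ P.T) {z : ℝ × E3} :
    Tendsto (fun n => P.cut τ n f z) atTop (𝓝 ((P.Qτ τ).indicator f z)) := by
  by_cases hz : z ∈ P.Q
  · have h1 : ∀ n, P.cut τ n f z = timeCut τ n z.1 * trunc n (f z) := fun n => by
      rw [cut, indicator_of_mem hz]
    simp_rw [h1]
    have h2 := (tendsto_timeCut τ z.1).mul (tendsto_trunc (f z))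
    convert h2 using 2
    by_cases ht : z.1 ∈ Ioo 0 τ
    · rw [indicator_of_mem ht, indicator_of_mem (show z ∈ P.Qτ τ from ⟨ht, hz.2⟩)]; simp
    · rw [indicator_of_notMem ht, indicator_of_notMem (fun h : z ∈ P.Qτ τ => ht h.1)]; simp
  · have h1 : ∀ n, P.cut τ n f z = 0 := fun n => by rw [cut, indicator_of_notMem hz]
    simp_rw [h1]
    rw [indicator_of_notMem fun h => hz (Qτ_subset_Q hτ h)]
    exact tendsto_const_nhds

lemma Admissible.dx_cut (hP : P.Admissible) (hf : ContDiffOn ℝ 1 f P.Qc)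
    {z : ℝ × E3} (hz : z ∈ P.Q) (j : Fin 3) :
    dx j (P.cut τ n f) z = timeCut τ n z.1 * deriv (trunc n) (f z) * dx j f z := by
  have hev : P.cut τ n f =ᶠ[𝓝 z] fun z => timeCut τ n z.1 * trunc n (f z) := by
    filter_upwards [hP.isOpen_Q.mem_nhds hz] with y hy
    rw [cut, indicator_of_mem hy]
  have hfz : DifferentiableAt ℝ f z :=
    (hf.contDiffAt (mem_of_superset (hP.isOpen_Q.mem_nhds hz) Q_subset_Qc)).differentiableAt
      one_ne_zero
  have h1 : HasFDerivAt (fun z : ℝ × E3 => timeCut τ n z.1)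
      ((deriv (timeCut τ n) z.1) • ContinuousLinearMap.fst ℝ ℝ E3) z :=
    (((contDiff_timeCut τ n).differentiable one_ne_zero z.1).hasDerivAt).comp_hasFDerivAt z
      hasFDerivAt_fst
  have h2 : HasFDerivAt (fun z : ℝ × E3 => trunc n (f z))
      ((deriv (trunc n) (f z)) • fderiv ℝ f z) z :=
    (((contDiff_trunc n).differentiable (by simp) (f z)).hasDerivAt).comp_hasFDerivAt z
      hfz.hasFDerivAt
  have h3 : fderiv ℝ (fun z : ℝ × E3 => timeCut τ n z.1 * trunc n (f z)) z = _ :=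
    (h1.mul h2).fderiv
  rw [dx, hev.fderiv_eq, h3]
  simp [dx, mul_assoc]

/-- The spatial derivatives of the cut-off functions converge almost everywhere, because the
derivative of `f` vanishes almost everywhere on the zero set of `f`. -/
lemma Admissible.ae_tendsto_dx_cut (hP : P.Admissible)
    (hf : ContDiffOn ℝ 1 f P.Qc) (j : Fin 3) :
    ∀ᵐ z ∂(volume.restrict P.Q),
      Tendsto (fun n => dx j (P.cut τ n f) z) atTop (𝓝 ((P.Qτ τ).indicator (dx j f) z)) := by
  rw [ae_restrict_iff' hP.measurableSet_Q]
  have hae := ae_fderiv_eq_zero_of_eq_zero (μ := (volume : Measure (ℝ × E3))) hP.isOpen_Q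
    ((hf.mono Q_subset_Qc).differentiableOn one_ne_zero)
  filter_upwards [hae] with z hz0 hz
  have hlim : Tendsto (fun n => timeCut τ n z.1 * deriv (trunc n) (f z) * dx j f z) atTop
      (𝓝 ((P.Qτ τ).indicator (dx j f) z)) := by
    by_cases hfz : f z = 0
    · have : dx j f z = 0 := by rw [dx, hz0 hz hfz]; rfl
      simp only [this, mul_zero]
      have h0 : (P.Qτ τ).indicator (dx j f) z = 0 := by
        by_cases h : z ∈ P.Qτ τ
        · rw [indicator_of_mem h, this]
        · exact indicator_of_notMem h _
      rw [h0]
      exact tendsto_const_nhds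
    · have h2 := ((tendsto_timeCut τ z.1).mul (tendsto_deriv_trunc hfz)).mul_const (dx j f z)
      convert h2 using 2
      by_cases ht : z.1 ∈ Ioo 0 τ
      · rw [indicator_of_mem ht, indicator_of_mem (show z ∈ P.Qτ τ from ⟨ht, hz.2⟩)]; simp
      · rw [indicator_of_notMem ht, indicator_of_notMem (fun h : z ∈ P.Qτ τ => ht h.1)]; simp
  exact hlim.congr fun n => (hP.dx_cut hf hz j).symm

/-- Uniform bound on the spatial derivatives of the cut-off functions. -/
lemma Admissible.exists_dx_cut_bound (hP : P.Admissible) (hf : ContDiffOn ℝ 1 f P.Qc) :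
    ∃ C, 0 ≤ C ∧ ∀ (τ : ℝ) (n : ℕ), n ≠ 0 → ∀ z ∈ P.Q, ∀ j,
      |dx j (P.cut τ n f) z| ≤ timeCut τ n z.1 * C := by
  obtain ⟨C1, hC1, h1⟩ := exists_deriv_gap_bound
  obtain ⟨C2, hC2, h2⟩ := hP.exists_fderiv_bound hf
  refine ⟨C1 * C2, by positivity, fun τ n hn z hz j => ?_⟩
  rw [hP.dx_cut hf hz, abs_mul, abs_mul, abs_of_nonneg (timeCut_nonneg _ _ _), mul_assoc,
    deriv_trunc hn]
  gcongr
  · exact timeCut_nonneg _ _ _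
  · exact h1 _
  · exact (h2 z hz).2 j

end Cut

/-- The fundamental theorem of calculus in time, integrated over the domain. -/
lemma Admissible.setIntegral_dt (hP : P.Admissible) {τ : ℝ} (hτ0 : 0 ≤ τ) (hτ : τ ≤ P.T)
    {f : ℝ × E3 → ℝ} (hf : ContDiffOn ℝ 1 f P.Qc) :
    ∫ z in P.Qτ τ, dt f z = (∫ x in P.Ω, f (τ, x)) - ∫ x in P.Ω, f (0, x) := by
  obtain ⟨C, hC, hb⟩ := hP.exists_fderiv_bound hf
  have hfQ : ContDiffOn ℝ 1 f P.Q := hf.mono Q_subset_Qc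
  have hint : IntegrableOn (dt f) (P.Qτ τ) :=
    (hP.integrableOn_of_bounded (continuousOn_dt hP.isOpen_Q hfQ)
      (fun z hz => (hb z hz).1)).mono_set (Qτ_subset_Q hτ)
  have hslice : ∀ s ∈ Icc 0 P.T, IntegrableOn (fun x => f (s, x)) P.Ω := fun s hs =>
    ((hf.continuousOn.comp (by fun_prop) (fun x hx => ⟨hs, hx⟩ :
      MapsTo (fun x => (s, x)) (closure P.Ω) P.Qc)).integrableOn_compact
        hP.isCompact_closure).mono_set subset_closure
  have hprod : (volume.restrict (P.Qτ τ) : Measure (ℝ × E3)) =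
      (volume.restrict (Ioo 0 τ)).prod (volume.restrict P.Ω) := by
    rw [Measure.prod_restrict]; rfl
  rw [IntegrableOn, hprod] at hint
  rw [hprod, integral_prod_symm _ hint,
    ← integral_sub (hslice τ ⟨hτ0, hτ⟩) (hslice 0 ⟨le_rfl, hP.T_pos.le⟩)]
  refine setIntegral_congr_ae hP.measurableSet_Ω ?_
  have hae := (ae_restrict_iff' hP.measurableSet_Ω).1 hint.prod_left_ae
  filter_upwards [hae] with x hxint hx
  rw [← integral_Ioc_eq_integral_Ioo, ← intervalIntegral.integral_of_le hτ0]
  refine intervalIntegral.integral_eq_sub_of_hasDerivAt_of_le (f := fun s => f (s, x)) hτ0 ?_ ?_ ?_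
  · exact hf.continuousOn.comp (by fun_prop) fun s hs =>
      ⟨⟨hs.1, hs.2.trans hτ⟩, subset_closure hx⟩
  · intro s hs
    have hz : (s, x) ∈ P.Q := ⟨⟨hs.1, hs.2.trans_le hτ⟩, hx⟩
    exact hasDerivAt_slice
      ((hfQ.differentiableOn one_ne_zero).differentiableAt (hP.isOpen_Q.mem_nhds hz))
  · rw [intervalIntegrable_iff_integrableOn_Ioo_of_le hτ0]
    exact hxint hx

/-! ### The equations in the classical sense -/

/-- A dissipative solution with the regularity of a strong solution: `ϱ`, `u` of class `C¹` up to
the boundary, `ϱ` bounded below, and a pressure with continuous density. -/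
structure IsRegularSolution (P : Data) (rho : ℝ → E3 → ℝ) (u : ℝ → E3 → E3) (S : ℝ → E3 → M3)
    (pi : Measure (ℝ × E3)) (R : ℝ → TensorMeasure) (p : ℝ → E3 → ℝ) (G : ℝ → E3 → M3)
    (m : ℝ → E3 → E3) : Prop where
  adm : P.Admissible
  sol : P.IsDissipativeWith rho u S pi R G m
  hu : ContDiffOn ℝ 1 (fun z : ℝ × E3 => u z.1 z.2) P.Qc
  hrho : ContDiffOn ℝ 1 (fun z : ℝ × E3 => rho z.1 z.2) P.Qc
  hinf : ∃ c : ℝ, 0 < c ∧ ∀ z ∈ P.Q, c ≤ rho z.1 z.2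
  hp : P.HasContinuousDensity pi p

/-- The density as a function on space-time. -/
def dens (rho : ℝ → E3 → ℝ) (z : ℝ × E3) : ℝ := rho z.1 z.2

/-- The `i`-th component of the velocity as a function on space-time. -/
def vel (u : ℝ → E3 → E3) (i : Fin 3) (z : ℝ × E3) : ℝ := u z.1 z.2 i

/-- The `i`-th component of the relative velocity `u - u_B`. -/
def rel (P : Data) (u : ℝ → E3 → E3) (i : Fin 3) (z : ℝ × E3) : ℝ := u z.1 z.2 i - P.uB z.2 i

namespace IsRegularSolution

variable {P : Data} {rho : ℝ → E3 → ℝ} {u : ℝ → E3 → E3} {S : ℝ → E3 → M3}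
  {pi : Measure (ℝ × E3)} {R : ℝ → TensorMeasure} {p : ℝ → E3 → ℝ} {G : ℝ → E3 → M3}
  {m : ℝ → E3 → E3} (h : P.IsRegularSolution rho u S pi R p G m)

include h

lemma dens_contDiffOn : ContDiffOn ℝ 1 (dens rho) P.Qc := h.hrho

lemma vel_contDiffOn (i : Fin 3) : ContDiffOn ℝ 1 (vel u i) P.Qc :=
  (EuclideanSpace.proj i : E3 →L[ℝ] ℝ).contDiff.comp_contDiffOn h.hu

lemma rel_contDiffOn (i : Fin 3) : ContDiffOn ℝ 1 (rel P u i) P.Qc :=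
  (h.vel_contDiffOn i).sub (((EuclideanSpace.proj i : E3 →L[ℝ] ℝ).contDiff.comp_contDiffOn
    h.adm.uB_extension).comp contDiffOn_snd fun _ hz => hz.2)

lemma mem_nhds_Qc {z : ℝ × E3} (hz : z ∈ P.Q) : P.Qc ∈ 𝓝 z :=
  mem_of_superset (h.adm.isOpen_Q.mem_nhds hz) Q_subset_Qc

lemma differentiableAt {f : ℝ × E3 → ℝ} (hf : ContDiffOn ℝ 1 f P.Qc) {z : ℝ × E3} (hz : z ∈ P.Q) :
    DifferentiableAt ℝ f z :=
  (hf.contDiffAt (h.mem_nhds_Qc hz)).differentiableAt one_ne_zero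

lemma velocity_differentiableAt {z : ℝ × E3} (hz : z ∈ P.Q) :
    DifferentiableAt ℝ (fun z : ℝ × E3 => u z.1 z.2) z :=
  (h.hu.contDiffAt (h.mem_nhds_Qc hz)).differentiableAt one_ne_zero

lemma grad_eq_dx {z : ℝ × E3} (hz : z ∈ P.Q) (i j : Fin 3) :
    grad (u z.1) z.2 i j = dx j (vel u i) z :=
  grad_slice_eq_dx (h.velocity_differentiableAt hz) i j

/-- The continuity equation holds pointwise. -/
lemma continuity_eq {z : ℝ × E3} (hz : z ∈ P.Q) :
    dt (dens rho) z + ∑ j, dx j (fun z => dens rho z * vel u j z) z = 0 := by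
  have hQ := h.adm.isOpen_Q
  have hr : ContDiffOn ℝ 1 (dens rho) P.Q := h.dens_contDiffOn.mono Q_subset_Qc
  have hv : ∀ j, ContDiffOn ℝ 1 (fun z => dens rho z * vel u j z) P.Q := fun j =>
    hr.mul ((h.vel_contDiffOn j).mono Q_subset_Qc)
  refine eq_zero_of_setIntegral_smooth_mul (μ := (volume : Measure (ℝ × E3))) hQ
    (f := fun z => dt (dens rho) z + ∑ j, dx j (fun z => dens rho z * vel u j z) z)
    ((continuousOn_dt hQ hr).add (continuousOn_finsetSum _ fun j _ => continuousOn_dx hQ (hv j) j))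
    ?_ z hz
  intro φ hφ hc hsub
  have hφ1 : ContDiff ℝ 1 φ := hφ.of_le (by exact_mod_cast le_top)
  have hz0 : ∀ y ∉ P.Q, φ y = 0 := fun y hy =>
    image_eq_zero_of_notMem_tsupport fun h' => hy (hsub h')
  have h1 := h.sol.continuity (fun t x => φ (t, x)) hφ1.contDiffOn
  have hT : ∀ x, φ (P.T, x) = 0 := fun x => hz0 _ fun h' => lt_irrefl _ h'.1.2
  have h0 : ∀ x, φ (0, x) = 0 := fun x => hz0 _ fun h' => lt_irrefl _ h'.1.1
  -- the boundary terms vanish, since the surface measure is carried by the boundary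
  have hbd : ∀ (A : Set E3) (g : ℝ → E3 → ℝ) (t : ℝ),
      ∫ x in A, φ (t, x) * g t x * P.flux x ∂(surfaceMeasure P.Ω) = 0 := by
    intro A g t
    refine integral_eq_zero_of_ae (ae_restrict_of_ae ?_)
    have : ∀ᵐ x ∂(surfaceMeasure P.Ω), x ∈ frontier P.Ω :=
      ae_restrict_mem isClosed_frontier.measurableSet
    filter_upwards [this] with x hx
    have hxΩ : (t, x) ∉ P.Q := fun h' => by
      rw [h.adm.domain.isOpen.frontier_eq] at hx
      exact hx.2 h'.2
    simp [hz0 _ hxΩ]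
  simp only [hT, h0, hbd P.Γout rho, hbd P.Γin (fun _ => P.rhoB), mul_zero, integral_zero,
    sub_zero] at h1
  have h2 := setIntegral_spaceTime_div hQ hr hv hφ1 hc hsub
  have h3 : ∫ z in P.Q, (rho z.1 z.2 * deriv (fun s => φ (s, z.2)) z.1
      + rho z.1 z.2 * ∑ j, u z.1 z.2 j * pderiv j (fun x => φ (z.1, x)) z.2) =
      ∫ z in P.Q, (dens rho z * dt φ z + ∑ j, dens rho z * vel u j z * dx j φ z) := by
    refine integral_congr_ae (Eventually.of_forall fun y => ?_)
    have hd : DifferentiableAt ℝ φ (y.1, y.2) := hφ1.differentiable one_ne_zero _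
    simp only [deriv_slice_eq_dt hd, pderiv_slice_eq_dx hd, Finset.mul_sum, dens, vel, mul_assoc]
  rw [h3, h2] at h1
  have h4 : ∫ z in P.Q, φ z * (dt (dens rho) z + ∑ j, dx j (fun z => dens rho z * vel u j z) z) =
      ∫ z in P.Q, (dt (dens rho) z + ∑ j, dx j (fun z => dens rho z * vel u j z) z) * φ z := by
    simp only [mul_comm (φ _)]
  rw [h4]
  linarith

lemma dens_bounds : ∀ z ∈ P.Q, 0 ≤ dens rho z ∧ dens rho z ≤ 1 := by
  have hcont : ContinuousOn (dens rho) P.Q := h.dens_contDiffOn.continuousOn.mono Q_subset_Qc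
  have hcl : ContinuousOn (fun z => max 0 (min 1 (dens rho z))) P.Q :=
    continuousOn_const.sup (continuousOn_const.inf hcont)
  have hae : dens rho =ᵐ[volume.restrict P.Q] fun z => max 0 (min 1 (dens rho z)) := by
    filter_upwards [h.sol.rho_bounds] with z hz
    simp only [dens]
    rw [min_eq_right hz.2, max_eq_right hz.1]
  intro z hz
  have heq : dens rho z = max 0 (min 1 (dens rho z)) :=
    Measure.eqOn_open_of_ae_eq hae h.adm.isOpen_Q hcont hcl hz
  constructor
  · rw [heq]; exact le_max_left _ _
  · rw [heq]; exact max_le zero_le_one (min_le_left _ _)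

/-- The velocity is divergence free where the density is maximal: there, the derivatives of the
density vanish, and the continuity equation reduces to `div u = 0`. -/
lemma div_eq_zero {z : ℝ × E3} (hz : z ∈ P.Q) (h1 : dens rho z = 1) :
    ∑ j, dx j (vel u j) z = 0 := by
  have hmax : IsLocalMax (dens rho) z := by
    filter_upwards [h.adm.isOpen_Q.mem_nhds hz] with y hy
    rw [h1]; exact (h.dens_bounds y hy).2
  have hd := hmax.fderiv_eq_zero
  have hc := h.continuity_eq hz
  have e1 : dt (dens rho) z = 0 := by rw [dt, hd]; rfl
  have e2 : ∀ j, dx j (dens rho) z = 0 := fun j => by rw [dx, hd]; rfl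
  rw [e1, zero_add] at hc
  rw [← hc]
  refine Finset.sum_congr rfl fun j _ => ?_
  rw [dx_mul (h.differentiableAt h.dens_contDiffOn hz) (h.differentiableAt (h.vel_contDiffOn j) hz),
    e2, h1, zero_mul, one_mul, zero_add]

lemma pressure_continuousOn : ContinuousOn (fun z : ℝ × E3 => p z.1 z.2) P.Q :=
  h.hp.1.mono Q_subset_Qc

lemma pressure_nonneg : ∀ z ∈ P.Q, 0 ≤ p z.1 z.2 := by
  refine nonneg_of_setIntegral_mul_nonneg (μ := (volume : Measure (ℝ × E3))) h.adm.isOpen_Q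
    h.pressure_continuousOn fun φ hφ hc hsub h0 => ?_
  rw [← h.hp.2 φ hφ hc hsub]
  exact integral_nonneg h0

lemma pressure_eq_zero {z : ℝ × E3} (hz : z ∈ P.Q) (h1 : dens rho z < 1) : p z.1 z.2 = 0 := by
  have hcont : ContinuousOn (dens rho) P.Q := h.dens_contDiffOn.continuousOn.mono Q_subset_Qc
  have hV : IsOpen (P.Q ∩ dens rho ⁻¹' Iio 1) :=
    hcont.isOpen_inter_preimage h.adm.isOpen_Q isOpen_Iio
  refine eq_zero_of_setIntegral_smooth_mul (μ := (volume : Measure (ℝ × E3))) hV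
    (f := fun z => p z.1 z.2) (h.pressure_continuousOn.mono inter_subset_left) ?_ z ⟨hz, h1⟩
  intro φ hφ hc hsub
  have hz0 : ∀ y ∉ P.Q ∩ dens rho ⁻¹' Iio 1, φ y = 0 := fun y hy =>
    image_eq_zero_of_notMem_tsupport fun h' => hy (hsub h')
  have h2 := h.hp.2 φ hφ.continuous hc (hsub.trans inter_subset_left)
  have h3 : ∫ z, φ z ∂pi = 0 := by
    refine integral_eq_zero_of_ae ?_
    filter_upwards [h.sol.pi_free] with y hy
    refine hz0 y fun h' => ?_
    have h4 : dens rho y < 1 := h'.2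
    exact h4.ne hy
  rw [h3, setIntegral_eq_integral_of_forall_compl_eq_zero] at h2
  · rw [setIntegral_eq_integral_of_forall_compl_eq_zero]
    · exact h2.symm
    · intro y hy; rw [hz0 y hy, zero_mul]
  · intro y hy; rw [hz0 y fun h' => hy h'.1, zero_mul]

/-- The pressure does no work on the fluid. -/
lemma pressure_mul_div_eq_zero {z : ℝ × E3} (hz : z ∈ P.Q) :
    p z.1 z.2 * ∑ j, dx j (vel u j) z = 0 := by
  rcases (h.dens_bounds z hz).2.lt_or_eq with h1 | h1
  · rw [h.pressure_eq_zero hz h1, zero_mul]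
  · rw [h.div_eq_zero hz h1, mul_zero]

lemma inertia_eq {z : ℝ × E3} (hz : z ∈ P.Q) (i : Fin 3) :
    inertia rho u z.1 z.2 i = dt (fun z => dens rho z * vel u i z) z +
      ∑ j, dx j (fun z => dens rho z * vel u i z * vel u j z) z := by
  have hr := h.dens_contDiffOn
  have hv := h.vel_contDiffOn
  have d1 := h.differentiableAt (hr.mul (hv i)) hz
  have d2 := fun j => h.differentiableAt ((hr.mul (hv i)).mul (hv j)) hz
  rw [← deriv_slice_eq_dt (t := z.1) (x := z.2) d1]
  simp only [← fun j => pderiv_slice_eq_dx (t := z.1) (x := z.2) (d2 j) j]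
  rfl

/-- The inertial term in nonconservative form. -/
lemma inertia_eq_convective {z : ℝ × E3} (hz : z ∈ P.Q) (i : Fin 3) :
    inertia rho u z.1 z.2 i =
      dens rho z * (dt (vel u i) z + ∑ j, vel u j z * dx j (vel u i) z) := by
  have hr := h.dens_contDiffOn
  have hv := h.vel_contDiffOn
  have dr := h.differentiableAt hr hz
  have dv := fun i => h.differentiableAt (hv i) hz
  have hc := h.continuity_eq hz
  have hrw : ∀ j, dx j (fun z => dens rho z * vel u i z * vel u j z) z =
      dx j (fun z => dens rho z * vel u j z) z * vel u i z
        + dens rho z * vel u j z * dx j (vel u i) z := by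
    intro j
    have : (fun z => dens rho z * vel u i z * vel u j z) =
        fun z => dens rho z * vel u j z * vel u i z := by
      funext y; ring
    rw [this, dx_mul (f := fun z => dens rho z * vel u j z) (dr.mul (dv j)) (dv i)]
  rw [h.inertia_eq hz, dt_mul dr (dv i)]
  simp_rw [hrw]
  rw [Finset.sum_add_distrib, ← Finset.sum_mul, mul_add, Finset.mul_sum]
  have hs : ∑ j, dx j (fun z => dens rho z * vel u j z) z = - dt (dens rho) z := by linarith
  rw [hs]
  simp_rw [mul_assoc]
  ring

lemma inertia_continuousOn (i : Fin 3) :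
    ContinuousOn (fun z : ℝ × E3 => inertia rho u z.1 z.2 i) P.Q := by
  have hr : ContDiffOn ℝ 1 (dens rho) P.Q := h.dens_contDiffOn.mono Q_subset_Qc
  have hv := fun i => (h.vel_contDiffOn i).mono (Q_subset_Qc (P := P))
  have hQ := h.adm.isOpen_Q
  refine ContinuousOn.congr ?_ fun z hz => h.inertia_eq_convective hz i
  exact hr.continuousOn.mul ((continuousOn_dt hQ (hv i)).add (continuousOn_finsetSum _ fun j _ =>
    (hv j).continuousOn.mul (continuousOn_dx hQ (hv i) j)))

lemma integrable_stress_mul {f : ℝ × E3 → ℝ} (hf : ContinuousOn f P.Q) {C : ℝ}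
    (hC : ∀ z ∈ P.Q, |f z| ≤ C) (i j : Fin 3) :
    IntegrableOn (fun z : ℝ × E3 => S z.1 z.2 i j * f z) P.Q :=
  (h.sol.S_integrable i j).mul_bdd (c := C) (hf.aestronglyMeasurable h.adm.measurableSet_Q)
    ((ae_restrict_iff' h.adm.measurableSet_Q).2 (Eventually.of_forall hC))

/-- The momentum equation with the inertial term in classical form. -/
lemma momentum_test {φ : ℝ → E3 → E3} (hφ : ContDiff ℝ 1 (fun z : ℝ × E3 => φ z.1 z.2))
    (hc : HasCompactSupport (fun z : ℝ × E3 => φ z.1 z.2))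
    (hsub : tsupport (fun z : ℝ × E3 => φ z.1 z.2) ⊆ P.Q) :
    ∫ z in P.Q, ∑ i, inertia rho u z.1 z.2 i * φ z.1 z.2 i =
      - (∫ z in P.Q, frob (S z.1 z.2) (grad (φ z.1) z.2))
      + (∫ z in P.Q, p z.1 z.2 * (grad (φ z.1) z.2).trace)
      + ∫ t in Ioo 0 P.T, (R t).pairing P.Ω (grad (φ t)) := by
  have hQ := h.adm.isOpen_Q
  have hr : ContDiffOn ℝ 1 (dens rho) P.Q := h.dens_contDiffOn.mono Q_subset_Qc
  have hv := fun i => (h.vel_contDiffOn i).mono (Q_subset_Qc (P := P))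
  have hmom := h.sol.momentum φ hφ hc hsub
  let ψ : Fin 3 → ℝ × E3 → ℝ := fun i z => φ z.1 z.2 i
  have hψ : ∀ i, ContDiff ℝ 1 (ψ i) := fun i =>
    (EuclideanSpace.proj i : E3 →L[ℝ] ℝ).contDiff.comp hφ
  have hψs : ∀ i, tsupport (ψ i) ⊆ tsupport (fun z : ℝ × E3 => φ z.1 z.2) := fun i =>
    closure_mono fun z hz => by
      intro h0
      apply hz
      simp only [ψ]
      have : φ z.1 z.2 = 0 := h0
      rw [this]
      rfl
  have hψc : ∀ i, HasCompactSupport (ψ i) := fun i =>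
    hc.of_isClosed_subset (isClosed_tsupport _) (hψs i)
  have hψQ : ∀ i, tsupport (ψ i) ⊆ P.Q := fun i => (hψs i).trans hsub
  have hdiff : ∀ z : ℝ × E3, DifferentiableAt ℝ (fun z : ℝ × E3 => φ z.1 z.2) z :=
    fun z => hφ.differentiable one_ne_zero z
  have hgrad : ∀ (z : ℝ × E3) i j, grad (φ z.1) z.2 i j = dx j (ψ i) z := fun z i j =>
    grad_slice_eq_dx (hdiff z) i j
  have hder : ∀ (z : ℝ × E3) i, deriv (fun s => φ s z.2) z.1 i = dt (ψ i) z := by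
    intro z i
    have h1 : HasDerivAt (fun s : ℝ => (s, z.2)) ((1 : ℝ), (0 : E3)) z.1 :=
      (hasDerivAt_id z.1).prodMk (hasDerivAt_const z.1 z.2)
    have h2 : deriv (fun s => φ s z.2) z.1 =
        fderiv ℝ (fun z : ℝ × E3 => φ z.1 z.2) z (1, 0) :=
      ((hdiff z).hasFDerivAt.comp_hasDerivAt (f := fun s : ℝ => (s, z.2)) z.1 h1).deriv
    rw [h2, fderiv_apply_coord (hdiff z)]
    rfl
  -- integrability of all the terms
  have iS : IntegrableOn (fun z : ℝ × E3 => frob (S z.1 z.2) (grad (φ z.1) z.2)) P.Q := by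
    simp only [frob, hgrad]
    refine integrable_finsetSum _ fun i _ => integrable_finsetSum _ fun j _ => ?_
    obtain ⟨C, hC⟩ := ((hψc i).fderiv_apply ℝ _).exists_bound_of_continuous
      (continuous_dx (hψ i) j)
    exact h.integrable_stress_mul (continuous_dx (hψ i) j).continuousOn (fun z _ => hC z) i j
  have iI : ∀ i, IntegrableOn (fun z => inertia rho u z.1 z.2 i * ψ i z) P.Q := fun i =>
    (integrable_mul_of_tsupport_subset hQ (h.inertia_continuousOn i) (hψ i).continuous (hψc i)
      (hψQ i)).integrableOn
  have iT : ∀ i, IntegrableOn (fun z => dens rho z * vel u i z * dt (ψ i) z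
      + ∑ j, dens rho z * vel u i z * vel u j z * dx j (ψ i) z) P.Q := by
    intro i
    refine Integrable.add (integrable_mul_of_tsupport_subset hQ
      (hr.continuousOn.mul (hv i).continuousOn) (continuous_dt (hψ i))
      ((hψc i).fderiv_apply ℝ _) ((tsupport_dt_subset _).trans (hψQ i))).integrableOn
      (integrable_finsetSum _ fun j _ => ?_)
    exact (integrable_mul_of_tsupport_subset hQ
      ((hr.continuousOn.mul (hv i).continuousOn).mul (hv j).continuousOn) (continuous_dx (hψ i) j)
      ((hψc i).fderiv_apply ℝ _) ((tsupport_dx_subset _ _).trans (hψQ i))).integrableOn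
  have e1 : ∫ z in P.Q, (rho z.1 z.2 * inner ℝ (u z.1 z.2) (deriv (fun s => φ s z.2) z.1)
          + rho z.1 z.2 * ∑ i, ∑ j, u z.1 z.2 i * u z.1 z.2 j * grad (φ z.1) z.2 i j
          - frob (S z.1 z.2) (grad (φ z.1) z.2)) =
      (∫ z in P.Q, ∑ i, (dens rho z * vel u i z * dt (ψ i) z
        + ∑ j, dens rho z * vel u i z * vel u j z * dx j (ψ i) z))
      - ∫ z in P.Q, frob (S z.1 z.2) (grad (φ z.1) z.2) := by
    rw [← integral_sub (integrable_finsetSum _ fun i _ => iT i) iS]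
    refine integral_congr_ae (Eventually.of_forall fun z => ?_)
    simp only [PiLp.inner_apply, hgrad, hder, Finset.sum_add_distrib, Finset.mul_sum, dens, vel]
    congr 2
    · refine Finset.sum_congr rfl fun i _ => ?_
      simp only [RCLike.inner_apply, conj_trivial]
      ring
    · refine Finset.sum_congr rfl fun i _ => Finset.sum_congr rfl fun j _ => ?_
      ring
  have e2 : ∫ z in P.Q, ∑ i, (dens rho z * vel u i z * dt (ψ i) z
        + ∑ j, dens rho z * vel u i z * vel u j z * dx j (ψ i) z) =
      - ∫ z in P.Q, ∑ i, inertia rho u z.1 z.2 i * φ z.1 z.2 i := by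
    rw [integral_finsetSum _ fun i _ => iT i, integral_finsetSum _ fun i _ => iI i,
      ← Finset.sum_neg_distrib]
    refine Finset.sum_congr rfl fun i _ => ?_
    rw [setIntegral_spaceTime_div hQ (f := fun z => dens rho z * vel u i z)
      (g := fun j z => dens rho z * vel u i z * vel u j z) (hr.mul (hv i))
      (fun j => (hr.mul (hv i)).mul (hv j)) (hψ i) (hψc i) (hψQ i)]
    congr 1
    refine setIntegral_congr_fun h.adm.measurableSet_Q fun z hz => ?_
    simp only [ψ]
    rw [h.inertia_eq hz]
  have htr : ∀ z : ℝ × E3, (grad (φ z.1) z.2).trace = ∑ i, dx i (ψ i) z := fun z => by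
    simp only [Matrix.trace, Matrix.diag_apply, hgrad]
  have e3 : ∫ z, (grad (φ z.1) z.2).trace ∂pi =
      ∫ z in P.Q, p z.1 z.2 * (grad (φ z.1) z.2).trace := by
    simp only [htr]
    have hts : tsupport (fun z => ∑ i, dx i (ψ i) z) ⊆
        tsupport (fun z : ℝ × E3 => φ z.1 z.2) := by
      refine closure_minimal (fun z hz => ?_) (isClosed_tsupport _)
      by_contra hz'
      apply hz
      refine Finset.sum_eq_zero fun i _ => ?_
      exact image_eq_zero_of_notMem_tsupport fun h' => hz' (hψs i (tsupport_dx_subset _ _ h'))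
    rw [h.hp.2 _ (continuous_finsetSum _ fun i _ => continuous_dx (hψ i) i)
      (hc.of_isClosed_subset (isClosed_tsupport _) hts) (hts.trans hsub)]
    simp only [mul_comm (p _ _)]
  rw [e1, e2, e3] at hmom
  linarith

end IsRegularSolution

end Data

/-! ### The gradient and the boundary values of the velocity -/

lemma integral_abs_le_of_eLpNorm_lt {α : Type*} [MeasurableSpace α] {μ : Measure α}
    [IsFiniteMeasure μ] {q : ℝ} (hq : 1 ≤ q) {f : α → ℝ} (hf : AEStronglyMeasurable f μ) {ε : ℝ}
    (hε : 0 ≤ ε) (h : eLpNorm f (ENNReal.ofReal q) μ < ENNReal.ofReal ε) :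
    ∫ x, |f x| ∂μ ≤ ε * (μ univ ^ (1 - 1 / q)).toReal := by
  have h1 := eLpNorm_le_eLpNorm_mul_rpow_measure_univ (p := 1) (q := ENNReal.ofReal q)
    (by simpa using hq) hf
  rw [ENNReal.toReal_one, ENNReal.toReal_ofReal (by linarith), div_one] at h1
  have h2 : eLpNorm f 1 μ ≤ ENNReal.ofReal ε * μ univ ^ (1 - 1 / q) := by
    refine h1.trans ?_
    gcongr
  have hV : μ univ ^ (1 - 1 / q) ≠ ⊤ :=
    ENNReal.rpow_ne_top_of_nonneg (by
      rw [sub_nonneg, div_le_one (by linarith)]; exact hq) (measure_ne_top _ _)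
  have h3 : ∫ x, |f x| ∂μ = (eLpNorm f 1 μ).toReal := by
    rw [eLpNorm_one_eq_lintegral_enorm, ← integral_norm_eq_lintegral_enorm hf]
    rfl
  rw [h3]
  refine (ENNReal.toReal_mono (ENNReal.mul_ne_top ENNReal.ofReal_ne_top hV) h2).trans_eq ?_
  rw [ENNReal.toReal_mul, ENNReal.toReal_ofReal hε]

namespace Data

section BoundaryField

variable {P : Data}

lemma contDiffOn_slice {f : ℝ × E3 → ℝ} (hf : ContDiffOn ℝ 1 f P.Qc) {t : ℝ}
    (ht : t ∈ Ioo 0 P.T) : ContDiffOn ℝ 1 (fun x => f (t, x)) P.Ω :=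
  (hf.mono Q_subset_Qc).comp (contDiff_const.prodMk contDiff_id).contDiffOn
    fun _ hx => ⟨ht, hx⟩

lemma Admissible.exists_gradB_bound (hP : P.Admissible) :
    ∃ C, 0 ≤ C ∧ ∀ x ∈ closure P.Ω, ∀ i j, |P.gradB x i j| ≤ C := by
  obtain ⟨C, hC⟩ := hP.isCompact_closure.exists_bound_of_continuousOn
    (hP.uB_extension.continuousOn_fderivWithin hP.domain.uniqueDiffOn_closure le_rfl)
  refine ⟨max C 0, le_max_right _ _, fun x hx i j => ?_⟩
  have h1 : |P.gradB x i j| ≤ ‖fderivWithin ℝ P.uB (closure P.Ω) x (EuclideanSpace.single j 1)‖ :=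
    PiLp.norm_apply_le (fderivWithin ℝ P.uB (closure P.Ω) x (EuclideanSpace.single j 1)) i
  refine h1.trans ((ContinuousLinearMap.le_opNorm _ _).trans ?_)
  simpa using Or.inl (hC x hx)

lemma Admissible.gradB_continuousOn (hP : P.Admissible) (i j : Fin 3) :
    ContinuousOn (fun x => P.gradB x i j) (closure P.Ω) :=
  (EuclideanSpace.proj i : E3 →L[ℝ] ℝ).continuous.comp_continuousOn
    ((hP.uB_extension.continuousOn_fderivWithin hP.domain.uniqueDiffOn_closure le_rfl).clm_apply
      continuousOn_const)

end BoundaryField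

namespace IsRegularSolution

variable {P : Data} {rho : ℝ → E3 → ℝ} {u : ℝ → E3 → E3} {S : ℝ → E3 → M3}
  {pi : Measure (ℝ × E3)} {R : ℝ → TensorMeasure} {p : ℝ → E3 → ℝ} {G : ℝ → E3 → M3}
  {m : ℝ → E3 → E3} (h : P.IsRegularSolution rho u S pi R p G m)

include h

lemma dx_rel {z : ℝ × E3} (hz : z ∈ P.Q) (i j : Fin 3) :
    dx j (rel P u i) z = dx j (vel u i) z - P.gradB z.2 i j := by
  have huB : DifferentiableAt ℝ P.uB z.2 :=
    (h.adm.uB_extension.contDiffAt (mem_of_superset (h.adm.domain.isOpen.mem_nhds hz.2)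
      subset_closure)).differentiableAt one_ne_zero
  have h1 : HasFDerivAt (fun y : ℝ × E3 => P.uB y.2)
      ((fderiv ℝ P.uB z.2).comp (ContinuousLinearMap.snd ℝ ℝ E3)) z :=
    huB.hasFDerivAt.comp z hasFDerivAt_snd
  have h2 : HasFDerivAt (fun y : ℝ × E3 => P.uB y.2 i) ((EuclideanSpace.proj i : E3 →L[ℝ] ℝ).comp
      ((fderiv ℝ P.uB z.2).comp (ContinuousLinearMap.snd ℝ ℝ E3))) z :=
    (EuclideanSpace.proj i : E3 →L[ℝ] ℝ).hasFDerivAt.comp z h1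
  have h3 : HasFDerivAt (rel P u i) _ z :=
    (h.differentiableAt (h.vel_contDiffOn i) hz).hasFDerivAt.sub h2
  have h4 : fderivWithin ℝ P.uB (closure P.Ω) z.2 = fderiv ℝ P.uB z.2 :=
    fderivWithin_of_mem_nhds (mem_of_superset (h.adm.domain.isOpen.mem_nhds hz.2) subset_closure)
  rw [dx, h3.fderiv]
  simp [gradB, gradUpTo, h4, dx]

lemma dt_rel {z : ℝ × E3} (hz : z ∈ P.Q) (i : Fin 3) :
    dt (rel P u i) z = dt (vel u i) z := by
  have h1 := deriv_slice_eq_dt (t := z.1) (x := z.2) (h.differentiableAt (h.rel_contDiffOn i) hz)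
  have h2 := deriv_slice_eq_dt (t := z.1) (x := z.2) (h.differentiableAt (h.vel_contDiffOn i) hz)
  change _ = dt (rel P u i) z at h1
  change _ = dt (vel u i) z at h2
  rw [← h1, ← h2]
  change deriv (fun s => u s z.2 i - P.uB z.2 i) z.1 = deriv (fun s => u s z.2 i) z.1
  simp

lemma dx_slice_continuousOn {f : ℝ × E3 → ℝ} (hf : ContDiffOn ℝ 1 f P.Qc) {t : ℝ}
    (ht : t ∈ Ioo 0 P.T) (j : Fin 3) : ContinuousOn (fun x => dx j f (t, x)) P.Ω :=
  (continuousOn_dx h.adm.isOpen_Q (hf.mono Q_subset_Qc) j).comp (by fun_prop)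
    fun _ hx => ⟨ht, hx⟩

lemma gradient_integrable (i j : Fin 3) :
    IntegrableOn (fun z : ℝ × E3 => G z.1 z.2 i j) P.Q := by
  have := h.adm.isFiniteMeasure_Q
  refine (h.sol.G_memLp i j).integrable ?_
  simpa using h.adm.potential.one_lt.le

/-- The weak gradient of the velocity is the classical one, at almost every time. -/
lemma ae_ae_weakGradient_eq : ∀ᵐ t ∂(volume.restrict (Ioo 0 P.T)),
    ∀ᵐ x ∂(volume.restrict P.Ω), ∀ i j, G t x i j = dx j (vel u i) (t, x) := by
  have hint : ∀ i j, ∀ᵐ t ∂(volume.restrict (Ioo 0 P.T)),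
      Integrable (fun x => G t x i j) (volume.restrict P.Ω) := fun i j => by
    have h1 := h.gradient_integrable i j
    rw [IntegrableOn, volume_restrict_Q] at h1
    exact h1.prod_right_ae
  have hint' := ae_all_iff.2 fun i => ae_all_iff.2 fun j => hint i j
  filter_upwards [hint', h.sol.u_grad, ae_restrict_mem measurableSet_Ioo] with t hG hw ht
  rw [ae_all_iff]; intro i
  rw [ae_all_iff]; intro j
  have hΩ := h.adm.domain.isOpen
  have hcont := h.dx_slice_continuousOn (h.vel_contDiffOn i) ht j
  have hloc : LocallyIntegrableOn (fun x => G t x i j - dx j (vel u i) (t, x)) P.Ω :=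
    (IntegrableOn.locallyIntegrableOn (hG i j)).sub
      (hcont.locallyIntegrableOn h.adm.measurableSet_Ω)
  have hz := hΩ.ae_eq_zero_of_integral_contDiff_smul_eq_zero hloc ?_
  · rw [ae_restrict_iff' h.adm.measurableSet_Ω]
    filter_upwards [hz] with x hx hxΩ
    exact sub_eq_zero.1 (hx hxΩ)
  intro g hg hgc hgs
  have hg1 : ContDiff ℝ 1 g := hg.of_le (by exact_mod_cast le_top)
  have e1 := hw g hg hgc hgs i j
  have e2 := setIntegral_mul_fderiv (μ := (volume : Measure E3)) hΩ
    (contDiffOn_slice (h.vel_contDiffOn i) ht) hg1 hgc hgs (EuclideanSpace.single j 1)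
  have e3 : ∫ x in P.Ω, fderiv ℝ (fun x => vel u i (t, x)) x (EuclideanSpace.single j 1) * g x =
      ∫ x in P.Ω, dx j (vel u i) (t, x) * g x := by
    refine setIntegral_congr_fun h.adm.measurableSet_Ω fun x hx => ?_
    have := pderiv_slice_eq_dx (h.differentiableAt (h.vel_contDiffOn i) (z := (t, x)) ⟨ht, hx⟩) j
    rw [pderiv] at this
    simp only [this]
  have e4 : ∫ x in P.Ω, G t x i j * g x = ∫ x in P.Ω, dx j (vel u i) (t, x) * g x := by
    rw [← e3]
    have : ∫ x in P.Ω, u t x i * pderiv j g x =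
      ∫ x in P.Ω, vel u i (t, x) * fderiv ℝ g x (EuclideanSpace.single j 1) := rfl
    linarith
  obtain ⟨M, hM⟩ := hgc.exists_bound_of_continuous hg.continuous
  have i1 : IntegrableOn (fun x => G t x i j * g x) P.Ω :=
    (hG i j).mul_bdd (c := M) hg.continuous.aestronglyMeasurable (Eventually.of_forall hM)
  have i2 : IntegrableOn (fun x => dx j (vel u i) (t, x) * g x) P.Ω :=
    (integrable_mul_of_tsupport_subset hΩ hcont hg.continuous hgc hgs).integrableOn
  rw [← setIntegral_eq_integral_of_forall_compl_eq_zero (s := P.Ω)]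
  · have : ∀ x, g x • (G t x i j - dx j (vel u i) (t, x)) =
        G t x i j * g x - dx j (vel u i) (t, x) * g x := fun x => by
      rw [smul_eq_mul]; ring
    simp_rw [this]
    rw [integral_sub i1 i2, e4, sub_self]
  · intro x hx
    rw [image_eq_zero_of_notMem_tsupport fun h' => hx (hgs h'), zero_smul]

lemma dt_integrable {f : ℝ × E3 → ℝ} (hf : ContDiffOn ℝ 1 f P.Qc) : IntegrableOn (dt f) P.Q := by
  obtain ⟨C, -, hC⟩ := h.adm.exists_fderiv_bound hf
  exact h.adm.integrableOn_of_bounded (continuousOn_dt h.adm.isOpen_Q (hf.mono Q_subset_Qc))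
    fun z hz => (hC z hz).1

lemma dx_integrable {f : ℝ × E3 → ℝ} (hf : ContDiffOn ℝ 1 f P.Qc) (j : Fin 3) :
    IntegrableOn (dx j f) P.Q := by
  obtain ⟨C, -, hC⟩ := h.adm.exists_fderiv_bound hf
  exact h.adm.integrableOn_of_bounded (continuousOn_dx h.adm.isOpen_Q (hf.mono Q_subset_Qc) j)
    fun z hz => (hC z hz).2 j

/-- The weak gradient of the velocity is the classical one. -/
lemma ae_weakGradient_eq : ∀ᵐ z ∂(volume.restrict P.Q),
    ∀ i j, G z.1 z.2 i j = dx j (vel u i) z := by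
  rw [ae_all_iff]; intro i
  rw [ae_all_iff]; intro j
  have hint : Integrable (fun z : ℝ × E3 => |G z.1 z.2 i j - dx j (vel u i) z|)
      (volume.restrict P.Q) := ((h.gradient_integrable i j).sub (h.dx_integrable (h.vel_contDiffOn i) j)).abs
  have h0 : ∫ z in P.Q, |G z.1 z.2 i j - dx j (vel u i) z| = 0 := by
    rw [volume_restrict_Q] at hint ⊢
    rw [integral_prod _ hint]
    refine integral_eq_zero_of_ae ?_
    filter_upwards [h.ae_ae_weakGradient_eq] with t ht
    refine integral_eq_zero_of_ae ?_
    filter_upwards [ht] with x hx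
    simp [hx i j]
  rw [integral_eq_zero_iff_of_nonneg (fun z => abs_nonneg _) hint] at h0
  filter_upwards [h0] with z hz
  exact sub_eq_zero.1 (abs_eq_zero.1 hz)

/-- The velocity attains its boundary values pointwise. -/
lemma rel_eq_zero_on_frontier (i : Fin 3) : ∀ t ∈ Icc 0 P.T, ∀ x ∈ frontier P.Ω,
    rel P u i (t, x) = 0 := by
  have hfin := h.adm.isFiniteMeasure_Ω
  obtain ⟨c, hc0, hc⟩ := h.adm.exists_fderiv_bound (h.rel_contDiffOn i)
  have hΩ := h.adm.domain.isOpen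
  have hae : ∀ᵐ t ∂(volume.restrict (Ioo 0 P.T)), ∀ x ∈ frontier P.Ω, rel P u i (t, x) = 0 := by
    filter_upwards [h.ae_ae_weakGradient_eq, h.sol.u_bdry, ae_restrict_mem measurableSet_Ioo]
      with t hG hW ht
    have hwc : ContinuousOn (fun x => rel P u i (t, x)) (closure P.Ω) :=
      (h.rel_contDiffOn i).continuousOn.comp (by fun_prop)
        fun x hx => ⟨Ioo_subset_Icc_self ht, hx⟩
    have hwm := (hwc.mono subset_closure).aestronglyMeasurable (μ := volume) h.adm.measurableSet_Ω
    have hdcont : ∀ j, ContinuousOn (fun x => dx j (rel P u i) (t, x)) P.Ω := fun j =>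
      h.dx_slice_continuousOn (h.rel_contDiffOn i) ht j
    have hdm := fun j => (hdcont j).aestronglyMeasurable (μ := volume) h.adm.measurableSet_Ω
    have hdint : ∀ j, IntegrableOn (fun x => dx j (rel P u i) (t, x)) P.Ω := fun j =>
      Integrable.of_bound (hdm j) c ((ae_restrict_iff' h.adm.measurableSet_Ω).2
        (Eventually.of_forall fun x hx => (hc (t, x) ⟨ht, hx⟩).2 j))
    have hwint : IntegrableOn (fun x => rel P u i (t, x)) P.Ω :=
      (hwc.integrableOn_compact h.adm.isCompact_closure).mono_set subset_closure
    -- integration by parts without boundary terms, by approximation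
    have hparts : ∀ ψ : E3 → ℝ, ContDiff ℝ ∞ ψ → HasCompactSupport ψ → ∀ j,
        (∫ x in P.Ω, rel P u i (t, x) * pderiv j ψ x) +
          ∫ x in P.Ω, dx j (rel P u i) (t, x) * ψ x = 0 := by
      intro ψ hψ hψc j
      have hψ1 : ContDiff ℝ 1 ψ := hψ.of_le (by exact_mod_cast le_top)
      have hpc : Continuous (pderiv j ψ) :=
        (hψ1.continuous_fderiv one_ne_zero).clm_apply continuous_const
      obtain ⟨M1, hM1⟩ := hψc.exists_bound_of_continuous hψ.continuous
      obtain ⟨M2, hM2⟩ := (hψc.fderiv_apply ℝ (EuclideanSpace.single j 1)).exists_bound_of_continuous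
        hpc
      have hM10 : 0 ≤ M1 := (norm_nonneg _).trans (hM1 0)
      have hM20 : 0 ≤ M2 := (norm_nonneg _).trans (hM2 0)
      set V : ℝ := ((volume.restrict P.Ω) univ ^ (1 - 1 / P.q)).toReal
      have hV : 0 ≤ V := ENNReal.toReal_nonneg
      have key : ∀ ε : ℝ, 0 < ε → |(∫ x in P.Ω, rel P u i (t, x) * pderiv j ψ x) +
          ∫ x in P.Ω, dx j (rel P u i) (t, x) * ψ x| ≤ ε * (V * M2 + V * M1) := by
        intro ε hε
        obtain ⟨φ, hφ, hφc, hφs, hφ1, hφ2⟩ := hW (ENNReal.ofReal ε) (by simpa using hε)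
        let φi : E3 → ℝ := fun x => φ x i
        have hφi : ContDiff ℝ 1 φi := (EuclideanSpace.proj i : E3 →L[ℝ] ℝ).contDiff.comp
          (hφ.of_le (by exact_mod_cast le_top))
        have hφis : tsupport φi ⊆ tsupport φ := closure_mono fun x hx hx0 => by
          apply hx
          have : φ x = 0 := hx0
          simp [φi, this]
        have hφic : HasCompactSupport φi := hφc.of_isClosed_subset (isClosed_tsupport _) hφis
        have hgradφ : ∀ x, grad φ x i j = pderiv j φi x := fun x =>
          grad_apply (hφ.differentiable (by simp) x) i j
        have hφcont : Continuous (pderiv j φi) :=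
          (hφi.continuous_fderiv one_ne_zero).clm_apply continuous_const
        have hφint : Integrable φi := hφi.continuous.integrable_of_hasCompactSupport hφic
        have hφdint : Integrable (pderiv j φi) :=
          hφcont.integrable_of_hasCompactSupport (hφic.fderiv_apply ℝ _)
        have b1 : ∫ x in P.Ω, |rel P u i (t, x) - φi x| ≤ ε * V := by
          refine integral_abs_le_of_eLpNorm_lt h.adm.potential.one_lt.le
            (hwm.sub hφi.continuous.aestronglyMeasurable) hε.le (lt_of_le_of_lt ?_ hφ1)
          refine eLpNorm_mono fun x => ?_
          exact PiLp.norm_apply_le (u t x - P.uB x - φ x) i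
        have b2 : ∫ x in P.Ω, |dx j (rel P u i) (t, x) - pderiv j φi x| ≤ ε * V := by
          refine integral_abs_le_of_eLpNorm_lt h.adm.potential.one_lt.le
            ((hdm j).sub hφcont.aestronglyMeasurable) hε.le (lt_of_le_of_lt ?_ (hφ2 i j))
          refine (eLpNorm_congr_ae ?_).le
          filter_upwards [hG, ae_restrict_mem h.adm.measurableSet_Ω] with x hx hxΩ
          change dx j (rel P u i) (t, x) - pderiv j φi x =
            G t x i j - P.gradB x i j - grad φ x i j
          rw [h.dx_rel (z := (t, x)) ⟨ht, hxΩ⟩, hx i j, hgradφ]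
        have e0 : (∫ x in P.Ω, φi x * pderiv j ψ x) + ∫ x in P.Ω, pderiv j φi x * ψ x = 0 := by
          have := setIntegral_mul_fderiv (μ := (volume : Measure E3)) hΩ hψ1.contDiffOn hφi hφic
            (hφis.trans hφs) (EuclideanSpace.single j 1)
          have e1 : ∫ x in P.Ω, φi x * pderiv j ψ x =
            ∫ x in P.Ω, fderiv ℝ ψ x (EuclideanSpace.single j 1) * φi x := by
              simp only [pderiv, mul_comm (φi _)]
          have e2 : ∫ x in P.Ω, pderiv j φi x * ψ x =
            ∫ x in P.Ω, ψ x * fderiv ℝ φi x (EuclideanSpace.single j 1) := by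
              simp only [pderiv, mul_comm (ψ _)]
          rw [e1, e2, this]; ring
        have mulint : ∀ (f g : E3 → ℝ) (M : ℝ), IntegrableOn f P.Ω → Continuous g →
            (∀ x, ‖g x‖ ≤ M) → IntegrableOn (fun x => f x * g x) P.Ω := fun f g M hf hg hM =>
          hf.mul_bdd (c := M) hg.aestronglyMeasurable (Eventually.of_forall hM)
        have mulbd : ∀ (f g : E3 → ℝ) (M : ℝ), IntegrableOn f P.Ω → (∀ x, ‖g x‖ ≤ M) →
            |∫ x in P.Ω, f x * g x| ≤ (∫ x in P.Ω, |f x|) * M := fun f g M hf hM => by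
          rw [← integral_mul_const, ← Real.norm_eq_abs]
          refine norm_integral_le_of_norm_le (hf.abs.mul_const M) (Eventually.of_forall fun x => ?_)
          rw [norm_mul]
          exact mul_le_mul_of_nonneg_left (hM x) (norm_nonneg _)
        have e3 : (∫ x in P.Ω, rel P u i (t, x) * pderiv j ψ x) +
            ∫ x in P.Ω, dx j (rel P u i) (t, x) * ψ x =
            (∫ x in P.Ω, (rel P u i (t, x) - φi x) * pderiv j ψ x) +
            ∫ x in P.Ω, (dx j (rel P u i) (t, x) - pderiv j φi x) * ψ x := by
          simp_rw [sub_mul]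
          rw [integral_sub (mulint _ _ M2 hwint hpc hM2) (mulint _ _ M2 hφint.integrableOn hpc hM2),
            integral_sub (mulint _ _ M1 (hdint j) hψ.continuous hM1)
              (mulint _ _ M1 hφdint.integrableOn hψ.continuous hM1)]
          linarith
        rw [e3]
        refine (abs_add_le _ _).trans ?_
        have c1 := mulbd _ (pderiv j ψ) M2 (hwint.sub hφint.integrableOn) hM2
        have c2 := mulbd _ ψ M1 ((hdint j).sub hφdint.integrableOn) hM1
        have d1 := mul_le_mul_of_nonneg_right b1 hM20
        have d2 := mul_le_mul_of_nonneg_right b2 hM10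
        simp only [Pi.sub_apply] at c1 c2
        linarith
      have hz : |(∫ x in P.Ω, rel P u i (t, x) * pderiv j ψ x) +
          ∫ x in P.Ω, dx j (rel P u i) (t, x) * ψ x| ≤ 0 := by
        refine le_of_forall_pos_le_add fun δ hδ => ?_
        have hK : 0 < V * M2 + V * M1 + 1 := by positivity
        have := key (δ / (V * M2 + V * M1 + 1)) (by positivity)
        refine this.trans ?_
        rw [zero_add, div_mul_eq_mul_div, div_le_iff₀ hK]
        nlinarith
      exact abs_eq_zero.1 (le_antisymm hz (abs_nonneg _))
    refine h.adm.domain.eq_zero_on_frontier hwc (C := fun v => ∑ j, |v j| * c) ?_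
    intro ψ hψ hψc v
    have hψ1 : ContDiff ℝ 1 ψ := hψ.of_le (by exact_mod_cast le_top)
    have hψint : Integrable ψ := hψ.continuous.integrable_of_hasCompactSupport hψc
    have hpc : ∀ j, Continuous (pderiv j ψ) := fun j =>
      (hψ1.continuous_fderiv one_ne_zero).clm_apply continuous_const
    have hv : ∀ x, fderiv ℝ ψ x v = ∑ j, v j * pderiv j ψ x := by
      intro x
      have hvs : v = ∑ j, v j • EuclideanSpace.single j (1 : ℝ) := by
        ext k
        simp [Pi.single_apply]
      conv_lhs => rw [hvs]
      simp [pderiv]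
    have hwint2 : ∀ j, IntegrableOn (fun x => rel P u i (t, x) * pderiv j ψ x) P.Ω := fun j => by
      obtain ⟨M2, hM2⟩ := (hψc.fderiv_apply ℝ (EuclideanSpace.single j 1)).exists_bound_of_continuous
        (hpc j)
      exact hwint.mul_bdd (c := M2) (hpc j).aestronglyMeasurable (Eventually.of_forall hM2)
    have e1 : ∫ y in P.Ω, rel P u i (t, y) * fderiv ℝ ψ y v =
        ∑ j, v j * ∫ y in P.Ω, rel P u i (t, y) * pderiv j ψ y := by
      simp_rw [← integral_const_mul]
      rw [← integral_finsetSum _ fun j _ => (hwint2 j).const_mul (v j)]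
      simp only [hv, Finset.mul_sum]
      refine integral_congr_ae (Eventually.of_forall fun x => Finset.sum_congr rfl fun j _ => ?_)
      ring
    have e2 : ∀ j, |∫ y in P.Ω, rel P u i (t, y) * pderiv j ψ y| ≤ c * ∫ y, |ψ y| := by
      intro j
      rw [eq_neg_of_add_eq_zero_left (hparts ψ hψ hψc j), abs_neg]
      have e3 : |∫ x in P.Ω, dx j (rel P u i) (t, x) * ψ x| ≤ ∫ x in P.Ω, c * |ψ x| := by
        rw [← Real.norm_eq_abs]
        refine norm_integral_le_of_norm_le (hψint.abs.const_mul c).integrableOn ?_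
        filter_upwards [ae_restrict_mem h.adm.measurableSet_Ω] with x hx
        rw [norm_mul]
        exact mul_le_mul_of_nonneg_right ((hc (t, x) ⟨ht, hx⟩).2 j) (norm_nonneg _)
      refine e3.trans ?_
      rw [integral_const_mul]
      exact mul_le_mul_of_nonneg_left
        (setIntegral_le_integral hψint.abs (Eventually.of_forall fun x => abs_nonneg _)) hc0
    rw [e1, Finset.sum_mul]
    refine (Finset.abs_sum_le_sum_abs _ _).trans (Finset.sum_le_sum fun j _ => ?_)
    rw [abs_mul, mul_assoc]
    exact mul_le_mul_of_nonneg_left (e2 j) (abs_nonneg _)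
  intro t ht x hx
  have hcont : ContinuousOn (fun t => rel P u i (t, x)) (Icc 0 P.T) :=
    (h.rel_contDiffOn i).continuousOn.comp (by fun_prop)
      fun s hs => ⟨hs, frontier_subset_closure hx⟩
  have hz : (fun t => rel P u i (t, x)) =ᵐ[volume.restrict (Icc 0 P.T)] fun _ => 0 := by
    rw [← restrict_Ioo_eq_restrict_Icc]
    filter_upwards [hae] with s hs using hs x hx
  exact Measure.eqOn_Icc_of_ae_eq volume h.adm.T_pos.ne hz hcont continuousOn_const ht

lemma exists_dens_lower_bound : ∃ c : ℝ, 0 < c ∧ ∀ t ∈ Icc 0 P.T, ∀ x ∈ P.Ω, c ≤ rho t x := by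
  obtain ⟨c, hc, hb⟩ := h.hinf
  refine ⟨c, hc, fun t ht x hx => ?_⟩
  have hcont : ContinuousOn (fun t => dens rho (t, x)) (Icc 0 P.T) :=
    h.dens_contDiffOn.continuousOn.comp (by fun_prop) fun s hs => ⟨hs, subset_closure hx⟩
  rw [← closure_Ioo h.adm.T_pos.ne] at ht hcont
  exact le_on_closure (fun s hs => hb (s, x) ⟨hs, hx⟩) continuousOn_const hcont ht

end IsRegularSolution

/-! ### Testing with functions that vanish on the lateral boundary -/

lemma setIntegral_mul_indicator {X : Type*} [MeasurableSpace X] {μ : Measure X} {s t : Set X}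
    (ht : MeasurableSet t) (hts : t ⊆ s) (g f : X → ℝ) :
    ∫ z in s, g z * t.indicator f z ∂μ = ∫ z in t, g z * f z ∂μ := by
  simp_rw [← indicator_mul_right]
  rw [setIntegral_indicator ht, inter_eq_self_of_subset_right hts]

section CutLimits

variable {P : Data} {τ : ℝ} {f g : ℝ × E3 → ℝ}

lemma Admissible.integrableOn_mul_cut (hP : P.Admissible) (hτ : τ ≤ P.T) (hg : IntegrableOn g P.Q)
    (hf : ContDiffOn ℝ 1 f P.Qc) (h0 : ∀ t ∈ Icc 0 P.T, ∀ x ∈ frontier P.Ω, f (t, x) = 0)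
    {n : ℕ} (hn : n ≠ 0) : IntegrableOn (fun z => g z * P.cut τ n f z) P.Q := by
  obtain ⟨C, -, hC⟩ := hP.exists_bound hf.continuousOn
  exact hg.mul_bdd (c := C) (hP.cut_isTest hτ hn hf h0).1.continuous.aestronglyMeasurable
    ((ae_restrict_iff' hP.measurableSet_Q).2 (Eventually.of_forall fun z hz =>
      abs_cut_le.trans (hC z (Q_subset_Qc hz))))

lemma Admissible.integrableOn_mul_dx_cut (hP : P.Admissible) (hτ : τ ≤ P.T)
    (hg : IntegrableOn g P.Q) (hf : ContDiffOn ℝ 1 f P.Qc)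
    (h0 : ∀ t ∈ Icc 0 P.T, ∀ x ∈ frontier P.Ω, f (t, x) = 0)
    {n : ℕ} (hn : n ≠ 0) (j : Fin 3) :
    IntegrableOn (fun z => g z * dx j (P.cut τ n f) z) P.Q := by
  obtain ⟨C, hC0, hC⟩ := hP.exists_dx_cut_bound hf
  exact hg.mul_bdd (c := C) (continuous_dx (hP.cut_isTest hτ hn hf h0).1 j).aestronglyMeasurable
    ((ae_restrict_iff' hP.measurableSet_Q).2 (Eventually.of_forall fun z hz =>
      (hC τ n hn z hz j).trans (mul_le_of_le_one_left hC0 (timeCut_le_one _ _ _))))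

lemma Admissible.tendsto_setIntegral_mul_cut (hP : P.Admissible) (hτ : τ ≤ P.T)
    (hg : IntegrableOn g P.Q) (hf : ContDiffOn ℝ 1 f P.Qc)
    (h0 : ∀ t ∈ Icc 0 P.T, ∀ x ∈ frontier P.Ω, f (t, x) = 0) :
    Tendsto (fun n => ∫ z in P.Q, g z * P.cut τ n f z) atTop (𝓝 (∫ z in P.Qτ τ, g z * f z)) := by
  obtain ⟨C, -, hC⟩ := hP.exists_bound hf.continuousOn
  have hlim : ∫ z in P.Qτ τ, g z * f z = ∫ z in P.Q, g z * (P.Qτ τ).indicator f z := by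
    rw [← setIntegral_mul_indicator (hP.measurableSet_Qτ τ) (Qτ_subset_Q hτ)]
  rw [hlim]
  refine tendsto_integral_filter_of_dominated_convergence (fun z => |g z| * C) ?_ ?_
    (hg.abs.mul_const C) ?_
  · filter_upwards [eventually_ne_atTop 0] with n hn
    exact (hP.integrableOn_mul_cut hτ hg hf h0 hn).aestronglyMeasurable
  · refine Eventually.of_forall fun n => (ae_restrict_iff' hP.measurableSet_Q).2
      (Eventually.of_forall fun z hz => ?_)
    rw [norm_mul]
    exact mul_le_mul_of_nonneg_left (abs_cut_le.trans (hC z (Q_subset_Qc hz))) (norm_nonneg _)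
  · exact Eventually.of_forall fun z => (tendsto_cut hτ).const_mul (g z)

lemma Admissible.tendsto_setIntegral_mul_dx_cut (hP : P.Admissible) (hτ : τ ≤ P.T)
    (hg : IntegrableOn g P.Q) (hf : ContDiffOn ℝ 1 f P.Qc)
    (h0 : ∀ t ∈ Icc 0 P.T, ∀ x ∈ frontier P.Ω, f (t, x) = 0) (j : Fin 3) :
    Tendsto (fun n => ∫ z in P.Q, g z * dx j (P.cut τ n f) z) atTop
      (𝓝 (∫ z in P.Qτ τ, g z * dx j f z)) := by
  obtain ⟨C, hC0, hC⟩ := hP.exists_dx_cut_bound hf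
  have hlim : ∫ z in P.Qτ τ, g z * dx j f z = ∫ z in P.Q, g z * (P.Qτ τ).indicator (dx j f) z := by
    rw [← setIntegral_mul_indicator (hP.measurableSet_Qτ τ) (Qτ_subset_Q hτ)]
  rw [hlim]
  refine tendsto_integral_filter_of_dominated_convergence (fun z => |g z| * C) ?_ ?_
    (hg.abs.mul_const C) ?_
  · filter_upwards [eventually_ne_atTop 0] with n hn
    exact (hP.integrableOn_mul_dx_cut hτ hg hf h0 hn j).aestronglyMeasurable
  · filter_upwards [eventually_ne_atTop 0] with n hn
    refine (ae_restrict_iff' hP.measurableSet_Q).2 (Eventually.of_forall fun z hz => ?_)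
    rw [norm_mul]
    exact mul_le_mul_of_nonneg_left ((hC τ n hn z hz j).trans
      (mul_le_of_le_one_left hC0 (timeCut_le_one _ _ _))) (norm_nonneg _)
  · filter_upwards [hP.ae_tendsto_dx_cut (τ := τ) hf j] with z hz using hz.const_mul (g z)

/-- Integration by parts in space: there is no boundary term if one of the functions vanishes on the
lateral boundary. -/
lemma Admissible.setIntegral_mul_dx (hP : P.Admissible) (hτ : τ ≤ P.T)
    (hg : ContDiffOn ℝ 1 g P.Qc) (hf : ContDiffOn ℝ 1 f P.Qc)
    (h0 : ∀ t ∈ Icc 0 P.T, ∀ x ∈ frontier P.Ω, f (t, x) = 0) (j : Fin 3) :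
    ∫ z in P.Qτ τ, g z * dx j f z = - ∫ z in P.Qτ τ, dx j g z * f z := by
  obtain ⟨C, -, hC⟩ := hP.exists_bound hg.continuousOn
  obtain ⟨C', -, hC'⟩ := hP.exists_fderiv_bound hg
  have hgQ : ContDiffOn ℝ 1 g P.Q := hg.mono Q_subset_Qc
  have i1 : IntegrableOn g P.Q := hP.integrableOn_of_bounded hgQ.continuousOn
    fun z hz => hC z (Q_subset_Qc hz)
  have i2 : IntegrableOn (dx j g) P.Q := hP.integrableOn_of_bounded
    (continuousOn_dx hP.isOpen_Q hgQ j) fun z hz => (hC' z hz).2 j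
  refine tendsto_nhds_unique (hP.tendsto_setIntegral_mul_dx_cut hτ i1 hf h0 j)
    ((hP.tendsto_setIntegral_mul_cut hτ i2 hf h0).neg.congr' ?_)
  filter_upwards [eventually_ne_atTop 0] with n hn
  obtain ⟨h1, h2, h3⟩ := hP.cut_isTest hτ hn hf h0
  exact (setIntegral_mul_fderiv hP.isOpen_Q hgQ h1 h2 h3 _).symm

end CutLimits

namespace IsRegularSolution

variable {P : Data} {rho : ℝ → E3 → ℝ} {u : ℝ → E3 → E3} {S : ℝ → E3 → M3}
  {pi : Measure (ℝ × E3)} {R : ℝ → TensorMeasure} {p : ℝ → E3 → ℝ} {G : ℝ → E3 → M3}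
  {m : ℝ → E3 → E3} (h : P.IsRegularSolution rho u S pi R p G m)

include h

/-- The initial values of the classical density and velocity. The weakly continuous momentum is `ϱ u`
only at almost every time; that this extends to `t = 0` follows by testing with a fixed function and
continuity in time. -/
lemma ae_initial : ∀ᵐ x ∂(volume.restrict P.Ω), rho 0 x = P.rho0 x ∧ u 0 x = P.u0 x := by
  have hfin := h.adm.isFiniteMeasure_Ω
  have hΩ := h.adm.domain.isOpen
  have h0mem : (0 : ℝ) ∈ Icc 0 P.T := ⟨le_rfl, h.adm.T_pos.le⟩
  have hcc := fun i => (h.dens_contDiffOn.mul (h.vel_contDiffOn i)).continuousOn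
  have hm : ∀ i, ∀ᵐ x ∂(volume.restrict P.Ω), m 0 x i = rho 0 x * u 0 x i := by
    intro i
    have hslice : ∀ t ∈ Icc 0 P.T, ContinuousOn (fun x => rho t x * u t x i) (closure P.Ω) :=
      fun t ht => (hcc i).comp (f := fun x => (t, x)) (by fun_prop) fun x hx => ⟨ht, hx⟩
    obtain ⟨B, -, hB⟩ := h.adm.exists_bound (hcc i)
    have hm0 : IntegrableOn (fun x => m 0 x i) P.Ω := by
      have h1 := (h.sol.m_weak 2 one_lt_two).1 0 h0mem
      have h2 : Integrable (m 0) (volume.restrict P.Ω) := by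
        refine h1.integrable ?_
        rw [← ENNReal.ofReal_one]
        exact ENNReal.ofReal_le_ofReal (by norm_num)
      exact (EuclideanSpace.proj i : E3 →L[ℝ] ℝ).integrable_comp h2
    have hs0 : IntegrableOn (fun x => rho 0 x * u 0 x i) P.Ω :=
      ((hslice 0 h0mem).integrableOn_compact h.adm.isCompact_closure).mono_set subset_closure
    have hz := hΩ.ae_eq_zero_of_integral_contDiff_smul_eq_zero
      (f := fun x => m 0 x i - rho 0 x * u 0 x i) (hm0.sub hs0).locallyIntegrableOn ?_
    · rw [ae_restrict_iff' h.adm.measurableSet_Ω]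
      filter_upwards [hz] with x hx hxΩ
      exact sub_eq_zero.1 (hx hxΩ)
    intro g hg hgc hgs
    obtain ⟨M, hM⟩ := hgc.exists_bound_of_continuous hg.continuous
    let ψ : E3 → E3 := fun x => EuclideanSpace.single i (g x)
    have hψ : Continuous ψ := by
      have : ψ = fun x => g x • EuclideanSpace.single i (1 : ℝ) := by
        funext x
        ext k
        simp [ψ]
      rw [this]
      exact hg.continuous.smul continuous_const
    have hψm : MemLp ψ (ENNReal.ofReal (2 * 2 / (2 + 1) / (2 * 2 / (2 + 1) - 1)))
        (volume.restrict P.Ω) :=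
      MemLp.of_bound hψ.aestronglyMeasurable M (Eventually.of_forall fun x => by
        simpa [ψ] using hM x)
    have hinner : ∀ (a : E3) x, inner ℝ a (ψ x) = a i * g x := fun a x => by
      rw [EuclideanSpace.inner_single_right]
      simp [mul_comm]
    have c1 : ContinuousOn (fun t => ∫ x in P.Ω, m t x i * g x) (Icc 0 P.T) := by
      have := (h.sol.m_weak 2 one_lt_two).2 ψ hψm
      simpa only [hinner] using this
    have c2 : ContinuousOn (fun t => ∫ x in P.Ω, rho t x * u t x i * g x) (Icc 0 P.T) := by
      refine continuousOn_of_dominated (bound := fun _ => B * M) ?_ ?_ (integrable_const _) ?_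
      · intro t ht
        exact (((hslice t ht).mono subset_closure).mul hg.continuous.continuousOn).aestronglyMeasurable
          h.adm.measurableSet_Ω
      · intro t ht
        filter_upwards [ae_restrict_mem h.adm.measurableSet_Ω] with x hx
        rw [norm_mul]
        exact mul_le_mul (hB (t, x) ⟨ht, subset_closure hx⟩) (hM x) (norm_nonneg _)
          ((abs_nonneg _).trans (hB (t, x) ⟨ht, subset_closure hx⟩))
      · filter_upwards [ae_restrict_mem h.adm.measurableSet_Ω] with x hx
        exact ((hcc i).comp (f := fun t => (t, x)) (by fun_prop)
          fun t ht => ⟨ht, subset_closure hx⟩).mul continuousOn_const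
    have hae : (fun t => ∫ x in P.Ω, m t x i * g x) =ᵐ[volume.restrict (Icc 0 P.T)]
        fun t => ∫ x in P.Ω, rho t x * u t x i * g x := by
      rw [← restrict_Ioo_eq_restrict_Icc]
      have h1 := h.sol.m_eq
      rw [volume_restrict_Q] at h1
      filter_upwards [Measure.ae_ae_of_ae_prod h1] with t ht
      refine integral_congr_ae ?_
      filter_upwards [ht] with x hx
      simp only [hx, PiLp.smul_apply, smul_eq_mul]
    have heq := Measure.eqOn_Icc_of_ae_eq volume h.adm.T_pos.ne hae c1 c2 h0mem
    rw [← setIntegral_eq_integral_of_forall_compl_eq_zero (s := P.Ω)]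
    · have : ∀ x, g x • (m 0 x i - rho 0 x * u 0 x i) =
          m 0 x i * g x - rho 0 x * u 0 x i * g x := fun x => by
        rw [smul_eq_mul]; ring
      simp_rw [this]
      have i1 := hm0.mul_bdd (c := M) hg.continuous.aestronglyMeasurable (Eventually.of_forall hM)
      have i2 := hs0.mul_bdd (c := M) hg.continuous.aestronglyMeasurable (Eventually.of_forall hM)
      rw [integral_sub i1 i2]
      exact sub_eq_zero.2 heq
    · intro x hx
      rw [image_eq_zero_of_notMem_tsupport fun h' => hx (hgs h'), zero_smul]
  obtain ⟨c, hc, hb⟩ := h.exists_dens_lower_bound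
  filter_upwards [h.sol.rho_init, h.sol.m_init, ae_all_iff.2 hm,
    ae_restrict_mem h.adm.measurableSet_Ω] with x h1 h2 h3 hx
  refine ⟨h1, ?_⟩
  have hpos : rho 0 x ≠ 0 := (hc.trans_le (hb 0 h0mem x hx)).ne'
  ext i
  rw [u0, ← h1, ← h2, PiLp.smul_apply, h3 i, smul_eq_mul, inv_mul_cancel_left₀ hpos]

end IsRegularSolution

end Data

/-! ### The pressure as a measure with density -/

/-- Continuous cut-off functions that increase to the indicator function of an open set. -/
noncomputable def interiorCut {X : Type*} [PseudoMetricSpace X] (U : Set X) (n : ℕ) (x : X) : ℝ :=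
  max 0 (min 1 (n * Metric.infDist x Uᶜ - 1))

section InteriorCut

variable {X : Type*} [PseudoMetricSpace X] {U : Set X}

lemma continuous_interiorCut (U : Set X) (n : ℕ) : Continuous (interiorCut U n) :=
  continuous_const.max (continuous_const.min ((continuous_const.mul
    (Metric.continuous_infDist_pt _)).sub continuous_const))

lemma abs_interiorCut_le (U : Set X) (n : ℕ) (x : X) : |interiorCut U n x| ≤ 1 := by
  rw [interiorCut, abs_of_nonneg (le_max_left _ _)]
  exact max_le zero_le_one (min_le_left _ _)

lemma interiorCut_of_notMem (n : ℕ) {x : X} (hx : x ∉ U) : interiorCut U n x = 0 := by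
  rw [interiorCut, Metric.infDist_zero_of_mem hx]
  norm_num

lemma tsupport_interiorCut_subset (U : Set X) (n : ℕ) : tsupport (interiorCut U n) ⊆ U := by
  have hcl : IsClosed {x : X | 1 ≤ n * Metric.infDist x Uᶜ} :=
    isClosed_le continuous_const (continuous_const.mul (Metric.continuous_infDist_pt _))
  refine (closure_minimal (fun x hx => ?_) hcl).trans fun x hx => ?_
  · by_contra h
    apply hx
    rw [mem_ofPred_eq, not_le] at h
    rw [interiorCut, max_eq_left]
    exact (min_le_right _ _).trans (by linarith)
  · by_contra h
    rw [mem_ofPred_eq, Metric.infDist_zero_of_mem h] at hx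
    norm_num at hx

lemma tendsto_interiorCut (hU : IsOpen U) (hne : Uᶜ.Nonempty) (x : X) :
    Tendsto (fun n => interiorCut U n x) atTop (𝓝 (U.indicator 1 x)) := by
  by_cases hx : x ∈ U
  · rw [indicator_of_mem hx]
    refine tendsto_const_nhds.congr' ?_
    have hpos : 0 < Metric.infDist x Uᶜ :=
      (hU.isClosed_compl.notMem_iff_infDist_pos hne).1 fun h => h hx
    have h1 := (tendsto_natCast_atTop_atTop (R := ℝ)).atTop_mul_const hpos
    filter_upwards [h1.eventually_ge_atTop 2] with n hn
    rw [interiorCut, min_eq_left (by linarith), max_eq_right zero_le_one]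
    rfl
  · rw [indicator_of_notMem hx]
    exact tendsto_const_nhds.congr fun n => (interiorCut_of_notMem n hx).symm

end InteriorCut

namespace Data

/-- The total trace of the Reynolds defect at time `t`. -/
noncomputable def defectTrace (P : Data) (R : ℝ → TensorMeasure) (t : ℝ) : ℝ :=
  (R t (closure P.Ω)).trace

namespace IsRegularSolution

variable {P : Data} {rho : ℝ → E3 → ℝ} {u : ℝ → E3 → E3} {S : ℝ → E3 → M3}
  {pi : Measure (ℝ × E3)} {R : ℝ → TensorMeasure} {p : ℝ → E3 → ℝ} {G : ℝ → E3 → M3}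
  {m : ℝ → E3 → E3} (h : P.IsRegularSolution rho u S pi R p G m)

include h

lemma exists_pressure_bound : ∃ C, 0 ≤ C ∧ ∀ z ∈ P.Q, |p z.1 z.2| ≤ C := by
  obtain ⟨C, hC0, hC⟩ := h.adm.exists_bound h.hp.1
  exact ⟨C, hC0, fun z hz => hC z (Q_subset_Qc hz)⟩

lemma pressure_mul_integrable {g : ℝ × E3 → ℝ} (hg : IntegrableOn g P.Q) :
    IntegrableOn (fun z => p z.1 z.2 * g z) P.Q := by
  obtain ⟨C, -, hC⟩ := h.exists_pressure_bound
  exact hg.bdd_mul (c := C) (h.pressure_continuousOn.aestronglyMeasurable h.adm.measurableSet_Q)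
    ((ae_restrict_iff' h.adm.measurableSet_Q).2 (Eventually.of_forall hC))

/-- The density represents the pressure measure on integrable fields that are continuous in the
interior, up to the boundary. -/
lemma setIntegral_pressure {U : Set (ℝ × E3)} (hU : IsOpen U) (hUQ : U ⊆ P.Q) {g : ℝ × E3 → ℝ}
    (hg : ContinuousOn g P.Q) (hgpi : Integrable g pi) (hgQ : IntegrableOn g P.Q) :
    ∫ z in U, g z ∂pi = ∫ z in U, p z.1 z.2 * g z := by
  have hne : Uᶜ.Nonempty := ⟨(0, 0), fun h' => lt_irrefl _ (hUQ h').1.1⟩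
  let φ : ℕ → ℝ × E3 → ℝ := fun n z => g z * interiorCut U n z
  have hcomp : ∀ n, HasCompactSupport (interiorCut U n) := fun n =>
    h.adm.isCompact_Qc.of_isClosed_subset (isClosed_tsupport _)
      ((tsupport_interiorCut_subset U n).trans (hUQ.trans Q_subset_Qc))
  have hφ : ∀ n, Continuous (φ n) := fun n =>
    continuous_mul_of_tsupport_subset hU (hg.mono hUQ) (continuous_interiorCut U n)
      (tsupport_interiorCut_subset U n)
  have hφs : ∀ n, tsupport (φ n) ⊆ P.Q := fun n =>
    (tsupport_mul_subset_right.trans (tsupport_interiorCut_subset U n)).trans hUQ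
  have heq : ∀ n, ∫ z, φ n z ∂pi = ∫ z in P.Q, (p z.1 z.2 * g z) * interiorCut U n z := by
    intro n
    rw [h.hp.2 _ (hφ n) (hcomp n).mul_left (hφs n)]
    refine integral_congr_ae (Eventually.of_forall fun z => ?_)
    simp only [φ]
    ring
  have hbd : ∀ (a : ℝ) n z, ‖a * interiorCut U n z‖ ≤ |a| := fun a n z => by
    rw [norm_mul]
    exact mul_le_of_le_one_right (norm_nonneg _) (abs_interiorCut_le _ _ _)
  have hpg := h.pressure_mul_integrable hgQ
  have l1 : Tendsto (fun n => ∫ z, φ n z ∂pi) atTop (𝓝 (∫ z, g z * U.indicator 1 z ∂pi)) :=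
    tendsto_integral_of_dominated_convergence (fun z => |g z|)
      (fun n => (hφ n).aestronglyMeasurable) hgpi.abs
      (fun n => Eventually.of_forall fun z => hbd _ n z)
      (Eventually.of_forall fun z => (tendsto_interiorCut hU hne z).const_mul _)
  have l2 : Tendsto (fun n => ∫ z in P.Q, (p z.1 z.2 * g z) * interiorCut U n z) atTop
      (𝓝 (∫ z in P.Q, (p z.1 z.2 * g z) * U.indicator 1 z)) :=
    tendsto_integral_of_dominated_convergence (fun z => |p z.1 z.2 * g z|)
      (fun n => hpg.aestronglyMeasurable.mul (continuous_interiorCut U n).aestronglyMeasurable)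
      hpg.abs (fun n => Eventually.of_forall fun z => hbd _ n z)
      (Eventually.of_forall fun z => (tendsto_interiorCut hU hne z).const_mul _)
  simp_rw [heq] at l1
  have e := tendsto_nhds_unique l1 l2
  have e1 := setIntegral_mul_indicator (μ := pi) hU.measurableSet (subset_univ U) g 1
  have e2 := setIntegral_mul_indicator (μ := volume) hU.measurableSet hUQ
    (fun z => p z.1 z.2 * g z) 1
  rw [setIntegral_univ] at e1
  rw [e1, e2] at e
  simpa using e

/-! ### The momentum equation tested with the relative velocity -/

lemma ae_defectTrace_nonneg : ∀ᵐ t ∂(volume.restrict (Ioo 0 P.T)), 0 ≤ defectTrace P R t := by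
  filter_upwards [h.sol.defect.pos] with t ht using (ht.2 _).trace_nonneg

lemma defectTrace_integrable : IntegrableOn (defectTrace P R) (Ioo 0 P.T) := by
  obtain ⟨C, hC⟩ := h.sol.defect.bounded
  refine Integrable.of_bound
    (h.sol.defect.aemeasurable_trace isClosed_closure.measurableSet).aestronglyMeasurable C ?_
  filter_upwards [hC, h.ae_defectTrace_nonneg] with t h1 h2
  rwa [Real.norm_eq_abs, abs_of_nonneg h2]

lemma mul_integrable {f g : ℝ × E3 → ℝ} (hg : IntegrableOn g P.Q) (hf : ContinuousOn f P.Qc) :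
    IntegrableOn (fun z => g z * f z) P.Q := by
  obtain ⟨C, -, hC⟩ := h.adm.exists_bound hf
  exact hg.mul_bdd (c := C)
    ((hf.mono Q_subset_Qc).aestronglyMeasurable h.adm.measurableSet_Q)
    ((ae_restrict_iff' h.adm.measurableSet_Q).2 (Eventually.of_forall fun z hz =>
      hC z (Q_subset_Qc hz)))

lemma inertia_integrable (i : Fin 3) :
    IntegrableOn (fun z : ℝ × E3 => inertia rho u z.1 z.2 i) P.Q := by
  have hr := h.dens_contDiffOn
  have hv := h.vel_contDiffOn
  refine IntegrableOn.congr_fun (f := fun z => dt (fun z => dens rho z * vel u i z) z +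
      ∑ j, dx j (fun z => dens rho z * vel u i z * vel u j z) z) ?_
    (fun z hz => (h.inertia_eq hz i).symm) h.adm.measurableSet_Q
  exact (h.dt_integrable (hr.mul (hv i))).add
    (integrable_finsetSum _ fun j _ => h.dx_integrable ((hr.mul (hv i)).mul (hv j)) j)

/-- The momentum equation tested with the relative velocity `u - u_B`. The cut-off test functions
keep the defect under control uniformly, so that it contributes no more than a multiple of its total
trace. -/
lemma exists_momentum_bound : ∃ D, 0 ≤ D ∧ ∀ τ ≤ P.T,
    |(∑ i, ∫ z in P.Qτ τ, inertia rho u z.1 z.2 i * rel P u i z)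
      + (∑ i, ∑ j, ∫ z in P.Qτ τ, S z.1 z.2 i j * dx j (rel P u i) z)
      - ∑ i, ∫ z in P.Qτ τ, p z.1 z.2 * dx i (rel P u i) z|
    ≤ D * ∫ t in Ioo 0 τ, defectTrace P R t := by
  choose c hc0 hc using fun i => h.adm.exists_dx_cut_bound (h.rel_contDiffOn i)
  let C := ∑ i, c i
  have hcC : ∀ i, c i ≤ C := fun i =>
    Finset.single_le_sum (fun i _ => hc0 i) (Finset.mem_univ i)
  have hC0 : 0 ≤ C := Finset.sum_nonneg fun i _ => hc0 i
  refine ⟨9 * C, by positivity, fun τ hτ => ?_⟩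
  have hw := h.rel_contDiffOn
  have hb := h.rel_eq_zero_on_frontier
  have hpint : IntegrableOn (fun z : ℝ × E3 => p z.1 z.2) P.Q := by
    obtain ⟨B, -, hB⟩ := h.exists_pressure_bound
    exact h.adm.integrableOn_of_bounded h.pressure_continuousOn hB
  have lim : Tendsto (fun n =>
      |(∑ i, ∫ z in P.Q, inertia rho u z.1 z.2 i * P.cut τ n (rel P u i) z)
        + (∑ i, ∑ j, ∫ z in P.Q, S z.1 z.2 i j * dx j (P.cut τ n (rel P u i)) z)
        - ∑ i, ∫ z in P.Q, p z.1 z.2 * dx i (P.cut τ n (rel P u i)) z|) atTop (𝓝 _) :=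
    (((tendsto_finsetSum _ fun i _ => h.adm.tendsto_setIntegral_mul_cut hτ
      (h.inertia_integrable i) (hw i) (hb i)).add
      (tendsto_finsetSum _ fun i _ => tendsto_finsetSum _ fun j _ =>
        h.adm.tendsto_setIntegral_mul_dx_cut hτ (h.sol.S_integrable i j) (hw i) (hb i) j)).sub
      (tendsto_finsetSum _ fun i _ =>
        h.adm.tendsto_setIntegral_mul_dx_cut hτ hpint (hw i) (hb i) i)).abs
  refine le_of_tendsto lim ?_
  filter_upwards [eventually_ne_atTop 0] with n hn
  have htest := fun i => h.adm.cut_isTest hτ hn (hw i) (hb i)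
  let φ : ℝ → E3 → E3 := fun t x => WithLp.toLp 2 fun i => P.cut τ n (rel P u i) (t, x)
  have hφ : ContDiff ℝ 1 (fun z : ℝ × E3 => φ z.1 z.2) := by
    rw [contDiff_euclidean]
    exact fun i => (htest i).1
  let K : Set (ℝ × E3) := ⋃ i, tsupport (P.cut τ n (rel P u i))
  have hK : IsCompact K := isCompact_iUnion fun i => (htest i).2.1
  have hKQ : K ⊆ P.Q := iUnion_subset fun i => (htest i).2.2
  have hφs : tsupport (fun z : ℝ × E3 => φ z.1 z.2) ⊆ K := by
    refine closure_minimal (fun z hz => ?_) hK.isClosed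
    by_contra hzK
    apply hz
    ext i
    exact image_eq_zero_of_notMem_tsupport (f := P.cut τ n (rel P u i))
      fun h' => hzK (mem_iUnion.2 ⟨i, h'⟩)
  have hmom := h.momentum_test hφ (hK.of_isClosed_subset (isClosed_tsupport _) hφs)
    (hφs.trans hKQ)
  have hgrad : ∀ (z : ℝ × E3) i j, grad (φ z.1) z.2 i j = dx j (P.cut τ n (rel P u i)) z :=
    fun z i j => grad_slice_eq_dx (hφ.differentiable one_ne_zero z) i j
  have e1 : ∫ z in P.Q, ∑ i, inertia rho u z.1 z.2 i * φ z.1 z.2 i =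
      ∑ i, ∫ z in P.Q, inertia rho u z.1 z.2 i * P.cut τ n (rel P u i) z :=
    integral_finsetSum _ fun i _ =>
      h.adm.integrableOn_mul_cut hτ (h.inertia_integrable i) (hw i) (hb i) hn
  have e2 : ∫ z in P.Q, frob (S z.1 z.2) (grad (φ z.1) z.2) =
      ∑ i, ∑ j, ∫ z in P.Q, S z.1 z.2 i j * dx j (P.cut τ n (rel P u i)) z := by
    have hi := fun i j => h.adm.integrableOn_mul_dx_cut hτ (h.sol.S_integrable i j) (hw i) (hb i)
      hn j
    simp only [frob, hgrad]
    rw [integral_finsetSum _ fun i _ => integrable_finsetSum _ fun j _ => hi i j]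
    exact Finset.sum_congr rfl fun i _ => integral_finsetSum _ fun j _ => hi i j
  have e3 : ∫ z in P.Q, p z.1 z.2 * (grad (φ z.1) z.2).trace =
      ∑ i, ∫ z in P.Q, p z.1 z.2 * dx i (P.cut τ n (rel P u i)) z := by
    simp only [Matrix.trace, Matrix.diag_apply, hgrad, Finset.mul_sum]
    exact integral_finsetSum _ fun i _ =>
      h.adm.integrableOn_mul_dx_cut hτ hpint (hw i) (hb i) hn i
  rw [e1, e2, e3] at hmom
  have e4 : (∑ i, ∫ z in P.Q, inertia rho u z.1 z.2 i * P.cut τ n (rel P u i) z)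
        + (∑ i, ∑ j, ∫ z in P.Q, S z.1 z.2 i j * dx j (P.cut τ n (rel P u i)) z)
        - ∑ i, ∫ z in P.Q, p z.1 z.2 * dx i (P.cut τ n (rel P u i)) z =
      ∫ t in Ioo 0 P.T, (R t).pairing P.Ω (grad (φ t)) := by linarith
  have e5 : 9 * C * ∫ t in Ioo 0 τ, defectTrace P R t =
      ∫ t in Ioo 0 P.T, 9 * C * defectTrace P R t * (Ioo 0 τ).indicator 1 t := by
    rw [setIntegral_mul_indicator measurableSet_Ioo (Ioo_subset_Ioo_right hτ),
      ← integral_const_mul]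
    simp
  rw [e4, e5, ← Real.norm_eq_abs]
  refine norm_integral_le_of_norm_le ?_ ?_
  · refine (h.defectTrace_integrable.const_mul (9 * C)).mul_bdd (c := 1)
      ((measurable_const.indicator measurableSet_Ioo).aestronglyMeasurable)
      (Eventually.of_forall fun t => ?_)
    rw [indicator_apply]
    split_ifs <;> simp
  · filter_upwards [h.sol.defect.pos, h.ae_defectTrace_nonneg, ae_restrict_mem measurableSet_Ioo]
      with t hpos h0 ht
    have hA : ∀ x ∈ P.Ω, ∀ i j, |grad (φ t) x i j| ≤ timeCut τ n t * C := fun x hx i j => by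
      have h1 := hgrad (t, x) i j
      change grad (φ t) x i j = _ at h1
      rw [h1]
      exact (hc i τ n hn (t, x) ⟨ht, hx⟩ j).trans
        (mul_le_mul_of_nonneg_left (hcC i) (timeCut_nonneg _ _ _))
    have h2 := hpos.abs_pairing_le isClosed_closure.measurableSet h.adm.measurableSet_Ω
      subset_closure (mul_nonneg (timeCut_nonneg τ n t) hC0) hA
    have h3 : timeCut τ n t ≤ (Ioo 0 τ).indicator 1 t := by
      by_cases htτ : t ∈ Ioo 0 τ
      · rw [indicator_of_mem htτ]
        exact timeCut_le_one _ _ _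
      · rw [indicator_of_notMem htτ, timeCut_eq_zero_of_notMem n htτ]
    refine h2.trans ?_
    have h4 : 0 ≤ 9 * C * defectTrace P R t := by positivity
    calc 9 * (timeCut τ n t * C) * (R t (closure P.Ω)).trace
        = 9 * C * defectTrace P R t * timeCut τ n t := by rw [defectTrace]; ring
      _ ≤ _ := mul_le_mul_of_nonneg_left h3 h4

end IsRegularSolution

/-! ### The relative energy inequality -/

/-- The relative kinetic energy per unit mass, `|u - u_B|² / 2`. -/
noncomputable def kin (P : Data) (u : ℝ → E3 → E3) (z : ℝ × E3) : ℝ :=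
  1 / 2 * ∑ i, rel P u i z * rel P u i z

/-- The density `F(𝔻u) + F*(𝕊)` of the dissipation. -/
noncomputable def dissip (P : Data) (S : ℝ → E3 → M3) (G : ℝ → E3 → M3) (z : ℝ × E3) : ℝ≥0∞ :=
  ENNReal.ofReal (P.F (symPart (G z.1 z.2))) + (conjugate P.F (S z.1 z.2)).toENNReal

lemma norm_sq_eq_sum (v : E3) : ‖v‖ ^ 2 = ∑ i, v i * v i := by
  rw [EuclideanSpace.norm_sq_eq]
  exact Finset.sum_congr rfl fun i _ => by rw [Real.norm_eq_abs, sq_abs, sq]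

namespace IsRegularSolution

variable {P : Data} {rho : ℝ → E3 → ℝ} {u : ℝ → E3 → E3} {S : ℝ → E3 → M3}
  {pi : Measure (ℝ × E3)} {R : ℝ → TensorMeasure} {p : ℝ → E3 → ℝ} {G : ℝ → E3 → M3}
  {m : ℝ → E3 → E3} (h : P.IsRegularSolution rho u S pi R p G m)

include h

lemma kin_contDiffOn : ContDiffOn ℝ 1 (kin P u) P.Qc :=
  contDiffOn_const.mul (ContDiffOn.sum fun i _ => (h.rel_contDiffOn i).mul (h.rel_contDiffOn i))

lemma fderiv_kin {z : ℝ × E3} (hz : z ∈ P.Q) (v : ℝ × E3) :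
    fderiv ℝ (kin P u) z v = ∑ i, rel P u i z * fderiv ℝ (rel P u i) z v := by
  have hd := fun i => (h.differentiableAt (h.rel_contDiffOn i) hz).hasFDerivAt
  have h1 : HasFDerivAt (kin P u) _ z :=
    (HasFDerivAt.fun_sum (u := Finset.univ) fun i _ => (hd i).mul (hd i)).const_mul (1 / 2)
  rw [h1.fderiv]
  simp only [FunLike.coe_smul, Pi.smul_apply, FunLike.coe_sum, Finset.sum_apply,
    FunLike.coe_add, Pi.add_apply, smul_eq_mul, Finset.mul_sum]
  exact Finset.sum_congr rfl fun i _ => by ring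

/-- The balance of the relative kinetic energy: transport along the flow creates no kinetic
energy, since the relative velocity vanishes on the lateral boundary. -/
lemma kinetic_balance {τ : ℝ} (hτ0 : 0 ≤ τ) (hτ : τ ≤ P.T) :
    ∫ z in P.Qτ τ, (dens rho z * dt (kin P u) z + ∑ j, dens rho z * vel u j z * dx j (kin P u) z) =
      (∫ x in P.Ω, rho τ x * kin P u (τ, x)) - ∫ x in P.Ω, rho 0 x * kin P u (0, x) := by
  have hr := h.dens_contDiffOn
  have hv := h.vel_contDiffOn
  have hk := h.kin_contDiffOn
  have hsub := Qτ_subset_Q (P := P) hτ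
  have hk0 : ∀ t ∈ Icc 0 P.T, ∀ x ∈ frontier P.Ω, kin P u (t, x) = 0 := fun t ht x hx => by
    simp [kin, h.rel_eq_zero_on_frontier _ t ht x hx]
  have hrk : ContDiffOn ℝ 1 (fun z => dens rho z * kin P u z) P.Qc := hr.mul hk
  have e1 := h.adm.setIntegral_dt hτ0 hτ hrk
  have e2 := fun j => h.adm.setIntegral_mul_dx hτ (hr.mul (hv j)) hk hk0 j
  have i1 := (h.dt_integrable hrk).mono_set hsub
  have i2 : ∀ j, IntegrableOn (fun z => dens rho z * vel u j z * dx j (kin P u) z) (P.Qτ τ) :=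
    fun j => ((h.mul_integrable (h.dx_integrable hk j) (hr.mul (hv j)).continuousOn).mono_set
      hsub).congr_fun (fun z _ => mul_comm _ _) (h.adm.measurableSet_Qτ τ)
  have i3 : ∀ j, IntegrableOn (fun z => dx j (fun z => dens rho z * vel u j z) z * kin P u z)
      (P.Qτ τ) :=
    fun j => (h.mul_integrable (h.dx_integrable (hr.mul (hv j)) j) hk.continuousOn).mono_set hsub
  have e3 : ∫ z in P.Qτ τ, (dens rho z * dt (kin P u) z +
        ∑ j, dens rho z * vel u j z * dx j (kin P u) z) =
      ∫ z in P.Qτ τ, (dt (fun z => dens rho z * kin P u z) z +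
        ∑ j, (dx j (fun z => dens rho z * vel u j z) z * kin P u z
          + dens rho z * vel u j z * dx j (kin P u) z)) := by
    refine setIntegral_congr_fun (h.adm.measurableSet_Qτ τ) fun z hz => ?_
    have hc := h.continuity_eq (hsub hz)
    rw [dt_mul (h.differentiableAt hr (hsub hz)) (h.differentiableAt hk (hsub hz)),
      Finset.sum_add_distrib, ← Finset.sum_mul]
    have : ∑ j, dx j (fun z => dens rho z * vel u j z) z = - dt (dens rho) z := by linarith
    rw [this]
    ring
  have i4 : ∀ j, IntegrableOn (fun z => dx j (fun z => dens rho z * vel u j z) z * kin P u z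
      + dens rho z * vel u j z * dx j (kin P u) z) (P.Qτ τ) := fun j => (i3 j).add (i2 j)
  rw [e3, integral_add i1 (integrable_finsetSum _ fun j _ => i4 j), e1,
    integral_finsetSum _ fun j _ => i4 j, Finset.sum_eq_zero, add_zero]
  · rfl
  · intro j _
    rw [integral_add (i3 j) (i2 j), e2 j]
    ring

lemma inertia_mul_rel {z : ℝ × E3} (hz : z ∈ P.Q) :
    ∑ i, inertia rho u z.1 z.2 i * rel P u i z =
      (dens rho z * dt (kin P u) z + ∑ j, dens rho z * vel u j z * dx j (kin P u) z)
      + (rho z.1 z.2 * ∑ i, ∑ j, u z.1 z.2 i * u z.1 z.2 j * P.gradB z.2 i j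
        - rho z.1 z.2 * ∑ i, ∑ j, u z.1 z.2 j * P.uB z.2 i * P.gradB z.2 i j) := by
  have k1 : dt (kin P u) z = ∑ i, rel P u i z * dt (vel u i) z := by
    simp_rw [← h.dt_rel hz]
    exact h.fderiv_kin hz _
  have k2 : ∀ j, dx j (kin P u) z =
      ∑ i, rel P u i z * (dx j (vel u i) z - P.gradB z.2 i j) := fun j => by
    simp_rw [← h.dx_rel hz]
    exact h.fderiv_kin hz _
  simp only [h.inertia_eq_convective hz, k1, k2, dens, vel, rel, Fin.sum_univ_three]
  ring

lemma integrableOn_of_continuousOn {f : ℝ × E3 → ℝ} (hf : ContinuousOn f P.Qc) :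
    IntegrableOn f P.Q :=
  (hf.integrableOn_compact h.adm.isCompact_Qc).mono_set Q_subset_Qc

lemma uB_continuousOn (i : Fin 3) : ContinuousOn (fun z : ℝ × E3 => P.uB z.2 i) P.Qc :=
  ((EuclideanSpace.proj i : E3 →L[ℝ] ℝ).continuous.comp_continuousOn
    h.adm.uB_extension.continuousOn).comp continuousOn_snd fun _ hz => hz.2

lemma gradB_continuousOn_Qc (i j : Fin 3) :
    ContinuousOn (fun z : ℝ × E3 => P.gradB z.2 i j) P.Qc :=
  (h.adm.gradB_continuousOn i j).comp continuousOn_snd fun _ hz => hz.2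

lemma stress_mul_dx_vel_integrable (i j : Fin 3) :
    IntegrableOn (fun z : ℝ × E3 => S z.1 z.2 i j * dx j (vel u i) z) P.Q := by
  obtain ⟨C, -, hC⟩ := h.adm.exists_fderiv_bound (h.vel_contDiffOn i)
  exact h.integrable_stress_mul (continuousOn_dx h.adm.isOpen_Q
    ((h.vel_contDiffOn i).mono Q_subset_Qc) j) (fun z hz => (hC z hz).2 j) i j

lemma stress_mul_gradB_integrable (i j : Fin 3) :
    IntegrableOn (fun z : ℝ × E3 => S z.1 z.2 i j * P.gradB z.2 i j) P.Q := by
  obtain ⟨C, -, hC⟩ := h.adm.exists_gradB_bound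
  exact h.integrable_stress_mul ((h.gradB_continuousOn_Qc i j).mono Q_subset_Qc)
    (fun z hz => hC z.2 (subset_closure hz.2) i j) i j

/-- The work of the inertial forces against the relative velocity. -/
lemma sum_setIntegral_inertia_mul_rel {τ : ℝ} (hτ0 : 0 ≤ τ) (hτ : τ ≤ P.T) :
    ∑ i, ∫ z in P.Qτ τ, inertia rho u z.1 z.2 i * rel P u i z =
      ((∫ x in P.Ω, rho τ x * kin P u (τ, x)) - ∫ x in P.Ω, rho 0 x * kin P u (0, x))
      + ((∫ z in P.Qτ τ, rho z.1 z.2 * ∑ i, ∑ j, u z.1 z.2 i * u z.1 z.2 j * P.gradB z.2 i j)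
        - ∫ z in P.Qτ τ, rho z.1 z.2 * ∑ i, ∑ j, u z.1 z.2 j * P.uB z.2 i * P.gradB z.2 i j) := by
  have hr := h.dens_contDiffOn
  have hv := h.vel_contDiffOn
  have hk := h.kin_contDiffOn
  have hsub := Qτ_subset_Q (P := P) hτ
  have i1 : ∀ i, IntegrableOn (fun z : ℝ × E3 => inertia rho u z.1 z.2 i * rel P u i z) (P.Qτ τ) :=
    fun i => (h.mul_integrable (h.inertia_integrable i) (h.rel_contDiffOn i).continuousOn).mono_set
      hsub
  have i2 : IntegrableOn (fun z => dens rho z * dt (kin P u) z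
      + ∑ j, dens rho z * vel u j z * dx j (kin P u) z) (P.Qτ τ) := by
    refine IntegrableOn.congr_fun (f := fun z => dt (kin P u) z * dens rho z
      + ∑ j, dx j (kin P u) z * (dens rho z * vel u j z)) ?_
      (fun z _ => by simp only [mul_comm (dens rho z), mul_comm (dx _ _ z)])
      (h.adm.measurableSet_Qτ τ)
    refine IntegrableOn.mono_set ?_ hsub
    exact (h.mul_integrable (h.dt_integrable hk) hr.continuousOn).add
      (integrable_finsetSum _ fun j _ =>
        h.mul_integrable (h.dx_integrable hk j) (hr.mul (hv j)).continuousOn)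
  have i3 : IntegrableOn (fun z : ℝ × E3 =>
      rho z.1 z.2 * ∑ i, ∑ j, u z.1 z.2 i * u z.1 z.2 j * P.gradB z.2 i j) (P.Qτ τ) :=
    (h.integrableOn_of_continuousOn (hr.continuousOn.mul (continuousOn_finsetSum _ fun i _ =>
      continuousOn_finsetSum _ fun j _ => ((hv i).continuousOn.mul (hv j).continuousOn).mul
        (h.gradB_continuousOn_Qc i j)))).mono_set hsub
  have i4 : IntegrableOn (fun z : ℝ × E3 =>
      rho z.1 z.2 * ∑ i, ∑ j, u z.1 z.2 j * P.uB z.2 i * P.gradB z.2 i j) (P.Qτ τ) :=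
    (h.integrableOn_of_continuousOn (hr.continuousOn.mul (continuousOn_finsetSum _ fun i _ =>
      continuousOn_finsetSum _ fun j _ => ((hv j).continuousOn.mul (h.uB_continuousOn i)).mul
        (h.gradB_continuousOn_Qc i j)))).mono_set hsub
  rw [← integral_finsetSum _ fun i _ => i1 i, ← h.kinetic_balance hτ0 hτ, ← integral_sub i3 i4]
  refine Eq.trans ?_ (integral_add i2 (i3.sub i4))
  exact setIntegral_congr_fun (h.adm.measurableSet_Qτ τ) fun z hz => h.inertia_mul_rel (hsub hz)

/-- Comparing the energy inequality with the momentum equation tested with `u - u_B`, all terms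
cancel but those of the dissipation and those of the defect. -/
lemma exists_relative_energy_bound : ∃ D, 0 ≤ D ∧ ∀ᵐ τ ∂(volume.restrict (Ioo 0 P.T)),
    (∫⁻ z in P.Qτ τ, dissip P S G z).toReal
      - (∑ i, ∑ j, ∫ z in P.Qτ τ, S z.1 z.2 i j * dx j (vel u i) z)
      + 1 / P.dbar * defectTrace P R τ
    ≤ D * ∫ t in Ioo 0 τ, defectTrace P R t := by
  obtain ⟨D, hD0, hD⟩ := h.exists_momentum_bound
  obtain ⟨B, hB0, hB⟩ := h.adm.exists_gradB_bound
  refine ⟨D + 9 * B, by positivity, ?_⟩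
  filter_upwards [h.sol.energy, ae_restrict_mem measurableSet_Ioo] with τ hen hτ
  have hτT := hτ.2.le
  have hsub := Qτ_subset_Q (P := P) hτT
  have hmeas := h.adm.measurableSet_Qτ τ
  have hmom := hD τ hτT
  rw [h.sum_setIntegral_inertia_mul_rel hτ.1.le hτT] at hmom
  -- kinetic energy
  have hkin : ∀ (v : E3) t x, u t x = v → ‖v - P.uB x‖ ^ 2 = 2 * kin P u (t, x) := by
    intro v t x hv
    rw [norm_sq_eq_sum, kin, ← hv]
    simp only [rel, PiLp.sub_apply]
    ring
  have k1 : ∫ x in P.Ω, 1 / 2 * rho τ x * ‖u τ x - P.uB x‖ ^ 2 =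
      ∫ x in P.Ω, rho τ x * kin P u (τ, x) :=
    integral_congr_ae (Eventually.of_forall fun x => by
      simp only [hkin _ τ x rfl]
      ring)
  have k0 : ∫ x in P.Ω, 1 / 2 * P.rho0 x * ‖P.u0 x - P.uB x‖ ^ 2 =
      ∫ x in P.Ω, rho 0 x * kin P u (0, x) := by
    refine integral_congr_ae ?_
    filter_upwards [h.ae_initial] with x hx
    rw [hkin _ 0 x hx.2, hx.1]
    ring
  -- pressure
  have hgp : IntegrableOn (fun z : ℝ × E3 => (P.gradB z.2).trace) P.Q :=
    h.integrableOn_of_continuousOn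
      (continuousOn_finsetSum _ fun i _ => h.gradB_continuousOn_Qc i i)
  have hpi : ∫ z in P.Qτ τ, (P.gradB z.2).trace ∂pi =
      ∫ z in P.Qτ τ, p z.1 z.2 * (P.gradB z.2).trace :=
    h.setIntegral_pressure (isOpen_Ioo.prod h.adm.domain.isOpen) hsub
      ((continuousOn_finsetSum _ fun i _ => h.gradB_continuousOn_Qc i i).mono Q_subset_Qc)
      h.sol.pi_pairing hgp
  have ip : ∀ i, IntegrableOn (fun z : ℝ × E3 => p z.1 z.2 * dx i (rel P u i) z) (P.Qτ τ) :=
    fun i => (h.pressure_mul_integrable (h.dx_integrable (h.rel_contDiffOn i) i)).mono_set hsub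
  have hpr : ∑ i, ∫ z in P.Qτ τ, p z.1 z.2 * dx i (rel P u i) z =
      - ∫ z in P.Qτ τ, (P.gradB z.2).trace ∂pi := by
    rw [hpi, ← integral_neg, ← integral_finsetSum _ fun i _ => ip i]
    refine setIntegral_congr_fun hmeas fun z hz => ?_
    have h0 := h.pressure_mul_div_eq_zero (hsub hz)
    simp only [h.dx_rel (hsub hz), mul_sub, Finset.sum_sub_distrib, ← Finset.mul_sum, h0, zero_sub]
    rfl
  -- stress
  have iSv := fun i j => (h.stress_mul_dx_vel_integrable i j).mono_set hsub
  have iSB := fun i j => (h.stress_mul_gradB_integrable i j).mono_set hsub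
  have hst : ∑ i, ∑ j, ∫ z in P.Qτ τ, S z.1 z.2 i j * dx j (rel P u i) z =
      (∑ i, ∑ j, ∫ z in P.Qτ τ, S z.1 z.2 i j * dx j (vel u i) z)
      - ∫ z in P.Qτ τ, frob (S z.1 z.2) (P.gradB z.2) := by
    simp only [frob]
    rw [integral_finsetSum _ fun i _ => integrable_finsetSum _ fun j _ => iSB i j]
    rw [← Finset.sum_sub_distrib]
    refine Finset.sum_congr rfl fun i _ => ?_
    rw [integral_finsetSum _ fun j _ => iSB i j, ← Finset.sum_sub_distrib]
    refine Finset.sum_congr rfl fun j _ => ?_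
    rw [← integral_sub (iSv i j) (iSB i j)]
    refine setIntegral_congr_fun hmeas fun z hz => ?_
    simp only [h.dx_rel (hsub hz), mul_sub]
  -- defect
  have hpair : |∫ t in Ioo 0 τ, (R t).pairing (closure P.Ω) P.gradB| ≤
      9 * B * ∫ t in Ioo 0 τ, defectTrace P R t := by
    rw [← integral_const_mul, ← Real.norm_eq_abs]
    have hsubI : Ioo 0 τ ⊆ Ioo 0 P.T := Ioo_subset_Ioo_right hτT
    refine norm_integral_le_of_norm_le
      ((h.defectTrace_integrable.mono_set hsubI).const_mul _) ?_
    filter_upwards [ae_restrict_of_ae_restrict_of_subset hsubI h.sol.defect.pos] with t ht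
    exact ht.abs_pairing_le isClosed_closure.measurableSet isClosed_closure.measurableSet
      subset_rfl hB0 hB
  have hQτ : Ioo 0 τ ×ˢ P.Ω = P.Qτ τ := rfl
  rw [k1, k0, hQτ] at hen
  rw [hst, hpr] at hmom
  have hmom' := (abs_le.1 hmom).1
  have hpair' := (abs_le.1 hpair).1
  have hdis : ∫⁻ z in P.Qτ τ, dissip P S G z = ∫⁻ z in P.Qτ τ,
      (ENNReal.ofReal (P.F (symPart (G z.1 z.2))) + (conjugate P.F (S z.1 z.2)).toENNReal) := rfl
  have hr : defectTrace P R τ = (R τ (closure P.Ω)).trace := rfl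
  rw [hdis, hr]
  linarith

end IsRegularSolution

end Data

/-! ### The defect vanishes -/

/-- Gronwall's lemma for integrable functions. -/
lemma ae_eq_zero_of_le_mul_integral {T D : ℝ} {r : ℝ → ℝ} (hD : 0 ≤ D)
    (hr : IntegrableOn r (Ioo 0 T)) (h0 : ∀ᵐ t ∂(volume.restrict (Ioo 0 T)), 0 ≤ r t)
    (hle : ∀ᵐ t ∂(volume.restrict (Ioo 0 T)), r t ≤ D * ∫ s in Ioo 0 t, r s) :
    ∀ᵐ t ∂(volume.restrict (Ioo 0 T)), r t = 0 := by
  rcases le_or_gt T 0 with hT | hT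
  · rw [Ioo_eq_empty hT.not_gt]; simp
  let r' : ℝ → ℝ := (Ioo 0 T).indicator r
  have hr' : Integrable r' := hr.integrable_indicator measurableSet_Ioo
  have h0' : ∀ᵐ t, 0 ≤ r' t := by
    filter_upwards [(ae_restrict_iff' measurableSet_Ioo).1 h0] with t ht
    by_cases h : t ∈ Ioo 0 T
    · simpa only [r', indicator_of_mem h] using ht h
    · simp only [r', indicator_of_notMem h, le_refl]
  let M : ℝ → ℝ := fun τ => ∫ s in (0 : ℝ)..τ, r' s
  have hMc : Continuous M := intervalIntegral.continuous_primitive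
    (fun a b => hr'.intervalIntegrable) 0
  have hM : ∀ t ∈ Ioo 0 T, M t = ∫ s in Ioo 0 t, r s := fun t ht => by
    simp only [M]
    rw [intervalIntegral.integral_of_le ht.1.le, integral_Ioc_eq_integral_Ioo]
    exact setIntegral_congr_fun measurableSet_Ioo fun s hs =>
      indicator_of_mem (s := Ioo 0 T) ⟨hs.1, hs.2.trans ht.2⟩ r
  have hM0 : ∀ t, 0 ≤ t → 0 ≤ M t := fun t ht =>
    intervalIntegral.integral_nonneg_of_ae ht h0'
  let N : ℝ → ℝ := fun τ => ∫ s in (0 : ℝ)..τ, M s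
  have hN : ∀ t, HasDerivAt N (M t) t := fun t =>
    intervalIntegral.integral_hasDerivAt_right (hMc.intervalIntegrable _ _)
      hMc.aestronglyMeasurable.stronglyMeasurableAtFilter hMc.continuousAt
  have hN0 : ∀ t, 0 ≤ t → 0 ≤ N t := fun t ht =>
    intervalIntegral.integral_nonneg ht fun s hs => hM0 s hs.1
  have hMN : ∀ t, 0 ≤ t → M t ≤ D * N t := fun t ht => by
    simp only [M, N]
    rw [← intervalIntegral.integral_const_mul]
    refine intervalIntegral.integral_mono_ae_restrict ht hr'.intervalIntegrable
      ((continuous_const.mul hMc).intervalIntegrable _ _) ?_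
    filter_upwards [ae_restrict_of_ae ((ae_restrict_iff' measurableSet_Ioo).1 hle),
      ae_restrict_mem measurableSet_Icc] with s hs hst
    by_cases h : s ∈ Ioo 0 T
    · change r' s ≤ D * M s
      rw [hM s h]
      simpa only [r', indicator_of_mem h] using hs h
    · simp only [r', indicator_of_notMem h]
      exact mul_nonneg hD (hM0 s hst.1)
  have hNz : ∀ t ∈ Icc 0 T, N t = 0 :=
    eq_zero_of_abs_deriv_le_mul_abs_self_of_eq_zero_right (K := D)
      (fun t _ => (hN t).continuousAt.continuousWithinAt)
      (fun t _ => (hN t).hasDerivWithinAt) (by simp [N]) fun t ht => by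
        rw [Real.norm_eq_abs, Real.norm_eq_abs, abs_of_nonneg (hM0 t ht.1),
          abs_of_nonneg (hN0 t ht.1)]
        exact hMN t ht.1
  filter_upwards [h0, hle, ae_restrict_mem measurableSet_Ioo] with t h1 h2 ht
  have h3 := hMN t ht.1.le
  rw [hNz t (Ioo_subset_Icc_self ht), mul_zero, hM t ht] at h3
  have := mul_nonneg hD (sub_nonneg.2 h3)
  linarith

lemma TensorMeasure.pairing_zero (K : Set E3) (A : E3 → M3) :
    (0 : TensorMeasure).pairing K A = 0 := by
  have h0 : ∀ i j, (0 : TensorMeasure).entry i j = 0 := fun i j => by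
    ext A hA
    rfl
  simp [TensorMeasure.pairing, h0]

namespace Data

/-- The excess `F(𝔻u) + F*(𝕊) - 𝕊 : ∇u` in the Fenchel–Young inequality. -/
noncomputable def excess (P : Data) (u : ℝ → E3 → E3) (S : ℝ → E3 → M3)
    (G : ℝ → E3 → M3) (z : ℝ × E3) : ℝ :=
  (dissip P S G z).toReal - ∑ i, ∑ j, S z.1 z.2 i j * dx j (vel u i) z

namespace IsRegularSolution

variable {P : Data} {rho : ℝ → E3 → ℝ} {u : ℝ → E3 → E3} {S : ℝ → E3 → M3}
  {pi : Measure (ℝ × E3)} {R : ℝ → TensorMeasure} {p : ℝ → E3 → ℝ} {G : ℝ → E3 → M3}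
  {m : ℝ → E3 → E3} (h : P.IsRegularSolution rho u S pi R p G m)

include h

lemma dissip_aemeasurable : AEMeasurable (dissip P S G) (volume.restrict P.Q) := by
  have hG : AEMeasurable (fun z : ℝ × E3 => (fun i j => G z.1 z.2 i j : Fin 3 → Fin 3 → ℝ))
      (volume.restrict P.Q) :=
    aemeasurable_pi_lambda _ fun i => aemeasurable_pi_lambda _ fun j =>
      (h.sol.G_memLp i j).aestronglyMeasurable.aemeasurable
  have hS : AEMeasurable (fun z : ℝ × E3 => (fun i j => S z.1 z.2 i j : Fin 3 → Fin 3 → ℝ))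
      (volume.restrict P.Q) :=
    aemeasurable_pi_lambda _ fun i => aemeasurable_pi_lambda _ fun j =>
      (h.sol.S_integrable i j).aestronglyMeasurable.aemeasurable
  exact ((h.adm.potential.continuous_symPart.measurable.comp_aemeasurable hG).ennreal_ofReal).add
    ((IsPotential.measurable_conjugate (F := P.F)).comp_aemeasurable hS).ereal_toENNReal

lemma ae_dissip_toReal : ∀ᵐ z ∂(volume.restrict P.Q),
    (conjugate P.F (S z.1 z.2)).toENNReal ≠ ⊤ ∧ (dissip P S G z).toReal =
      P.F (symPart (grad (u z.1) z.2)) + (conjugate P.F (S z.1 z.2)).toENNReal.toReal ∧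
    ∑ i, ∑ j, S z.1 z.2 i j * dx j (vel u i) z =
      frob (S z.1 z.2) (symPart (grad (u z.1) z.2)) := by
  filter_upwards [ae_lt_top' h.dissip_aemeasurable h.sol.dissipation_finite, h.sol.S_symm,
    h.ae_weakGradient_eq, ae_restrict_mem h.adm.measurableSet_Q] with z hfin hS hG hz
  have hGg : G z.1 z.2 = grad (u z.1) z.2 := by
    ext i j
    rw [hG i j, h.grad_eq_dx hz]
  have htop : (conjugate P.F (S z.1 z.2)).toENNReal ≠ ⊤ := (ENNReal.add_lt_top.1 hfin).2.ne
  refine ⟨htop, ?_, ?_⟩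
  · rw [dissip, ENNReal.toReal_add ENNReal.ofReal_ne_top htop,
      ENNReal.toReal_ofReal (h.adm.potential.nonneg _ (isSymm_symPart _)), hGg]
  · rw [frob_symPart hS]
    simp only [frob, h.grad_eq_dx hz]

lemma ae_excess_nonneg : ∀ᵐ z ∂(volume.restrict P.Q), 0 ≤ excess P u S G z := by
  filter_upwards [h.ae_dissip_toReal] with z hz
  rw [excess, hz.2.1, hz.2.2]
  have := IsPotential.le_toReal_conjugate hz.1 (isSymm_symPart (grad (u z.1) z.2))
  linarith

lemma excess_integrable : IntegrableOn (excess P u S G) P.Q :=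
  (integrable_toReal_of_lintegral_ne_top h.dissip_aemeasurable h.sol.dissipation_finite).sub
    (integrable_finsetSum _ fun i _ => integrable_finsetSum _ fun j _ =>
      h.stress_mul_dx_vel_integrable i j)

lemma setIntegral_excess {τ : ℝ} (hτ : τ ≤ P.T) : ∫ z in P.Qτ τ, excess P u S G z =
    (∫⁻ z in P.Qτ τ, dissip P S G z).toReal
      - ∑ i, ∑ j, ∫ z in P.Qτ τ, S z.1 z.2 i j * dx j (vel u i) z := by
  have hsub := Qτ_subset_Q (P := P) hτ
  have i1 : IntegrableOn (fun z => (dissip P S G z).toReal) (P.Qτ τ) :=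
    IntegrableOn.mono_set (integrable_toReal_of_lintegral_ne_top h.dissip_aemeasurable
      h.sol.dissipation_finite) hsub
  have i2 := fun i j => (h.stress_mul_dx_vel_integrable i j).mono_set hsub
  have i3 : ∀ i, IntegrableOn (fun z => ∑ j, S z.1 z.2 i j * dx j (vel u i) z) (P.Qτ τ) := fun i =>
    integrable_finsetSum _ fun j _ => i2 i j
  have hfin : ∀ᵐ z ∂(volume.restrict P.Q), dissip P S G z < ⊤ :=
    ae_lt_top' h.dissip_aemeasurable h.sol.dissipation_finite
  simp only [excess]
  rw [integral_sub i1 (integrable_finsetSum _ fun i _ => i3 i),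
    integral_toReal (h.dissip_aemeasurable.mono_measure (Measure.restrict_mono hsub le_rfl))
      (ae_restrict_of_ae_restrict_of_subset hsub hfin),
    integral_finsetSum _ fun i _ => i3 i]
  exact congrArg _ (Finset.sum_congr rfl fun i _ => integral_finsetSum _ fun j _ => i2 i j)

lemma ae_defectTrace_eq_zero : ∀ᵐ t ∂(volume.restrict (Ioo 0 P.T)), defectTrace P R t = 0 := by
  obtain ⟨D, hD0, hD⟩ := h.exists_relative_energy_bound
  have hd := h.adm.dbar_pos
  refine ae_eq_zero_of_le_mul_integral (D := P.dbar * D) (by positivity) h.defectTrace_integrable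
    h.ae_defectTrace_nonneg ?_
  filter_upwards [hD, ae_restrict_mem measurableSet_Ioo] with τ h1 hτ
  rw [← h.setIntegral_excess hτ.2.le] at h1
  have h2 : 0 ≤ ∫ z in P.Qτ τ, excess P u S G z :=
    integral_nonneg_of_ae
      (ae_restrict_of_ae_restrict_of_subset (Qτ_subset_Q hτ.2.le) h.ae_excess_nonneg)
  have h3 : 1 / P.dbar * defectTrace P R τ ≤ D * ∫ t in Ioo 0 τ, defectTrace P R t := by linarith
  rw [one_div, inv_mul_le_iff₀ hd] at h3
  rwa [mul_assoc]

/-- The Reynolds defect vanishes. -/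
lemma ae_defect_eq_zero : ∀ᵐ t ∂(volume.restrict (Ioo 0 P.T)), R t = 0 := by
  filter_upwards [h.ae_defectTrace_eq_zero, h.sol.defect.pos] with t h1 h2
  exact h2.eq_zero_of_trace isClosed_closure.measurableSet h1

/-- Without defect there is equality in the Fenchel–Young inequality. -/
lemma ae_excess_eq_zero : ∀ᵐ z ∂(volume.restrict P.Q), excess P u S G z = 0 := by
  obtain ⟨D, -, hD⟩ := h.exists_relative_energy_bound
  have hτ : ∀ᵐ τ ∂(volume.restrict (Ioo 0 P.T)),
      ∀ᵐ z ∂(volume.restrict (P.Qτ τ)), excess P u S G z = 0 := by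
    filter_upwards [hD, h.ae_defectTrace_eq_zero, ae_restrict_mem measurableSet_Ioo] with τ h1 h2 hτ
    have hsub := Qτ_subset_Q (P := P) hτ.2.le
    have h3 : ∫ t in Ioo 0 τ, defectTrace P R t = 0 :=
      integral_eq_zero_of_ae (ae_restrict_of_ae_restrict_of_subset
        (Ioo_subset_Ioo_right hτ.2.le) h.ae_defectTrace_eq_zero)
    rw [← h.setIntegral_excess hτ.2.le, h2, h3, mul_zero, mul_zero, add_zero] at h1
    have h4 := ae_restrict_of_ae_restrict_of_subset hsub h.ae_excess_nonneg
    exact (integral_eq_zero_iff_of_nonneg_ae h4 (h.excess_integrable.mono_set hsub)).1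
      (le_antisymm h1 (integral_nonneg_of_ae h4))
  have hT := h.adm.T_pos
  -- admissible times that increase to `T`
  have hex : ∀ k : ℕ, ∃ τ ∈ Ioo (P.T - P.T / (k + 1)) P.T,
      ∀ᵐ z ∂(volume.restrict (P.Qτ τ)), excess P u S G z = 0 := fun k => by
    have hk : 0 < P.T / (k + 1) := by positivity
    have hk' : P.T / (k + 1) ≤ P.T := div_le_self hT.le (by norm_cast; omega)
    have hne : (ae (volume.restrict (Ioo (P.T - P.T / (k + 1)) P.T))).NeBot := by
      rw [ae_neBot, Ne, Measure.restrict_eq_zero, Real.volume_Ioo, ENNReal.ofReal_eq_zero, not_le]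
      linarith
    have h1 := ae_restrict_of_ae_restrict_of_subset
      (Ioo_subset_Ioo_left (sub_nonneg.2 hk') : Ioo (P.T - P.T / (k + 1)) P.T ⊆ Ioo 0 P.T) hτ
    exact (((ae_restrict_mem measurableSet_Ioo).and h1).exists)
  choose τ hτm hτe using hex
  have hQ : P.Q ⊆ ⋃ k, P.Qτ (τ k) := by
    rintro ⟨t, x⟩ ⟨ht, hx⟩
    obtain ⟨k, hk⟩ := exists_nat_gt (P.T / (P.T - t))
    have ht' : 0 < P.T - t := sub_pos.2 ht.2
    have h1 : P.T / (k + 1) < P.T - t := by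
      rw [div_lt_iff₀ (by positivity)]
      rw [div_lt_iff₀ ht'] at hk
      nlinarith
    exact mem_iUnion.2 ⟨k, ⟨ht.1, by have := (hτm k).1; linarith⟩, hx⟩
  exact ae_restrict_of_ae_restrict_of_subset hQ ((ae_restrict_iUnion_iff _ _).2 hτe)

/-- The constitutive relation. -/
lemma ae_memSubdifferential : ∀ᵐ z ∂(volume.restrict P.Q),
    MemSubdifferential P.F (symPart (grad (u z.1) z.2)) (S z.1 z.2) := by
  filter_upwards [h.ae_excess_eq_zero, h.ae_dissip_toReal, h.sol.S_symm] with z h0 hz hS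
  rw [excess, hz.2.1, hz.2.2] at h0
  exact IsPotential.memSubdifferential_of_le hS hz.1 (by linarith)

/-! ### The momentum equation in the classical sense -/

/-- The momentum equation without defect. -/
lemma momentum_weak {φ : ℝ → E3 → E3} (hφ : ContDiff ℝ 1 (fun z : ℝ × E3 => φ z.1 z.2))
    (hc : HasCompactSupport (fun z : ℝ × E3 => φ z.1 z.2))
    (hsub : tsupport (fun z : ℝ × E3 => φ z.1 z.2) ⊆ P.Q) :
    ∫ z in P.Q, ∑ i, inertia rho u z.1 z.2 i * φ z.1 z.2 i =
      - (∫ z in P.Q, frob (S z.1 z.2) (grad (φ z.1) z.2))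
      + ∫ z in P.Q, p z.1 z.2 * (grad (φ z.1) z.2).trace := by
  have h0 : ∫ t in Ioo 0 P.T, (R t).pairing P.Ω (grad (φ t)) = 0 := by
    refine integral_eq_zero_of_ae ?_
    filter_upwards [h.ae_defect_eq_zero] with t ht
    rw [ht, TensorMeasure.pairing_zero]
    rfl
  rw [h.momentum_test hφ hc hsub, h0, add_zero]

lemma momentum_classical {U : Set (ℝ × E3)} (hU : IsOpen U) (hUQ : U ⊆ P.Q) {S' : ℝ → E3 → M3}
    (hSS' : ∀ᵐ z ∂(volume.restrict U), S' z.1 z.2 = S z.1 z.2)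
    (hS' : ∀ i j, ContDiffOn ℝ 1 (fun z : ℝ × E3 => S' z.1 z.2 i j) U)
    (hp' : ContDiffOn ℝ 1 (fun z : ℝ × E3 => p z.1 z.2) U) (i : Fin 3) :
    ∀ z ∈ U, inertia rho u z.1 z.2 i - ∑ j, dx j (fun z => S' z.1 z.2 i j) z
      + dx i (fun z => p z.1 z.2) z = 0 := by
  refine eq_zero_of_setIntegral_smooth_mul (μ := (volume : Measure (ℝ × E3))) hU
    ((((h.inertia_continuousOn i).mono hUQ).sub (continuousOn_finsetSum _ fun j _ =>
      continuousOn_dx hU (hS' i j) j)).add (continuousOn_dx hU hp' i)) ?_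
  intro g hg hgc hgs
  have hg1 : ContDiff ℝ 1 g := hg.of_le (by exact_mod_cast le_top)
  let φ : ℝ → E3 → E3 := fun t x => EuclideanSpace.single i (g (t, x))
  have hφk : ∀ (z : ℝ × E3) k, φ z.1 z.2 k = if k = i then g z else 0 := fun z k => by
    simp [φ]
  have hφ : ContDiff ℝ 1 (fun z : ℝ × E3 => φ z.1 z.2) := by
    rw [contDiff_euclidean]
    intro k
    simp only [hφk]
    split_ifs
    · exact hg1
    · exact contDiff_const
  have hφs : tsupport (fun z : ℝ × E3 => φ z.1 z.2) ⊆ tsupport g := by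
    refine closure_mono fun z hz hgz => hz ?_
    ext k
    rw [hφk, hgz]
    simp
  have hgrad : ∀ (z : ℝ × E3) k j, grad (φ z.1) z.2 k j = if k = i then dx j g z else 0 := by
    intro z k j
    rw [grad_slice_eq_dx (hφ.differentiable one_ne_zero z)]
    simp only [hφk]
    split_ifs
    · rfl
    · simp [dx]
  have hw := h.momentum_weak hφ (hgc.of_isClosed_subset (isClosed_tsupport _) hφs)
    (hφs.trans (hgs.trans hUQ))
  have r1 : ∀ z : ℝ × E3, ∑ k, inertia rho u z.1 z.2 k * φ z.1 z.2 k =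
      inertia rho u z.1 z.2 i * g z := fun z => by
    simp [hφk]
  have r2 : ∀ z : ℝ × E3, frob (S z.1 z.2) (grad (φ z.1) z.2) =
      ∑ j, S z.1 z.2 i j * dx j g z := fun z => by
    simp only [frob, hgrad]
    rw [Finset.sum_eq_single i (fun k _ hk => by simp [hk]) (by simp)]
    simp
  have r3 : ∀ z : ℝ × E3, (grad (φ z.1) z.2).trace = dx i g z := fun z => by
    simp [Matrix.trace, hgrad]
  simp only [r1, r2, r3] at hw
  -- all integrals live on `U`
  have hdg0 : ∀ j, ∀ z ∉ U, dx j g z = 0 := fun j z hz =>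
    image_eq_zero_of_notMem_tsupport fun h' => hz (hgs (tsupport_dx_subset g j h'))
  have hg0 : ∀ z ∉ U, g z = 0 := fun z hz =>
    image_eq_zero_of_notMem_tsupport fun h' => hz (hgs h')
  have hres : ∀ f : ℝ × E3 → ℝ, (∀ z ∉ U, f z = 0) → ∫ z in P.Q, f z = ∫ z in U, f z :=
    fun f hf => setIntegral_eq_of_subset_of_forall_sdiff_eq_zero h.adm.measurableSet_Q hUQ
      fun z hz => hf z hz.2
  rw [hres _ fun z hz => by rw [hg0 z hz, mul_zero],
    hres _ fun z hz => by simp [hdg0 _ z hz], hres _ fun z hz => by rw [hdg0 _ z hz, mul_zero]] at hw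
  have s2 : ∫ z in U, ∑ j, S z.1 z.2 i j * dx j g z =
      ∑ j, ∫ z in U, S' z.1 z.2 i j * dx j g z := by
    rw [← integral_finsetSum _ fun j _ => (integrable_mul_of_tsupport_subset hU
      (hS' i j).continuousOn (continuous_dx hg1 j) (hgc.fderiv_apply ℝ _)
      ((tsupport_dx_subset g j).trans hgs)).integrableOn]
    refine integral_congr_ae ?_
    filter_upwards [hSS'] with z hz
    rw [hz]
  have ibp : ∀ f : ℝ × E3 → ℝ, ContDiffOn ℝ 1 f U → ∀ j,
      ∫ z in U, f z * dx j g z = - ∫ z in U, dx j f z * g z := fun f hf j =>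
    setIntegral_mul_fderiv hU hf hg1 hgc hgs _
  rw [s2, Finset.sum_congr rfl fun j _ => ibp _ (hS' i j) j, ibp _ hp' i] at hw
  have imul : ∀ f : ℝ × E3 → ℝ, ContinuousOn f U → IntegrableOn (fun z => f z * g z) U :=
    fun f hf => (integrable_mul_of_tsupport_subset hU hf hg1.continuous hgc hgs).integrableOn
  have j1 := imul _ ((h.inertia_continuousOn i).mono hUQ)
  have j2 := fun j => imul _ (continuousOn_dx hU (hS' i j) j)
  have j3 := imul _ (continuousOn_dx hU hp' i)
  have e : ∀ z : ℝ × E3, g z * (inertia rho u z.1 z.2 i - ∑ j, dx j (fun z => S' z.1 z.2 i j) z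
      + dx i (fun z => p z.1 z.2) z) = inertia rho u z.1 z.2 i * g z
      - ∑ j, dx j (fun z => S' z.1 z.2 i j) z * g z + dx i (fun z => p z.1 z.2) z * g z := fun z => by
    rw [← Finset.sum_mul]
    ring
  simp_rw [e]
  have j4 : IntegrableOn (fun z => ∑ j, dx j (fun z => S' z.1 z.2 i j) z * g z) U :=
    integrable_finsetSum _ fun j _ => j2 j
  refine (integral_add (j1.sub j4) j3).trans ?_
  simp only [Pi.sub_apply]
  rw [integral_sub j1 j4, integral_finsetSum _ fun j _ => j2 j, hw, Finset.sum_neg_distrib]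
  ring

lemma isClassical : P.IsClassical rho u S p where
  continuity t ht x hx := by
    have hz : (t, x) ∈ P.Q := ⟨ht, hx⟩
    have hr := h.dens_contDiffOn
    have e := h.continuity_eq hz
    rw [← deriv_slice_eq_dt (h.differentiableAt hr hz)] at e
    simp only [← fun j => pderiv_slice_eq_dx
      (h.differentiableAt (hr.mul (h.vel_contDiffOn j)) hz) j] at e
    exact e
  momentum φ := h.momentum_weak
  momentum_pointwise U S' hU hUQ hSS' hS' hp' t x hz i := by
    have e := h.momentum_classical hU hUQ hSS' hS' hp' i (t, x) hz
    have hd : ∀ {f : ℝ × E3 → ℝ}, ContDiffOn ℝ 1 f U → DifferentiableAt ℝ f (t, x) := fun hf =>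
      (hf.contDiffAt (hU.mem_nhds hz)).differentiableAt one_ne_zero
    rw [← pderiv_slice_eq_dx (hd hp')] at e
    simp only [← fun j => pderiv_slice_eq_dx (hd (hS' i j)) j] at e
    exact e
  rho_bounds t ht x hx := h.dens_bounds (t, x) ⟨ht, hx⟩
  div_free t ht x hx h1 := by
    rw [← h.div_eq_zero (z := (t, x)) ⟨ht, hx⟩ h1]
    exact Finset.sum_congr rfl fun i _ => h.grad_eq_dx (z := (t, x)) ⟨ht, hx⟩ i i
  p_free t ht x hx h1 := h.pressure_eq_zero (z := (t, x)) ⟨ht, hx⟩ h1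
  p_nonneg t ht x hx _ := h.pressure_nonneg (t, x) ⟨ht, hx⟩

end IsRegularSolution

end Data

end FreeBoundary

theorem theorem2 (P : FreeBoundary.Data) (hP : P.Admissible)
    (rho : ℝ → FreeBoundary.E3 → ℝ) (u : ℝ → FreeBoundary.E3 → FreeBoundary.E3)
    (S : ℝ → FreeBoundary.E3 → FreeBoundary.M3) (pi : Measure (ℝ × FreeBoundary.E3))
    (R : ℝ → FreeBoundary.TensorMeasure) (p : ℝ → FreeBoundary.E3 → ℝ)
    (hsol : P.IsDissipativeSolution rho u S pi R)
    (hu : ContDiffOn ℝ 1 (fun z : ℝ × FreeBoundary.E3 => u z.1 z.2) P.Qc)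
    (hrho : ContDiffOn ℝ 1 (fun z : ℝ × FreeBoundary.E3 => rho z.1 z.2) P.Qc)
    (hinf : ∃ c : ℝ, 0 < c ∧ ∀ z ∈ P.Q, c ≤ rho z.1 z.2)
    (hp : P.HasContinuousDensity pi p) :
    P.IsClassical rho u S p ∧
    (∀ᵐ t ∂(volume.restrict (Ioo 0 P.T)), R t = 0) ∧
    (∀ᵐ z ∂(volume.restrict P.Q),
      FreeBoundary.MemSubdifferential P.F (FreeBoundary.symPart (FreeBoundary.grad (u z.1) z.2))
        (S z.1 z.2)) := by
  obtain ⟨G, m, hsol⟩ := hsol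
  have h : P.IsRegularSolution rho u S pi R p G m := ⟨hP, hsol, hu, hrho, hinf, hp⟩
  exact ⟨h.isClassical, h.ae_defect_eq_zero, h.ae_memSubdifferential⟩
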